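/- **Theorem.** Let $\mathbb K$ be $\mathbb R$ or $\mathbb C$, let $n\ge 3$, and let $r_1,\dots,r_n\in\mathbb K$ be pairwise distinct. *The system.* For $u=(u^1,\dots,u^{n-1})$ write $u_k=\partial^k u/\partial x^k$, $\langle v,w\rangle=\sum_i v^iw^i$ and $\Delta=1+\langle u,u\rangle$. The $n$-component Landau–Lifshitz system in stereographic coordinates is the evolution system $$ \begin{aligned} u_t={}&u_{xxx}-6\langle u,u_x\rangle\Delta^{-1}u_{xx} +\bigl(-6\langle u,u_{xx}\rangle\Delta^{-1}+24\langle u,u_x\rangle^2\Delta^{-2}-6\langle u,u\rangle\langle u_x,u_x\rangle\Delta^{-2}\bigr)u_x\\ &+\bigl(6\langle u_x,u_{xx}\rangle\Delta^{-1}-12\langle u,u_x\rangle\langle u_x,u_x\rangle\Delta^{-2}\bigr)u +\tfrac32\Bigl(r_n+4\Delta^{-2}\sum_{i=1}^{n-1}(r_i-r_n)(u^i)^2\Bigr)u_x . \end{aligned} $$ Write it as $u^i_t=F^i(u,u_1,u_2,u_3)$. Let $\mathcal E'$ be the set of points $a=(a^i_k)$, $1\le i\le n-1$, $k\ge 0$,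 $a^i_k\in\mathbb K$, with $1+\sum_i(a^i_0)^2\ne 0$. *The Wahlquist–Estabrook algebra.* Let $a\in\mathcal E'$. Let $\mathfrak F$ be the free Lie algebra over $\mathbb K$ on symbols $\mathbf A_\alpha$ and $\mathbf B_\beta$, where $\alpha$ runs over the $(n-1)\times 1$ matrices and $\beta$ over the $(n-1)\times 3$ matrices with entries in $\mathbb Z_{\ge0}$. Let $\mathbf A=\sum_\alpha \mathbf A_\alpha U^\alpha$ and $\mathbf B=\sum_\beta\mathbf B_\beta U^\beta$, where $U^\gamma=\prod_{i,k}(u^i_k-a^i_k)^{\gamma_{ik}}$. With $D_x=\sum_{i,k}u^i_{k+1}\partial/\partial u^i_k$ and $D_t(\mathbf A)=\sum_i F^i\,\partial\mathbf A/\partial u^i_0$, where $F^i$ is replaced by its Taylor series at $a$, write $$D_x(\mathbf B)-D_t(\mathbf A)+[\mathbf A,\mathbf B]=\sum_\gamma z_\gamma U^\gamma,\qquad z_\gamma\in\mathfrak F,$$ where $\gamma$ runs over the $(n-1)\times 4$ matrices with entries in $\mathbb Z_{\ge0}$. Then $\mathfrak W(a)$ is the quotient of $\mathfrak F$ by the ideal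 generated by all $z_\gamma$. *The algebras $\mathfrak g(n)$ and $L(n)$.* Let $\mathfrak g(n)$ be the Lie algebra over $\mathbb K$ given by generators $p_1,\dots,p_n$ and the relations $$[p_i,[p_j,p_k]]=0\quad(i\ne j\ne k\ne i),\qquad [p_i,[p_i,p_k]]-[p_j,[p_j,p_k]]=(r_j-r_i)p_k\quad(i\ne k,\ j\ne k),\qquad(*)$$ with $i,j,k\in\{1,\dots,n\}$. Let $\mathcal Q=\mathbb K[\lambda_1,\dots,\lambda_n]/(\lambda_i^2-\lambda_j^2+r_i-r_j\mid i,j=1,\dots,n)$, and let $\mathfrak{so}_{n,1}\subset\mathfrak{gl}_{n+1}(\mathbb K)$ be the Lie algebra of matrices that are skew-adjoint for the bilinear form $\mathrm{diag}(1,\dots,1,-1)$. Let $L(n)\subset\mathfrak{so}_{n,1}\otimes_{\mathbb K}\mathcal Q$ be the Lie subalgebra over $\mathbb K$ generated by $Q_i=(E_{i,n+1}+E_{n+1,i})\otimes\lambda_i$, $i=1,\dots,n$. *Claim.* For every $a\in\mathcal E'$, the algebra $\mathfrak W(a)$ is isomorphic to the Lie algebra given by generators $p_0,p_1,\dots,p_{n+1}$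 and the relations $$[p_0,p_l]=[p_{n+1},p_l]=[p_0,p_{n+1}]=0\qquad(l=1,\dots,n)$$ together with $(*)$. Identify the two algebras. Then $\mathfrak W(a)$ is the direct sum of the 2-dimensional abelian subalgebra $\mathbb K^2$ spanned by $p_0,p_{n+1}$ and the subalgebra generated by $p_1,\dots,p_n$; the latter is isomorphic to $\mathfrak g(n)$ by an isomorphism that sends each generator $p_i$ to $p_i$. Thus $\mathfrak W(a)\cong\mathbb K^2\oplus\mathfrak g(n)$. Moreover, there is an isomorphism $\mathbb K^2\oplus L(n)\cong\mathfrak W(a)$ that maps the standard basis of $\mathbb K^2$ to $p_0,p_{n+1}$ and maps $Q_i$ to $p_i$ for $i=1,\dots,n$. -/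

import Mathlib

open scoped TensorProduct

noncomputable section

/-! ### Taylor series of scalar functions of finitely many variables -/

section Taylor

variable {𝕜 : Type*} [RCLike 𝕜] {σ : Type*} [Fintype σ] [DecidableEq σ]

/-- The partial derivative `∂f/∂x_s` (complex derivative if `𝕜 = ℂ`). -/
def partialDeriv (s : σ) (f : (σ → 𝕜) → 𝕜) : (σ → 𝕜) → 𝕜 :=
  fun x => fderiv 𝕜 f x (Pi.single s 1)

/-- The iterated partial derivative `∂^γ f`: each `∂/∂x_s` is applied `γ s` times. The order in
which the partial derivatives are listed does not matter for the (analytic) functions that are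
differentiated below. -/
def iteratedPartial (γ : σ →₀ ℕ) (f : (σ → 𝕜) → 𝕜) : (σ → 𝕜) → 𝕜 :=
  (Finsupp.toMultiset γ).toList.foldr partialDeriv f

/-- The Taylor series of `f` at `a`, as a formal power series in the variables `x_s - a_s`:
the coefficient at `γ` is `(∂^γ f)(a) / γ!`. -/
def taylorSeries (f : (σ → 𝕜) → 𝕜) (a : σ → 𝕜) : MvPowerSeries σ 𝕜 :=
  fun γ => ((∏ s, (γ s).factorial : ℕ) : 𝕜)⁻¹ * iteratedPartial γ f a

end Taylor

/-! ### Formal power series with coefficients in a Lie algebra -/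

/-- Formal power series `∑_γ c_γ X^γ` in the variables `X_s`, `s : σ`, with coefficients `c_γ`
in `L`, given by the family of coefficients. -/
abbrev FormalSeries (σ L : Type*) := (σ →₀ ℕ) → L

namespace FormalSeries

variable {𝕜 : Type*} [Field 𝕜] {σ τ : Type*} {L : Type*} [LieRing L]
  [LieAlgebra 𝕜 L]

/-- The partial derivative of a power series with respect to `X_s`. -/
def pderiv (s : σ) (c : FormalSeries σ L) : FormalSeries σ L :=
  fun γ => (γ s + 1) • c (γ + Finsupp.single s 1)

/-- The product of a scalar power series with an `L`-valued power series. -/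
def scalarMul [DecidableEq σ] (f : MvPowerSeries σ 𝕜) (c : FormalSeries σ L) : FormalSeries σ L :=
  fun γ => ∑ p ∈ Finset.HasAntidiagonal.antidiagonal γ, MvPowerSeries.coeff p.1 f • c p.2

/-- The bracket `[∑ c_α X^α, ∑ c'_β X^β] = ∑ [c_α, c'_β] X^α X^β`. -/
def bracket [DecidableEq σ] (c c' : FormalSeries σ L) : FormalSeries σ L :=
  fun γ => ∑ p ∈ Finset.HasAntidiagonal.antidiagonal γ, ⁅c p.1, c' p.2⁆

/-- A power series in the variables `X_s`, `s : σ`, regarded as a power series in the variables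
`X_t`, `t : τ`, along an injection `ι : σ → τ` of the sets of variables. -/
def extend (ι : σ → τ) (c : FormalSeries σ L) : FormalSeries τ L :=
  Function.extend (Finsupp.mapDomain ι) c 0

end FormalSeries

/-! ### The Wahlquist–Estabrook algebra of an evolution system -/

/-- Indices of the jet coordinates `u^i_k` with `i` one of the `m` components and `0 ≤ k < N`.
The multi-indices `JetIdx m (q + 1) →₀ ℕ` are the `m × (q + 1)` matrices with entries in `ℕ`. -/
abbrev JetIdx (m N : ℕ) := Fin m × Fin N

/-- The inclusion of the jet coordinates with `k < M` into those with `k < N`. -/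
def jetIncl {m M N : ℕ} (h : M ≤ N) : JetIdx m M → JetIdx m N :=
  fun s => (s.1, Fin.castLE h s.2)

section WahlquistEstabrook

variable {𝕜 : Type*} [RCLike 𝕜] {m d : ℕ} {L : Type*} [LieRing L] [LieAlgebra 𝕜 L]

/-- The total derivative `D_x = ∑_{i,k} u^i_{k+1} ∂/∂u^i_k` on power series in the variables
`u^i_k - a^i_k`, `k < N`; note that `u^i_{k+1} = a^i_{k+1} + (u^i_{k+1} - a^i_{k+1})`. -/
def totalDx {N : ℕ} (a : Fin m × ℕ → 𝕜) (c : FormalSeries (JetIdx m N) L) :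
    FormalSeries (JetIdx m (N + 1)) L :=
  ∑ s : JetIdx m N,
    FormalSeries.scalarMul
      (MvPowerSeries.C (a (s.1, (s.2 : ℕ) + 1)) +
        MvPowerSeries.X (σ := JetIdx m (N + 1)) (R := 𝕜) (s.1, s.2.succ))
      (FormalSeries.extend (jetIncl N.le_succ) (FormalSeries.pderiv s c))

/-- The total derivative `D_t` of the system `u^i_t = F^i(u^j_k, k ≤ d)` on power series in the
variables `u^i_0 - a^i_0` only, where it is `∑_i F^i ∂/∂u^i_0`. The function `F^i` is replaced by
its Taylor series at the point `a`. -/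
def totalDt (F : Fin m → (JetIdx m (d + 1) → 𝕜) → 𝕜) (a : Fin m × ℕ → 𝕜)
    (c : FormalSeries (JetIdx m 1) L) : FormalSeries (JetIdx m (d + 1)) L :=
  ∑ i : Fin m,
    FormalSeries.scalarMul (taylorSeries (F i) fun s => a (s.1, (s.2 : ℕ)))
      (FormalSeries.extend (jetIncl (Nat.le_add_left 1 d)) (FormalSeries.pderiv (i, 0) c))

/-- The power series `D_x(B) - D_t(A) + [A, B]`, where `A` is a power series in the variables
`u^i_0 - a^i_0`, and `B` is a power series in the variables `u^i_k - a^i_k`, `k ≤ d - 1`. -/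
def zeroCurvature (F : Fin m → (JetIdx m (d + 1) → 𝕜) → 𝕜) (a : Fin m × ℕ → 𝕜)
    (A : FormalSeries (JetIdx m 1) L) (B : FormalSeries (JetIdx m d) L) :
    FormalSeries (JetIdx m (d + 1)) L :=
  totalDx a B - totalDt F a A +
    FormalSeries.bracket (FormalSeries.extend (jetIncl (Nat.le_add_left 1 d)) A)
      (FormalSeries.extend (jetIncl d.le_succ) B)

end WahlquistEstabrook

/-- The Lie algebra over `𝕜` given by the generators `x : X` and the relations `y = 0`,
`y ∈ rels`: the quotient of the free Lie algebra by the ideal generated by `rels`. -/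
abbrev PresentedLieAlgebra (𝕜 : Type*) [Field 𝕜] {X : Type*} (rels : Set (FreeLieAlgebra 𝕜 X)) :=
  FreeLieAlgebra 𝕜 X ⧸ LieSubmodule.lieSpan 𝕜 (FreeLieAlgebra 𝕜 X) rels

/-- The generator of a presented Lie algebra with the label `x`. -/
def PresentedLieAlgebra.gen {𝕜 : Type*} [Field 𝕜] {X : Type*} (rels : Set (FreeLieAlgebra 𝕜 X))
    (x : X) : PresentedLieAlgebra 𝕜 rels :=
  LieSubmodule.Quotient.mk (FreeLieAlgebra.of 𝕜 x)

section WahlquistEstabrookAlgebra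

variable {𝕜 : Type*} [RCLike 𝕜] {m d : ℕ}

/-- The labels of the generators `A_α`, `B_β`: here `α` is an `m × 1` matrix and `β` is an `m × d`
matrix of nonnegative integers. -/
abbrev WEGen (m d : ℕ) := (JetIdx m 1 →₀ ℕ) ⊕ (JetIdx m d →₀ ℕ)

/-- The elements `z_γ` of the free Lie algebra on the symbols `A_α`, `B_β`: the coefficients of
`D_x(B) - D_t(A) + [A, B]` for the power series `A = ∑ A_α U^α` and `B = ∑ B_β U^β`. -/
def weRelator (F : Fin m → (JetIdx m (d + 1) → 𝕜) → 𝕜) (a : Fin m × ℕ → 𝕜) :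
    FormalSeries (JetIdx m (d + 1)) (FreeLieAlgebra 𝕜 (WEGen m d)) :=
  zeroCurvature F a (fun α => FreeLieAlgebra.of 𝕜 (Sum.inl α))
    (fun β => FreeLieAlgebra.of 𝕜 (Sum.inr β))

/-- The Wahlquist–Estabrook algebra of the evolution system `u^i_t = F^i(u^j_k, k ≤ d)` at the
point `a = (a^i_k)` of the infinite jet space. -/
abbrev WEAlgebra (F : Fin m → (JetIdx m (d + 1) → 𝕜) → 𝕜) (a : Fin m × ℕ → 𝕜) :=
  PresentedLieAlgebra 𝕜 (Set.range (weRelator F a))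

end WahlquistEstabrookAlgebra

/-! ### The multicomponent Landau–Lifshitz system in stereographic coordinates -/

section LandauLifshitz

variable {𝕜 : Type*} [RCLike 𝕜] {m : ℕ}

/-- The right-hand side of the `n`-component Landau–Lifshitz system, `n = m + 1`, written in
stereographic coordinates `u = (u^1, …, u^m)`, as a function of the jet coordinates `u^i_k`, `k ≤ 3`.
Here `R = diag (r_1, …, r_n)`, and `Fin.last m` is the index of `r_n`. -/
def landauLifshitz (r : Fin (m + 1) → 𝕜) (j : Fin m) (v : JetIdx m 4 → 𝕜) : 𝕜 :=
  let u : Fin m → 𝕜 := fun i => v (i, 0)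
  let ux : Fin m → 𝕜 := fun i => v (i, 1)
  let uxx : Fin m → 𝕜 := fun i => v (i, 2)
  let uxxx : Fin m → 𝕜 := fun i => v (i, 3)
  let Δ : 𝕜 := 1 + u ⬝ᵥ u
  uxxx j - 6 * (u ⬝ᵥ ux) * Δ⁻¹ * uxx j
    + (-6 * (u ⬝ᵥ uxx) * Δ⁻¹ + 24 * (u ⬝ᵥ ux) ^ 2 * (Δ ^ 2)⁻¹
        - 6 * (u ⬝ᵥ u) * (ux ⬝ᵥ ux) * (Δ ^ 2)⁻¹) * ux j
    + (6 * (ux ⬝ᵥ uxx) * Δ⁻¹ - 12 * (u ⬝ᵥ ux) * (ux ⬝ᵥ ux) * (Δ ^ 2)⁻¹) * u j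
    + 3 / 2 * (r (Fin.last m)
        + 4 * (Δ ^ 2)⁻¹ * ∑ i : Fin m, (r i.castSucc - r (Fin.last m)) * u i ^ 2) * ux j

variable (𝕜 m) in
/-- The open set of the infinite jet space on which `1 + ⟨u, u⟩ ≠ 0`. -/
def jetDomain : Set (Fin m × ℕ → 𝕜) :=
  {a | 1 + ∑ i : Fin m, a (i, 0) ^ 2 ≠ 0}

end LandauLifshitz

/-! ### The Lie algebras given by generators and relations -/

section Presentations

variable {𝕜 : Type*} [RCLike 𝕜] {n : ℕ}

/-- The left-hand sides minus right-hand sides of the relations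
`[p_i, [p_j, p_k]] = 0` for distinct `i`, `j`, `k`, and
`[p_i, [p_i, p_k]] - [p_j, [p_j, p_k]] = (r_j - r_i) p_k` for `i ≠ k`, `j ≠ k`. -/
def gRelators {L : Type*} [LieRing L] [LieAlgebra 𝕜 L] (r : Fin n → 𝕜) (p : Fin n → L) : Set L :=
  {x | ∃ i j k : Fin n, i ≠ j ∧ j ≠ k ∧ k ≠ i ∧ x = ⁅p i, ⁅p j, p k⁆⁆} ∪
  {x | ∃ i j k : Fin n, i ≠ k ∧ j ≠ k ∧
    x = ⁅p i, ⁅p i, p k⁆⁆ - ⁅p j, ⁅p j, p k⁆⁆ - (r j - r i) • p k}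

/-- The Lie algebra `𝔤(n)` with generators `p_1, …, p_n`. -/
abbrev gAlgebra (r : Fin n → 𝕜) :=
  PresentedLieAlgebra 𝕜 (gRelators r (FreeLieAlgebra.of 𝕜 : Fin n → FreeLieAlgebra 𝕜 (Fin n)))

/-- The generator `p_{l+1}` of `𝔤(n)` for `l : Fin n`. -/
def gAlgebra.p (r : Fin n → 𝕜) (l : Fin n) : gAlgebra r :=
  PresentedLieAlgebra.gen _ l

/-- The relations for generators `p_0, p_1, …, p_{n+1}`: the elements `p_0` and `p_{n+1}` commute
with each other and with `p_1, …, p_n`, and `p_1, …, p_n` satisfy the relations of `𝔤(n)`. -/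
def hRelators (r : Fin n → 𝕜) : Set (FreeLieAlgebra 𝕜 (Fin (n + 2))) :=
  let p : Fin (n + 2) → FreeLieAlgebra 𝕜 (Fin (n + 2)) := FreeLieAlgebra.of 𝕜
  {x | ∃ l : Fin n, x = ⁅p 0, p l.succ.castSucc⁆} ∪
  {x | ∃ l : Fin n, x = ⁅p (Fin.last (n + 1)), p l.succ.castSucc⁆} ∪
  {⁅p 0, p (Fin.last (n + 1))⁆} ∪
  gRelators r (fun l => p l.succ.castSucc)

/-- The Lie algebra given by generators `p_0, …, p_{n+1}` and the relations `hRelators`. -/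
abbrev hAlgebra (r : Fin n → 𝕜) := PresentedLieAlgebra 𝕜 (hRelators r)

/-- The generator `p_i` of `hAlgebra r`, `0 ≤ i ≤ n + 1`. -/
def hAlgebra.p (r : Fin n → 𝕜) (i : Fin (n + 2)) : hAlgebra r :=
  PresentedLieAlgebra.gen _ i

end Presentations

/-- The 2-dimensional abelian Lie algebra `𝕜²`. -/
def AbelianPlane (𝕜 : Type*) := 𝕜 × 𝕜

section AbelianPlane

variable (𝕜 : Type*) [RCLike 𝕜]

instance : AddCommGroup (AbelianPlane 𝕜) := inferInstanceAs (AddCommGroup (𝕜 × 𝕜))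

instance : Module 𝕜 (AbelianPlane 𝕜) := inferInstanceAs (Module 𝕜 (𝕜 × 𝕜))

instance : LieRing (AbelianPlane 𝕜) where
  bracket _ _ := 0
  add_lie _ _ _ := (add_zero 0).symm
  lie_add _ _ _ := (add_zero 0).symm
  lie_self _ := rfl
  leibniz_lie _ _ _ := (add_zero 0).symm

instance : LieAlgebra 𝕜 (AbelianPlane 𝕜) where
  lie_smul t _ _ := (smul_zero t).symm

variable {𝕜} in
/-- The element `(s, t)` of `𝕜²`. -/
def AbelianPlane.mk (s t : 𝕜) : AbelianPlane 𝕜 := (s, t)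

end AbelianPlane

/-! ### The Lie algebra `L(n)` of matrix-valued functions on the curve -/

section CurveAlgebra

variable {𝕜 : Type*} [RCLike 𝕜] {n : ℕ}

/-- The algebra `𝕜[λ_1, …, λ_n] / (λ_i² - λ_j² + r_i - r_j)`. -/
abbrev CurveRing (r : Fin n → 𝕜) :=
  MvPolynomial (Fin n) 𝕜 ⧸ Ideal.span (Set.range fun ij : Fin n × Fin n =>
    (MvPolynomial.X ij.1 ^ 2 - MvPolynomial.X ij.2 ^ 2 + MvPolynomial.C (r ij.1 - r ij.2) :
      MvPolynomial (Fin n) 𝕜))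

/-- The element `E_{i,n+1} + E_{n+1,i}` of `𝔰𝔬_{n,1}`. -/
def boost (𝕜 : Type*) [RCLike 𝕜] {n : ℕ} (i : Fin n) :
    LieAlgebra.Orthogonal.so' (Fin n) (Fin 1) 𝕜 :=
  ⟨Matrix.single (Sum.inl i) (Sum.inr 0) 1 + Matrix.single (Sum.inr 0) (Sum.inl i) 1, by
    rw [LieAlgebra.Orthogonal.so', mem_skewAdjointMatricesLieSubalgebra,
      mem_skewAdjointMatricesSubmodule, Matrix.IsSkewAdjoint, Matrix.IsAdjointPair,
      LieAlgebra.Orthogonal.indefiniteDiagonal]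
    rw [Matrix.transpose_add, Matrix.transpose_single, Matrix.transpose_single]
    ext s t
    rcases s with s | s <;> rcases t with t | t <;>
      simp [Matrix.single_apply, and_comm, apply_ite]⟩

/-- The element `Q_i = (E_{i,n+1} + E_{n+1,i}) ⊗ λ_i` of `𝔰𝔬_{n,1} ⊗ CurveRing r` (with the scalar
factor written on the left). -/
def curveQ (r : Fin n → 𝕜) (i : Fin n) :
    CurveRing r ⊗[𝕜] LieAlgebra.Orthogonal.so' (Fin n) (Fin 1) 𝕜 :=
  (Ideal.Quotient.mk _ (MvPolynomial.X i) : CurveRing r) ⊗ₜ[𝕜] boost 𝕜 i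

/-- The Lie algebra `L(n)`: the subalgebra over `𝕜` generated by `Q_1, …, Q_n`. -/
abbrev curveAlgebra (r : Fin n → 𝕜) :
    LieSubalgebra 𝕜 (CurveRing r ⊗[𝕜] LieAlgebra.Orthogonal.so' (Fin n) (Fin 1) 𝕜) :=
  LieSubalgebra.lieSpan 𝕜 _ (Set.range (curveQ r))

/-- `Q_i` as an element of `L(n)`. -/
def curveAlgebra.Q (r : Fin n → 𝕜) (i : Fin n) : curveAlgebra r :=
  ⟨curveQ r i, LieSubalgebra.subset_lieSpan (Set.mem_range_self i)⟩

end CurveAlgebra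

end

noncomputable section

/-! ### Sums over antidiagonals -/

namespace FormalSeries

open Finset

section Antidiagonal

variable {ι M : Type*} [AddCommMonoid ι] [HasAntidiagonal ι] [AddCommMonoid M]

/-! Homomorphisms from $\mathfrak W(a)$ to a Lie algebra `L` are the same as pairs $(A,B)$ of
`L`-valued power series that solve $D_xB-D_tA+[A,B]=0$, with $A$ depending on $u_0$ and $B$ on
$u_0,u_1,u_2$ (`isZCR_we`, `exists_weHom`, `weHom_ext`). So a presentation of $\mathfrak W(a)$
follows once all solutions over an arbitrary `L` are known. In the coordinates
$S=(2u/\Delta,\,2/\Delta-1)$ on the sphere $\langle S,S\rangle=1$ the system becomes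
$S_t=D_x(S_{xx}+\tfrac32\langle S_x,S_x\rangle S)+\tfrac32\langle S,RS\rangle S_x$
(`scalarDt_sphere`), and the claim is that every solution has $A=q_0+\sum S^ip_i$ and $B$ as in
`zcrB`, with $q_0,q_1,p_i$ satisfying the relations of `hAlgebra` (`HRel.isZCR`,
`IsZCR.exists_hRel`).

The form of $A$: differentiating the equation by $u_3$ and $u_2$ expresses $\partial B/\partial u_2$
and $\partial B/\partial u_1$ through $A$. The third derivatives by $u_1$ then give a condition on
$A$ alone, which is a system of third order for $G=\Delta A$. Its integrability forces the Hessian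
of $G$ to be a constant multiple of the identity (`IsZCR.hess_compat`,
`IsZCR.exists_hess_eq_const`). Hence $G$ is a combination of $1$, $u^i$, $\langle u,u\rangle$, and
$A$ is a combination of $1,S^1,\dots,S^n$ (`IsZCR.exists_eq_zcrA`).

The form of $B$: after subtraction of the terms forced by the derivatives in $u_2$ and $u_1$, a
remainder depending only on $u_0$ is left. Its gradient is known, and the symmetry of its second
derivatives says that the trilinear map $[X,[Y,Z]]+\langle RX,Y\rangle Z-\langle RX,Z\rangle Y$
vanishes when $X=S$ and $Y,Z$ are tangent to the sphere at $S$ (`IsZCR.sphere_integrability`).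
Evaluation at a few rational points of the sphere turns this into the relations of $\mathfrak g(n)$
(`gRel_of_trilinear`). The remainder is then determined up to a constant $q_1$, and linear
independence of $1,S^1,\dots,S^n$ makes $q_0,q_1$ central.

The isomorphism $\mathfrak g(n)\cong L(n)$: since $n\ge3$, the relations imply a full multiplication
table for elements $p_k\lambda^s$, by induction on the total degree (`GRel.towerRel`), so that
$\mathfrak g(n)$ is spanned by the $p_k\lambda^s$ and $[p_i,p_j\lambda^s]$ (`lie_range_towerSum`).
The map $p_i\mapsto Q_i$ sends $\lambda$ to the function $\lambda_i^2+r_i$, which is the same for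
all $i$; comparing matrix entries at points of the curve shows that it is injective on this span
(`towerSum_eq_zero`). -/

lemma sum_antidiagonal_assoc (Φ : ι → ι → ι → M) (γ : ι) :
    ∑ p ∈ HasAntidiagonal.antidiagonal γ, ∑ q ∈ HasAntidiagonal.antidiagonal p.1, Φ q.1 q.2 p.2 =
      ∑ p ∈ HasAntidiagonal.antidiagonal γ, ∑ q ∈ HasAntidiagonal.antidiagonal p.2, Φ p.1 q.1 q.2 := by
  rw [sum_sigma', sum_sigma']
  refine sum_nbij' (fun x => ⟨(x.2.1, x.2.2 + x.1.2), (x.2.2, x.1.2)⟩)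
    (fun x => ⟨(x.1.1 + x.2.1, x.2.2), (x.1.1, x.2.1)⟩) ?_ ?_ ?_ ?_ ?_
  · rintro ⟨⟨a, b⟩, ⟨c, d⟩⟩ h
    simp only [mem_sigma, HasAntidiagonal.mem_antidiagonal, and_true] at h ⊢
    rw [← add_assoc, h.2, h.1]
  · rintro ⟨⟨a, b⟩, ⟨c, d⟩⟩ h
    simp only [mem_sigma, HasAntidiagonal.mem_antidiagonal, and_true] at h ⊢
    rw [add_assoc, h.2, h.1]
  · rintro ⟨⟨a, b⟩, ⟨c, d⟩⟩ h
    simp only [mem_sigma, HasAntidiagonal.mem_antidiagonal] at h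
    simp [h.2]
  · rintro ⟨⟨a, b⟩, ⟨c, d⟩⟩ h
    simp only [mem_sigma, HasAntidiagonal.mem_antidiagonal] at h
    simp [h.2]
  · rintro ⟨⟨a, b⟩, ⟨c, d⟩⟩ h
    rfl

lemma sum_antidiagonal_comm (Φ : ι → ι → M) (γ : ι) :
    ∑ p ∈ HasAntidiagonal.antidiagonal γ, Φ p.1 p.2 = ∑ p ∈ HasAntidiagonal.antidiagonal γ, Φ p.2 p.1 :=
  sum_nbij' Prod.swap Prod.swap
    (fun _ hp => HasAntidiagonal.swap_mem_antidiagonal.2 hp)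
    (fun _ hp => HasAntidiagonal.swap_mem_antidiagonal.2 hp)
    (fun _ _ => rfl) (fun _ _ => rfl) (fun _ _ => rfl)

lemma sum_antidiagonal_left_comm (Φ : ι → ι → ι → M) (γ : ι) :
    ∑ p ∈ HasAntidiagonal.antidiagonal γ, ∑ q ∈ HasAntidiagonal.antidiagonal p.2, Φ p.1 q.1 q.2 =
      ∑ p ∈ HasAntidiagonal.antidiagonal γ, ∑ q ∈ HasAntidiagonal.antidiagonal p.2, Φ q.1 p.1 q.2 := by
  rw [← sum_antidiagonal_assoc, ← sum_antidiagonal_assoc (fun a b c => Φ b a c)]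
  exact sum_congr rfl fun p _ => sum_antidiagonal_comm (fun a b => Φ a b p.2) p.1

end Antidiagonal

variable {σ A B C : Type*} [DecidableEq σ] [AddCommGroup A] [AddCommGroup B] [AddCommGroup C]

/-- The terms in which the first exponent vanishes at `s` carry the factor zero; all the others are
shifts by `single s 1`. -/
lemma sum_antidiagonal_nsmul_fst (s : σ) (Φ : (σ →₀ ℕ) → (σ →₀ ℕ) → C) (γ : σ →₀ ℕ) :
    ∑ p ∈ HasAntidiagonal.antidiagonal (γ + Finsupp.single s 1), (p.1 : σ →₀ ℕ) s • Φ p.1 p.2 =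
      ∑ p ∈ HasAntidiagonal.antidiagonal γ, ((p.1 : σ →₀ ℕ) s + 1) • Φ (p.1 + Finsupp.single s 1) p.2 := by
  symm
  refine sum_of_injOn (fun p => (p.1 + Finsupp.single s 1, p.2)) ?_ ?_ ?_ ?_
  · rintro ⟨a, b⟩ _ ⟨c, d⟩ _ h
    simpa using h
  · rintro ⟨a, b⟩ h
    simp only [mem_coe, HasAntidiagonal.mem_antidiagonal] at h ⊢
    rw [← h, add_right_comm]
  · rintro ⟨a, b⟩ h h'
    have : a s = 0 := by
      by_contra h0
      apply h'
      have hle : Finsupp.single s 1 ≤ a := by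
        rw [Finsupp.single_le_iff]; omega
      refine ⟨(a - Finsupp.single s 1, b), ?_, by simp [tsub_add_cancel_of_le hle]⟩
      simp only [mem_coe, HasAntidiagonal.mem_antidiagonal] at h ⊢
      have : a - Finsupp.single s 1 + b + Finsupp.single s 1 = γ + Finsupp.single s 1 := by
        rw [← h, add_right_comm, tsub_add_cancel_of_le hle]
      exact add_right_cancel this
    simp [this]
  · rintro ⟨a, b⟩ h
    simp

/-- The derivative of a convolution. -/
lemma sum_antidiagonal_leibniz (s : σ) (Φ : (σ →₀ ℕ) → (σ →₀ ℕ) → C) (γ : σ →₀ ℕ) :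
    (γ s + 1) • ∑ p ∈ HasAntidiagonal.antidiagonal (γ + Finsupp.single s 1), Φ p.1 p.2 =
      ∑ p ∈ HasAntidiagonal.antidiagonal γ, ((p.1 : σ →₀ ℕ) s + 1) • Φ (p.1 + Finsupp.single s 1) p.2 +
      ∑ p ∈ HasAntidiagonal.antidiagonal γ, ((p.2 : σ →₀ ℕ) s + 1) • Φ p.1 (p.2 + Finsupp.single s 1) := by
  rw [← sum_antidiagonal_nsmul_fst,
    sum_antidiagonal_comm (fun a b => (b s + 1) • Φ a (b + Finsupp.single s 1)),
    ← sum_antidiagonal_nsmul_fst s (fun a b => Φ b a),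
    sum_antidiagonal_comm (fun a b => a s • Φ b a), ← sum_add_distrib, smul_sum]
  refine sum_congr rfl fun p hp => ?_
  rw [← add_smul]
  congr 1
  have := DFunLike.congr_fun (HasAntidiagonal.mem_antidiagonal.1 hp) s
  simp only [Finsupp.add_apply, Finsupp.single_eq_same] at this
  exact this.symm

end FormalSeries

/-! ### The Lie algebra of power series with coefficients in a Lie algebra -/

/-- Formal power series with coefficients in `L`, as a Lie algebra over the ring of scalar power
series. -/
def LieSeries (σ L : Type*) := FormalSeries σ L

namespace LieSeries

open Finset FormalSeries

variable {𝕜 : Type*} [Field 𝕜] {σ : Type*} {L : Type*} [LieRing L] [LieAlgebra 𝕜 L]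

instance : AddCommGroup (LieSeries σ L) := inferInstanceAs (AddCommGroup ((σ →₀ ℕ) → L))

variable [DecidableEq σ]

/-- The bracket is the convolution. The plain function type already carries the pointwise bracket,
hence the separate type `LieSeries`. -/
instance : LieRing (LieSeries σ L) where
  bracket c c' := FormalSeries.bracket c c'
  add_lie x y z := by
    funext γ
    change ∑ p ∈ HasAntidiagonal.antidiagonal γ, ⁅x p.1 + y p.1, z p.2⁆ = ∑ p ∈ HasAntidiagonal.antidiagonal γ, ⁅x p.1, z p.2⁆ + ∑ p ∈ HasAntidiagonal.antidiagonal γ, ⁅y p.1, z p.2⁆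
    simp only [add_lie, sum_add_distrib]
  lie_add x y z := by
    funext γ
    change ∑ p ∈ HasAntidiagonal.antidiagonal γ, ⁅x p.1, y p.2 + z p.2⁆ = ∑ p ∈ HasAntidiagonal.antidiagonal γ, ⁅x p.1, y p.2⁆ + ∑ p ∈ HasAntidiagonal.antidiagonal γ, ⁅x p.1, z p.2⁆
    simp only [lie_add, sum_add_distrib]
  lie_self x := by
    funext γ
    change ∑ p ∈ HasAntidiagonal.antidiagonal γ, ⁅x p.1, x p.2⁆ = 0
    refine sum_involution (fun p _ => p.swap) ?_ ?_ ?_ ?_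
    · intro p _
      simp only [Prod.fst_swap, Prod.snd_swap]
      rw [← lie_skew, neg_add_cancel]
    · rintro ⟨a, b⟩ _ h h'
      simp only [Prod.swap_prod_mk, Prod.mk.injEq] at h'
      exact h (by rw [h'.1]; exact lie_self _)
    · intro p hp
      exact HasAntidiagonal.swap_mem_antidiagonal.2 hp
    · intro p _
      exact Prod.swap_swap p
  leibniz_lie x y z := by
    funext γ
    change ∑ p ∈ HasAntidiagonal.antidiagonal γ,
        ⁅x p.1, ∑ q ∈ HasAntidiagonal.antidiagonal p.2, ⁅y q.1, z q.2⁆⁆ =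
      ∑ p ∈ HasAntidiagonal.antidiagonal γ,
        ⁅∑ q ∈ HasAntidiagonal.antidiagonal p.1, ⁅x q.1, y q.2⁆, z p.2⁆ +
      ∑ p ∈ HasAntidiagonal.antidiagonal γ,
        ⁅y p.1, ∑ q ∈ HasAntidiagonal.antidiagonal p.2, ⁅x q.1, z q.2⁆⁆
    simp only [lie_sum, sum_lie]
    rw [sum_antidiagonal_assoc (fun a b c => ⁅⁅x a, y b⁆, z c⁆),
      sum_antidiagonal_left_comm (fun a b c => ⁅y a, ⁅x b, z c⁆⁆), ← sum_add_distrib]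
    refine sum_congr rfl fun p _ => ?_
    rw [← sum_add_distrib]
    exact sum_congr rfl fun q _ => leibniz_lie _ _ _

/-- With scalar power series as the ground ring, the identities below become statements of linear
algebra over a commutative ring, accessible to `module` and `match_scalars`. -/
instance : Module (MvPowerSeries σ 𝕜) (LieSeries σ L) where
  smul f c := FormalSeries.scalarMul f c
  one_smul c := by
    funext γ
    change ∑ p ∈ HasAntidiagonal.antidiagonal γ,
      MvPowerSeries.coeff p.1 (1 : MvPowerSeries σ 𝕜) • c p.2 = c γ
    rw [sum_eq_single (0, γ)]
    · simp
    · rintro ⟨a, b⟩ h h'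
      have : a ≠ 0 := by
        rintro rfl
        apply h'
        rw [HasAntidiagonal.mem_antidiagonal] at h
        simpa using h
      simp [MvPowerSeries.coeff_one, this]
    · simp
  mul_smul f g c := by
    funext γ
    change ∑ p ∈ HasAntidiagonal.antidiagonal γ, MvPowerSeries.coeff p.1 (f * g) • c p.2 =
      ∑ p ∈ HasAntidiagonal.antidiagonal γ, MvPowerSeries.coeff p.1 f •
        ∑ q ∈ HasAntidiagonal.antidiagonal p.2, MvPowerSeries.coeff q.1 g • c q.2
    simp only [MvPowerSeries.coeff_mul, sum_smul, smul_sum, mul_smul]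
    exact sum_antidiagonal_assoc
      (fun a b d => MvPowerSeries.coeff a f • MvPowerSeries.coeff b g • c d) γ
  smul_zero f := by
    funext γ
    exact sum_eq_zero fun p _ => smul_zero _
  smul_add f c d := by
    funext γ
    change ∑ p ∈ HasAntidiagonal.antidiagonal γ, MvPowerSeries.coeff p.1 f • (c p.2 + d p.2) =
      ∑ p ∈ HasAntidiagonal.antidiagonal γ, MvPowerSeries.coeff p.1 f • c p.2 + ∑ p ∈ HasAntidiagonal.antidiagonal γ, MvPowerSeries.coeff p.1 f • d p.2
    simp only [smul_add, sum_add_distrib]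
  add_smul f g c := by
    funext γ
    change ∑ p ∈ HasAntidiagonal.antidiagonal γ, MvPowerSeries.coeff p.1 (f + g) • c p.2 =
      ∑ p ∈ HasAntidiagonal.antidiagonal γ, MvPowerSeries.coeff p.1 f • c p.2 + ∑ p ∈ HasAntidiagonal.antidiagonal γ, MvPowerSeries.coeff p.1 g • c p.2
    simp only [map_add, add_smul, sum_add_distrib]
  zero_smul c := by
    funext γ
    exact sum_eq_zero fun p _ => by rw [map_zero, zero_smul]

instance : LieAlgebra (MvPowerSeries σ 𝕜) (LieSeries σ L) where
  lie_smul f c d := by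
    funext γ
    change ∑ p ∈ HasAntidiagonal.antidiagonal γ, ⁅c p.1,
        ∑ q ∈ HasAntidiagonal.antidiagonal p.2, MvPowerSeries.coeff q.1 f • d q.2⁆ =
      ∑ p ∈ HasAntidiagonal.antidiagonal γ, MvPowerSeries.coeff p.1 f •
        ∑ q ∈ HasAntidiagonal.antidiagonal p.2, ⁅c q.1, d q.2⁆
    simp only [lie_sum, lie_smul, smul_sum]
    exact sum_antidiagonal_left_comm
      (fun a b e => MvPowerSeries.coeff b f • ⁅c a, d e⁆) γ

variable (L) in
/-- The partial derivative with respect to `X_s`, as an additive map. -/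
def pd (s : σ) : LieSeries σ L →+ LieSeries σ L where
  toFun c := FormalSeries.pderiv s c
  map_zero' := by
    funext γ
    exact smul_zero _
  map_add' c d := by
    funext γ
    exact smul_add _ _ _

lemma pd_lie (s : σ) (c d : LieSeries σ L) : pd L s ⁅c, d⁆ = ⁅pd L s c, d⁆ + ⁅c, pd L s d⁆ := by
  funext γ
  change (γ s + 1) • ∑ p ∈ HasAntidiagonal.antidiagonal (γ + Finsupp.single s 1), ⁅c p.1, d p.2⁆ =
    ∑ p ∈ HasAntidiagonal.antidiagonal γ, ⁅(p.1 s + 1) • c (p.1 + Finsupp.single s 1), d p.2⁆ +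
    ∑ p ∈ HasAntidiagonal.antidiagonal γ, ⁅c p.1, (p.2 s + 1) • d (p.2 + Finsupp.single s 1)⁆
  simp only [nsmul_lie, lie_nsmul]
  exact sum_antidiagonal_leibniz s (fun a b => ⁅c a, d b⁆) γ

lemma pd_smul (s : σ) (f : MvPowerSeries σ 𝕜) (c : LieSeries σ L) :
    pd L s (f • c) = MvPowerSeries.pderiv 𝕜 s f • c + f • pd L s c := by
  funext γ
  change (γ s + 1) • ∑ p ∈ HasAntidiagonal.antidiagonal (γ + Finsupp.single s 1),
      MvPowerSeries.coeff p.1 f • c p.2 =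
    ∑ p ∈ HasAntidiagonal.antidiagonal γ,
      MvPowerSeries.coeff p.1 (MvPowerSeries.pderiv 𝕜 s f) • c p.2 +
    ∑ p ∈ HasAntidiagonal.antidiagonal γ, MvPowerSeries.coeff p.1 f •
      (p.2 s + 1) • c (p.2 + Finsupp.single s 1)
  rw [sum_antidiagonal_leibniz s (fun a b => MvPowerSeries.coeff a f • c b) γ]
  congr 1
  · refine sum_congr rfl fun p _ => ?_
    rw [MvPowerSeries.coeff_pderiv, mul_comm, mul_smul]
    norm_cast
  · refine sum_congr rfl fun p _ => ?_
    rw [smul_comm]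

lemma pd_comm (s t : σ) (c : LieSeries σ L) : pd L s (pd L t c) = pd L t (pd L s c) := by
  funext γ
  change (γ s + 1) • ((γ + Finsupp.single s 1 : σ →₀ ℕ) t + 1) •
      c (γ + Finsupp.single s 1 + Finsupp.single t 1) =
    (γ t + 1) • ((γ + Finsupp.single t 1 : σ →₀ ℕ) s + 1) •
      c (γ + Finsupp.single t 1 + Finsupp.single s 1)
  rw [add_right_comm, smul_smul, smul_smul]
  by_cases h : s = t
  · subst h; rfl
  · congr 1
    simp [h, Ne.symm h, mul_comm]

/-- The constant power series. -/
def const (σ : Type*) [DecidableEq σ] (L : Type*) [LieRing L] : L →+ LieSeries σ L where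
  toFun x := fun γ => if γ = 0 then x else 0
  map_zero' := by
    funext γ
    exact ite_self _
  map_add' x y := by
    funext γ
    change (if γ = 0 then x + y else 0) = (if γ = 0 then x else 0) + (if γ = 0 then y else 0)
    split_ifs <;> simp

lemma const_apply_zero (x : L) : const σ L x (0 : σ →₀ ℕ) = x := by
  change (if (0 : σ →₀ ℕ) = 0 then x else 0) = x
  exact if_pos rfl

lemma const_injective : Function.Injective (const σ L) := fun x y h => by
  rw [← const_apply_zero (σ := σ) x, h, const_apply_zero]

lemma pd_const (s : σ) (x : L) : pd L s (const σ L x) = 0 := by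
  funext γ
  change (γ s + 1) • (if γ + Finsupp.single s 1 = 0 then x else 0) = 0
  rw [if_neg, smul_zero]
  intro h
  have := DFunLike.congr_fun h s
  simp at this

lemma const_lie (x y : L) : const σ L ⁅x, y⁆ = ⁅const σ L x, const σ L y⁆ := by
  funext γ
  change (if γ = 0 then ⁅x, y⁆ else 0) = ∑ p ∈ HasAntidiagonal.antidiagonal γ,
    ⁅if p.1 = 0 then x else 0, if p.2 = 0 then y else 0⁆
  split_ifs with h
  · subst h
    simp
  · symm
    refine sum_eq_zero fun p hp => ?_
    rw [HasAntidiagonal.mem_antidiagonal] at hp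
    by_cases h1 : p.1 = 0
    · by_cases h2 : p.2 = 0
      · rw [h1, h2, add_zero] at hp
        exact absurd hp.symm h
      · simp [h2]
    · simp [h1]

lemma const_smul (t : 𝕜) (x : L) :
    const σ L (t • x) = (MvPowerSeries.C t : MvPowerSeries σ 𝕜) • const σ L x := by
  funext γ
  change (if γ = 0 then t • x else 0) = ∑ p ∈ HasAntidiagonal.antidiagonal γ,
    MvPowerSeries.coeff p.1 (MvPowerSeries.C t : MvPowerSeries σ 𝕜) • if p.2 = 0 then x else 0
  split_ifs with h
  · subst h
    simp
  · symm
    refine sum_eq_zero fun p hp => ?_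
    rw [HasAntidiagonal.mem_antidiagonal] at hp
    by_cases h1 : p.1 = 0
    · by_cases h2 : p.2 = 0
      · rw [h1, h2, add_zero] at hp
        exact absurd hp.symm h
      · simp [h2]
    · simp [MvPowerSeries.coeff_C, h1]

/-- A coefficient with a nonzero exponent at `s` is, up to a nonzero integer factor, a coefficient
of the derivative by `s`. -/
lemma eq_const_of_pd_eq_zero [CharZero 𝕜] (c : LieSeries σ L) (h : ∀ s, pd L s c = 0) :
    c = const σ L (c 0) := by
  funext γ
  change c γ = if γ = 0 then c 0 else 0
  split_ifs with h0
  · rw [h0]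
  · obtain ⟨s, hs⟩ := Finsupp.ne_iff.1 h0
    have hle : Finsupp.single s 1 ≤ γ := by
      rw [Finsupp.single_le_iff]
      exact Nat.one_le_iff_ne_zero.2 hs
    have := congrFun (h s) (γ - Finsupp.single s 1)
    change ((γ - Finsupp.single s 1 : σ →₀ ℕ) s + 1) • c (γ - Finsupp.single s 1 + Finsupp.single s 1) = 0
      at this
    rw [tsub_add_cancel_of_le hle, ← Nat.cast_smul_eq_nsmul 𝕜, smul_eq_zero] at this
    exact this.resolve_left (Nat.cast_ne_zero.2 (Nat.succ_ne_zero _))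

/-- A homomorphism of Lie algebras acts on power series coefficientwise. -/
def map {L' : Type*} [LieRing L'] [LieAlgebra 𝕜 L'] (f : L →ₗ⁅𝕜⁆ L') :
    LieSeries σ L →ₗ⁅MvPowerSeries σ 𝕜⁆ LieSeries σ L' where
  toFun c := fun γ => f (c γ)
  map_add' c d := by
    funext γ
    exact map_add f _ _
  map_smul' r c := by
    funext γ
    change f (∑ p ∈ HasAntidiagonal.antidiagonal γ, _ • c p.2) = ∑ p ∈ HasAntidiagonal.antidiagonal γ, _ • f (c p.2)
    rw [map_sum]
    exact sum_congr rfl fun p _ => map_smul f _ _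
  map_lie' {c d} := by
    funext γ
    change f (∑ p ∈ HasAntidiagonal.antidiagonal γ, ⁅c p.1, d p.2⁆) = ∑ p ∈ HasAntidiagonal.antidiagonal γ, ⁅f (c p.1), f (d p.2)⁆
    rw [map_sum]
    exact sum_congr rfl fun p _ => LieHom.map_lie f _ _

lemma map_const {L' : Type*} [LieRing L'] [LieAlgebra 𝕜 L'] (f : L →ₗ⁅𝕜⁆ L') (x : L) :
    map (σ := σ) f (const σ L x) = const σ L' (f x) := by
  funext γ
  change f (if γ = 0 then x else 0) = if γ = 0 then f x else 0
  split_ifs <;> simp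

lemma map_pd {L' : Type*} [LieRing L'] [LieAlgebra 𝕜 L'] (f : L →ₗ⁅𝕜⁆ L') (s : σ)
    (c : LieSeries σ L) : map f (pd L s c) = pd L' s (map f c) := by
  funext γ
  exact map_nsmul f _ _

end LieSeries

/-! ### Taylor series of analytic functions -/

section Taylor

open MvPowerSeries Finset

variable {𝕜 : Type*} [RCLike 𝕜] {σ : Type*} [Fintype σ] [DecidableEq σ]
  {U : Set (σ → 𝕜)} {f g : (σ → 𝕜) → 𝕜} {a : σ → 𝕜}

lemma AnalyticOnNhd.partialDeriv (hf : AnalyticOnNhd 𝕜 f U) (s : σ) :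
    AnalyticOnNhd 𝕜 (partialDeriv s f) U :=
  fun x hx => ((ContinuousLinearMap.apply 𝕜 𝕜 (Pi.single s (1 : 𝕜) : σ → 𝕜)).analyticAt
    (fderiv 𝕜 f x)).comp (hf.fderiv x hx)

lemma partialDeriv_congr (hU : IsOpen U) (h : Set.EqOn f g U) (s : σ) :
    Set.EqOn (partialDeriv s f) (partialDeriv s g) U := fun x hx => by
  unfold partialDeriv
  rw [(h.eventuallyEq_of_mem (hU.mem_nhds hx)).fderiv_eq]

lemma partialDeriv_comm (hf : AnalyticOnNhd 𝕜 f U) (s t : σ) :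
    Set.EqOn (partialDeriv s (partialDeriv t f)) (partialDeriv t (partialDeriv s f)) U := by
  intro x hx
  have hsymm : IsSymmSndFDerivAt 𝕜 f x :=
    ContDiffAt.isSymmSndFDerivAt_of_omega (hf x hx).contDiffAt
  have key (v w : σ → 𝕜) : fderiv 𝕜 (fun y => fderiv 𝕜 f y v) x w = fderiv 𝕜 (fderiv 𝕜 f) x w v := by
    have hd : DifferentiableAt 𝕜 (fderiv 𝕜 f) x := (hf.fderiv x hx).differentiableAt
    rw [fderiv_clm_apply hd (differentiableAt_const v)]
    simp
  change fderiv 𝕜 (fun y => fderiv 𝕜 f y _) x _ = fderiv 𝕜 (fun y => fderiv 𝕜 f y _) x _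
  rw [key, key]
  exact hsymm _ _

lemma AnalyticOnNhd.foldr_partialDeriv (hf : AnalyticOnNhd 𝕜 f U) (l : List σ) :
    AnalyticOnNhd 𝕜 (l.foldr _root_.partialDeriv f) U := by
  induction l with
  | nil => exact hf
  | cons s l ih => exact ih.partialDeriv s

/-- `iteratedPartial` lists the derivatives in the unspecified order of `Multiset.toList`; for
analytic functions the order is irrelevant. -/
lemma foldr_partialDeriv_perm (hU : IsOpen U) (hf : AnalyticOnNhd 𝕜 f U) {l l' : List σ}
    (h : l.Perm l') : Set.EqOn (l.foldr partialDeriv f) (l'.foldr partialDeriv f) U := by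
  induction h with
  | nil => exact fun _ _ => rfl
  | cons s _ ih => exact partialDeriv_congr hU ih s
  | swap s t l => exact partialDeriv_comm (hf.foldr_partialDeriv l) t s
  | trans _ _ ih ih' => exact ih.trans ih'

lemma iteratedPartial_add_single (hU : IsOpen U) (hf : AnalyticOnNhd 𝕜 f U) (γ : σ →₀ ℕ) (s : σ) :
    Set.EqOn (iteratedPartial (γ + Finsupp.single s 1) f) (iteratedPartial γ (partialDeriv s f))
      U := by
  have h : (Finsupp.toMultiset (γ + Finsupp.single s 1)).toList.Perm
      ((Finsupp.toMultiset γ).toList ++ [s]) := by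
    rw [← Multiset.coe_eq_coe, Multiset.coe_toList, ← Multiset.coe_add, Multiset.coe_toList,
      map_add, Finsupp.toMultiset_single]
    simp
  have := foldr_partialDeriv_perm hU hf h
  rw [List.foldr_append] at this
  exact this

lemma coeff_taylorSeries (γ : σ →₀ ℕ) :
    coeff γ (taylorSeries f a) =
      ((∏ s, (γ s).factorial : ℕ) : 𝕜)⁻¹ * iteratedPartial γ f a := rfl

lemma constantCoeff_taylorSeries : constantCoeff (taylorSeries f a) = f a := by
  rw [← coeff_zero_eq_constantCoeff_apply, coeff_taylorSeries]
  simp [iteratedPartial]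

lemma taylorSeries_congr (hU : IsOpen U) (h : Set.EqOn f g U) (ha : a ∈ U) :
    taylorSeries f a = taylorSeries g a := by
  ext γ
  rw [coeff_taylorSeries, coeff_taylorSeries]
  congr 1
  have (l : List σ) : Set.EqOn (l.foldr partialDeriv f) (l.foldr partialDeriv g) U := by
    induction l with
    | nil => exact h
    | cons s l ih => exact partialDeriv_congr hU ih s
  exact this _ ha

/-- The key to all computations of Taylor series: a power series is determined by its constant term
and its derivatives, so algebraic rules can be proved by differentiating. -/
lemma pderiv_taylorSeries (hU : IsOpen U) (hf : AnalyticOnNhd 𝕜 f U) (ha : a ∈ U) (s : σ) :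
    MvPowerSeries.pderiv 𝕜 s (taylorSeries f a) = taylorSeries (partialDeriv s f) a := by
  ext γ
  rw [MvPowerSeries.coeff_pderiv, coeff_taylorSeries, coeff_taylorSeries,
    iteratedPartial_add_single hU hf γ s ha]
  have h : ∏ t, ((γ + Finsupp.single s 1 : σ →₀ ℕ) t).factorial =
      (γ s + 1) * ∏ t, (γ t).factorial := by
    rw [← Finset.mul_prod_erase univ _ (mem_univ s),
      ← Finset.mul_prod_erase univ (fun t => (γ t).factorial) (mem_univ s), ← mul_assoc]
    congr 1
    · simp [Nat.factorial_succ]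
    · refine Finset.prod_congr rfl fun t ht => ?_
      rw [Finsupp.add_apply, Finsupp.single_eq_of_ne (Finset.ne_of_mem_erase ht), add_zero]
  rw [h]
  have h1 : ((γ s : 𝕜) + 1) ≠ 0 := Nat.cast_add_one_ne_zero _
  have h2 : ((∏ t, (γ t).factorial : ℕ) : 𝕜) ≠ 0 :=
    Nat.cast_ne_zero.2 (Finset.prod_ne_zero_iff.2 fun t _ => Nat.factorial_ne_zero _)
  rw [Nat.cast_mul, Nat.cast_add_one]
  field_simp

/-- A family of power series indexed by tuples of functions that is closed under differentiation
vanishes if all constant terms do. -/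
lemma MvPowerSeries.eq_zero_of_pderiv_mem (S : Set (MvPowerSeries σ 𝕜))
    (h0 : ∀ P ∈ S, constantCoeff P = 0)
    (hS : ∀ P ∈ S, ∀ s, MvPowerSeries.pderiv 𝕜 s P ∈ Submodule.span 𝕜 S)
    {P : MvPowerSeries σ 𝕜} (hP : P ∈ S) : P = 0 := by
  -- The induction on the degree runs over the whole span, because the derivative of a member of `S`
  -- is only a combination of members.
  have key : ∀ n : ℕ, ∀ γ : σ →₀ ℕ, γ.degree = n → ∀ P ∈ Submodule.span 𝕜 S, coeff γ P = 0 := by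
    intro n
    induction n with
    | zero =>
      intro γ hγ P hP
      rw [Finsupp.degree_eq_zero_iff] at hγ
      subst hγ
      induction hP using Submodule.span_induction with
      | mem P hP => exact h0 P hP
      | zero => simp
      | add P Q _ _ hP hQ => rw [map_add, hP, hQ, add_zero]
      | smul t P _ hP => rw [map_smul, hP, smul_zero]
    | succ n ih =>
      intro γ hγ P hP
      obtain ⟨s, hs⟩ : ∃ s, γ s ≠ 0 := by
        by_contra! h
        have : γ = 0 := Finsupp.ext h
        rw [this, map_zero] at hγ
        omega
      have hle : Finsupp.single s 1 ≤ γ := by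
        rw [Finsupp.single_le_iff]
        exact Nat.one_le_iff_ne_zero.2 hs
      have hdeg : (γ - Finsupp.single s 1).degree = n := by
        have : (γ - Finsupp.single s 1 + Finsupp.single s 1).degree = n + 1 := by
          rw [tsub_add_cancel_of_le hle, hγ]
        rw [map_add, Finsupp.degree_single] at this
        omega
      have hmem : MvPowerSeries.pderiv 𝕜 s P ∈ Submodule.span 𝕜 S := by
        clear hγ hle hdeg
        induction hP using Submodule.span_induction with
        | mem P hP => exact hS P hP s
        | zero => simp
        | add P Q _ _ hP hQ => rw [map_add]; exact add_mem hP hQ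
        | smul t P _ hP => rw [Derivation.map_smul]; exact Submodule.smul_mem _ _ hP
      have := ih _ hdeg _ hmem
      rw [MvPowerSeries.coeff_pderiv, tsub_add_cancel_of_le hle] at this
      exact (mul_eq_zero.1 this).resolve_right (Nat.cast_add_one_ne_zero _)
  ext γ
  exact key _ γ rfl P (Submodule.subset_span hP)

lemma partialDeriv_add (hf : AnalyticOnNhd 𝕜 f U) (hg : AnalyticOnNhd 𝕜 g U) (s : σ) :
    Set.EqOn (partialDeriv s (f + g)) (partialDeriv s f + partialDeriv s g) U := fun x hx => by
  unfold partialDeriv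
  rw [fderiv_add (hf x hx).differentiableAt (hg x hx).differentiableAt]
  rfl

lemma partialDeriv_mul (hf : AnalyticOnNhd 𝕜 f U) (hg : AnalyticOnNhd 𝕜 g U) (s : σ) :
    Set.EqOn (partialDeriv s (f * g)) (partialDeriv s f * g + f * partialDeriv s g) U :=
  fun x hx => by
  unfold partialDeriv
  rw [fderiv_mul (hf x hx).differentiableAt (hg x hx).differentiableAt]
  simp [mul_comm, add_comm]

lemma taylorSeries_add (hU : IsOpen U) (hf : AnalyticOnNhd 𝕜 f U) (hg : AnalyticOnNhd 𝕜 g U)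
    (ha : a ∈ U) : taylorSeries (f + g) a = taylorSeries f a + taylorSeries g a := by
  rw [← sub_eq_zero]
  refine MvPowerSeries.eq_zero_of_pderiv_mem
    {P | ∃ f g : (σ → 𝕜) → 𝕜, AnalyticOnNhd 𝕜 f U ∧ AnalyticOnNhd 𝕜 g U ∧
      P = taylorSeries (f + g) a - (taylorSeries f a + taylorSeries g a)} ?_ ?_
    ⟨f, g, hf, hg, rfl⟩
  · rintro _ ⟨f, g, hf, hg, rfl⟩
    simp [constantCoeff_taylorSeries]
  · rintro _ ⟨f, g, hf, hg, rfl⟩ s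
    refine Submodule.subset_span ⟨partialDeriv s f, partialDeriv s g, hf.partialDeriv s,
      hg.partialDeriv s, ?_⟩
    rw [map_sub, map_add, pderiv_taylorSeries hU hf ha, pderiv_taylorSeries hU hg ha,
      pderiv_taylorSeries (f := f + g) hU (hf.add hg) ha,
      taylorSeries_congr hU (partialDeriv_add hf hg s) ha]

/-- By the Leibniz rule on both sides, the derivative of the defect of a pair `f`, `g` is the sum of
the defects of `∂f`, `g` and of `f`, `∂g`. -/
lemma taylorSeries_mul (hU : IsOpen U) (hf : AnalyticOnNhd 𝕜 f U) (hg : AnalyticOnNhd 𝕜 g U)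
    (ha : a ∈ U) : taylorSeries (f * g) a = taylorSeries f a * taylorSeries g a := by
  rw [← sub_eq_zero]
  refine MvPowerSeries.eq_zero_of_pderiv_mem
    {P | ∃ f g : (σ → 𝕜) → 𝕜, AnalyticOnNhd 𝕜 f U ∧ AnalyticOnNhd 𝕜 g U ∧
      P = taylorSeries (f * g) a - taylorSeries f a * taylorSeries g a} ?_ ?_
    ⟨f, g, hf, hg, rfl⟩
  · rintro _ ⟨f, g, hf, hg, rfl⟩
    simp [constantCoeff_taylorSeries]
  · rintro _ ⟨f, g, hf, hg, rfl⟩ s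
    have h : MvPowerSeries.pderiv 𝕜 s (taylorSeries (f * g) a - taylorSeries f a * taylorSeries g a)
        = (taylorSeries (partialDeriv s f * g) a
            - taylorSeries (partialDeriv s f) a * taylorSeries g a)
          + (taylorSeries (f * partialDeriv s g) a
            - taylorSeries f a * taylorSeries (partialDeriv s g) a) := by
      rw [map_sub, Derivation.leibniz, pderiv_taylorSeries hU hf ha, pderiv_taylorSeries hU hg ha,
        pderiv_taylorSeries (f := f * g) hU (hf.mul hg) ha,
        taylorSeries_congr hU (partialDeriv_mul hf hg s) ha,
        taylorSeries_add (f := partialDeriv s f * g) (g := f * partialDeriv s g) hU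
          ((hf.partialDeriv s).mul hg) (hf.mul (hg.partialDeriv s)) ha,
        smul_eq_mul, smul_eq_mul]
      ring
    rw [h]
    exact add_mem (Submodule.subset_span ⟨_, _, hf.partialDeriv s, hg, rfl⟩)
      (Submodule.subset_span ⟨_, _, hf, hg.partialDeriv s, rfl⟩)

lemma partialDeriv_const (s : σ) (t : 𝕜) : partialDeriv s (fun _ : σ → 𝕜 => t) = fun _ => 0 := by
  funext x
  simp [partialDeriv]

lemma taylorSeries_const (t : 𝕜) : taylorSeries (fun _ : σ → 𝕜 => t) a = C t := by
  have hU : AnalyticOnNhd 𝕜 (fun _ : σ → 𝕜 => t) Set.univ := analyticOnNhd_const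
  have h0 : taylorSeries (fun _ : σ → 𝕜 => (0 : 𝕜)) a = 0 := by
    refine MvPowerSeries.eq_zero_of_pderiv_mem {taylorSeries (fun _ : σ → 𝕜 => (0 : 𝕜)) a}
      ?_ ?_ rfl
    · rintro _ rfl
      rw [constantCoeff_taylorSeries]
    · rintro _ rfl s
      rw [pderiv_taylorSeries isOpen_univ analyticOnNhd_const (Set.mem_univ a),
        partialDeriv_const]
      exact Submodule.subset_span rfl
  refine MvPowerSeries.pderiv.ext (fun s => ?_) ?_
  · rw [pderiv_taylorSeries isOpen_univ hU (Set.mem_univ a), partialDeriv_const, h0,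
      MvPowerSeries.pderiv_C]
  · rw [constantCoeff_taylorSeries, constantCoeff_C]

lemma taylorSeries_coord (s : σ) : taylorSeries (fun x : σ → 𝕜 => x s) a = C (a s) + X s := by
  have hU : AnalyticOnNhd 𝕜 (fun x : σ → 𝕜 => x s) Set.univ :=
    (ContinuousLinearMap.proj (R := 𝕜) (φ := fun _ : σ => 𝕜) s).analyticOnNhd _
  refine MvPowerSeries.pderiv.ext (fun t => ?_) ?_
  · rw [pderiv_taylorSeries isOpen_univ hU (Set.mem_univ a)]
    have : partialDeriv t (fun x : σ → 𝕜 => x s) =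
        fun _ => (Pi.single t (1 : 𝕜) : σ → 𝕜) s := by
      funext x
      unfold partialDeriv
      have := (ContinuousLinearMap.proj (R := 𝕜) (φ := fun _ : σ => 𝕜) s).fderiv (x := x)
      exact DFunLike.congr_fun this (Pi.single t 1)
    rw [this, taylorSeries_const, map_add, MvPowerSeries.pderiv_C, zero_add,
      MvPowerSeries.pderiv_X, Pi.single_apply, Pi.single_apply]
    split_ifs <;> simp
  · simp [constantCoeff_taylorSeries]

/-- The function `f` is analytic on `U`, and its Taylor series at `a` is `P`. -/
def HasTaylor (U : Set (σ → 𝕜)) (a : σ → 𝕜) (f : (σ → 𝕜) → 𝕜) (P : MvPowerSeries σ 𝕜) : Prop :=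
  AnalyticOnNhd 𝕜 f U ∧ taylorSeries f a = P

namespace HasTaylor

variable {P Q : MvPowerSeries σ 𝕜}

lemma const (t : 𝕜) : HasTaylor U a (fun _ => t) (C t) :=
  ⟨analyticOnNhd_const, taylorSeries_const t⟩

lemma coord (s : σ) : HasTaylor U a (fun x => x s) (C (a s) + X s) :=
  ⟨(ContinuousLinearMap.proj (R := 𝕜) (φ := fun _ : σ => 𝕜) s).analyticOnNhd _,
    taylorSeries_coord s⟩

lemma add (hU : IsOpen U) (ha : a ∈ U) (hf : HasTaylor U a f P) (hg : HasTaylor U a g Q) :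
    HasTaylor U a (fun x => f x + g x) (P + Q) :=
  ⟨hf.1.add hg.1, by rw [← hf.2, ← hg.2]; exact taylorSeries_add hU hf.1 hg.1 ha⟩

lemma mul (hU : IsOpen U) (ha : a ∈ U) (hf : HasTaylor U a f P) (hg : HasTaylor U a g Q) :
    HasTaylor U a (fun x => f x * g x) (P * Q) :=
  ⟨hf.1.mul hg.1, by rw [← hf.2, ← hg.2]; exact taylorSeries_mul hU hf.1 hg.1 ha⟩

lemma sub (hU : IsOpen U) (ha : a ∈ U) (hf : HasTaylor U a f P) (hg : HasTaylor U a g Q) :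
    HasTaylor U a (fun x => f x - g x) (P - Q) := by
  have h := hf.add hU ha ((HasTaylor.const (-1)).mul hU ha hg)
  have h1 : (fun x => f x + -1 * g x) = fun x => f x - g x := by
    funext x
    ring
  have h2 : P + C (-1) * Q = P - Q := by
    rw [map_neg, map_one]
    ring
  rwa [h1, h2] at h

lemma pow (hU : IsOpen U) (ha : a ∈ U) (hf : HasTaylor U a f P) (n : ℕ) :
    HasTaylor U a (fun x => f x ^ n) (P ^ n) := by
  induction n with
  | zero => simpa using HasTaylor.const (U := U) (a := a) 1
  | succ n ih =>
    have h := ih.mul hU ha hf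
    simpa only [pow_succ] using h

lemma sum (hU : IsOpen U) (ha : a ∈ U) {ι : Type*} (s : Finset ι) {f : ι → (σ → 𝕜) → 𝕜}
    {P : ι → MvPowerSeries σ 𝕜} (hf : ∀ i, HasTaylor U a (f i) (P i)) :
    HasTaylor U a (fun x => ∑ i ∈ s, f i x) (∑ i ∈ s, P i) := by
  classical
  induction s using Finset.induction_on with
  | empty => simpa using HasTaylor.const (U := U) (a := a) 0
  | insert i s hi ih =>
    simp only [Finset.sum_insert hi]
    exact (hf i).add hU ha ih

/-- On `U` the product `f * f⁻¹` is the constant 1, so the two Taylor series are inverse to each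
other. -/
lemma inv (hU : IsOpen U) (ha : a ∈ U) (hf : HasTaylor U a f P) (h0 : ∀ x ∈ U, f x ≠ 0) :
    HasTaylor U a (fun x => (f x)⁻¹) P⁻¹ := by
  have han : AnalyticOnNhd 𝕜 (fun x => (f x)⁻¹) U := hf.1.inv h0
  refine ⟨han, ?_⟩
  have h1 : taylorSeries (f * fun x => (f x)⁻¹) a = 1 := by
    rw [← map_one C, ← taylorSeries_const (a := a) (1 : 𝕜)]
    exact taylorSeries_congr hU (fun x hx => mul_inv_cancel₀ (h0 x hx)) ha
  rw [taylorSeries_mul hU hf.1 han ha, hf.2] at h1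
  have hP : constantCoeff P ≠ 0 := by
    rw [← hf.2, constantCoeff_taylorSeries]
    exact h0 a ha
  rw [MvPowerSeries.eq_inv_iff_mul_eq_one hP, mul_comm, h1]

end HasTaylor

end Taylor

/-! ### Vector fields on power series -/

section JetSeries

open MvPowerSeries Finset

variable {𝕜 : Type*} [RCLike 𝕜] {m : ℕ}

/-- The vector field `∑ f_j ∂/∂X_{v j}` on scalar power series. -/
def scalarField {σ ι : Type*} [Fintype ι] (f : ι → MvPowerSeries σ 𝕜) (v : ι → σ) :
    Derivation 𝕜 (MvPowerSeries σ 𝕜) (MvPowerSeries σ 𝕜) :=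
  ∑ j, f j • MvPowerSeries.pderiv 𝕜 (v j)

lemma scalarField_apply {σ ι : Type*} [Fintype ι] (f : ι → MvPowerSeries σ 𝕜) (v : ι → σ)
    (g : MvPowerSeries σ 𝕜) :
    scalarField f v g = ∑ j, f j * MvPowerSeries.pderiv 𝕜 (v j) g := by
  rw [scalarField, ← Derivation.coeFnAddMonoidHom_apply, map_sum, Finset.sum_apply]
  rfl

namespace LieSeries

variable {σ ι : Type*} [DecidableEq σ] [Fintype ι] {L : Type*} [LieRing L] [LieAlgebra 𝕜 L]

variable (L) in
/-- The vector field `∑ f_j ∂/∂X_{v j}` on power series with coefficients in `L`. -/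
def field (f : ι → MvPowerSeries σ 𝕜) (v : ι → σ) : LieSeries σ L →+ LieSeries σ L where
  toFun c := ∑ j, f j • pd L (v j) c
  map_zero' := by simp
  map_add' c d := by simp [sum_add_distrib]

lemma field_apply (f : ι → MvPowerSeries σ 𝕜) (v : ι → σ) (c : LieSeries σ L) :
    field L f v c = ∑ j, f j • pd L (v j) c := rfl

lemma field_smul (f : ι → MvPowerSeries σ 𝕜) (v : ι → σ) (g : MvPowerSeries σ 𝕜)
    (c : LieSeries σ L) :
    field L f v (g • c) = scalarField f v g • c + g • field L f v c := by
  simp only [field_apply, pd_smul, scalarField_apply, smul_add, sum_add_distrib, sum_smul,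
    smul_sum, smul_smul, mul_comm g]

lemma field_lie (f : ι → MvPowerSeries σ 𝕜) (v : ι → σ) (c d : LieSeries σ L) :
    field L f v ⁅c, d⁆ = ⁅field L f v c, d⁆ + ⁅c, field L f v d⁆ := by
  simp only [field_apply, pd_lie, smul_add, sum_add_distrib, sum_lie, lie_sum, smul_lie, lie_smul]

lemma field_const (f : ι → MvPowerSeries σ 𝕜) (v : ι → σ) (x : L) :
    field L f v (const σ L x) = 0 := by
  simp [field_apply, pd_const]

lemma map_field {L' : Type*} [LieRing L'] [LieAlgebra 𝕜 L'] (φ : L →ₗ⁅𝕜⁆ L')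
    (f : ι → MvPowerSeries σ 𝕜) (v : ι → σ) (c : LieSeries σ L) :
    map φ (field L f v c) = field L' f v (map φ c) := by
  simp only [field_apply, map_sum, ← map_pd]
  exact sum_congr rfl fun j _ => _root_.map_smul (map φ) _ _

lemma pd_field (f : ι → MvPowerSeries σ 𝕜) (v : ι → σ) (s : σ) (c : LieSeries σ L) :
    pd L s (field L f v c) =
      field L (fun j => MvPowerSeries.pderiv 𝕜 s (f j)) v c + field L f v (pd L s c) := by
  simp only [field_apply, map_sum, pd_smul, sum_add_distrib, pd_comm s]

end LieSeries

/-! ### The jet coordinates and the right-hand side of the system as power series -/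

/-- The jet coordinate `u^i_k` as a power series in the variables `u^i_k - a^i_k`. -/
def jetU (a : Fin m × ℕ → 𝕜) (k : Fin 4) (i : Fin m) : MvPowerSeries (JetIdx m 4) 𝕜 :=
  C (a (i, (k : ℕ))) + X (i, k)

/-- The power series of `1 / (1 + ⟨u, u⟩)`. -/
def jetInv (a : Fin m × ℕ → 𝕜) : MvPowerSeries (JetIdx m 4) 𝕜 :=
  (1 + jetU a 0 ⬝ᵥ jetU a 0)⁻¹

/-- The power series of the right-hand side of the Landau–Lifshitz system. -/
def jetF (r : Fin (m + 1) → 𝕜) (a : Fin m × ℕ → 𝕜) (j : Fin m) : MvPowerSeries (JetIdx m 4) 𝕜 :=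
  jetU a 3 j - 6 * (jetU a 0 ⬝ᵥ jetU a 1) * jetInv a * jetU a 2 j
    + (-6 * (jetU a 0 ⬝ᵥ jetU a 2) * jetInv a
        + 24 * (jetU a 0 ⬝ᵥ jetU a 1) ^ 2 * (jetInv a) ^ 2
        - 6 * (jetU a 0 ⬝ᵥ jetU a 0) * (jetU a 1 ⬝ᵥ jetU a 1) * (jetInv a) ^ 2) * jetU a 1 j
    + (6 * (jetU a 1 ⬝ᵥ jetU a 2) * jetInv a
        - 12 * (jetU a 0 ⬝ᵥ jetU a 1) * (jetU a 1 ⬝ᵥ jetU a 1) * (jetInv a) ^ 2) * jetU a 0 j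
    + C (3 / 2) * (C (r (Fin.last m)) + 4 * (jetInv a) ^ 2 *
        ∑ i : Fin m, C (r i.castSucc - r (Fin.last m)) * jetU a 0 i ^ 2) * jetU a 1 j

lemma jetInv_mul (a : Fin m × ℕ → 𝕜) (ha : a ∈ jetDomain 𝕜 m) :
    (1 + jetU a 0 ⬝ᵥ jetU a 0) * jetInv a = 1 := by
  refine MvPowerSeries.mul_inv_cancel _ ?_
  have : constantCoeff (1 + jetU a 0 ⬝ᵥ jetU a 0) = 1 + ∑ i : Fin m, a (i, 0) ^ 2 := by
    simp [jetU, dotProduct, pow_two]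
  rw [this]
  exact ha

/-- From here on analysis is no longer needed: the right-hand side of the system is a polynomial in
the coordinates `jetU` and in `jetInv`. -/
lemma taylorSeries_landauLifshitz (r : Fin (m + 1) → 𝕜) (a : Fin m × ℕ → 𝕜)
    (ha : a ∈ jetDomain 𝕜 m) (j : Fin m) :
    taylorSeries (landauLifshitz r j) (fun s => a (s.1, (s.2 : ℕ))) = jetF r a j := by
  set U : Set (JetIdx m 4 → 𝕜) := {v | 1 + (fun i => v (i, 0)) ⬝ᵥ (fun i => v (i, 0)) ≠ 0}
  set b : JetIdx m 4 → 𝕜 := fun s => a (s.1, (s.2 : ℕ))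
  have hU : IsOpen U := by
    refine isOpen_ne_fun ?_ continuous_const
    unfold dotProduct
    fun_prop
  have hb : b ∈ U := by
    have : (1 : 𝕜) + ∑ i : Fin m, a (i, 0) ^ 2 ≠ 0 := ha
    simpa [U, b, dotProduct, pow_two] using this
  have hu (k : Fin 4) (i : Fin m) : HasTaylor U b (fun v => v (i, k)) (jetU a k i) :=
    HasTaylor.coord (i, k)
  have hdot (k l : Fin 4) : HasTaylor U b
      (fun v => (fun i => v (i, k)) ⬝ᵥ (fun i => v (i, l))) (jetU a k ⬝ᵥ jetU a l) :=
    HasTaylor.sum hU hb _ fun i => (hu k i).mul hU hb (hu l i)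
  have hnum (n : ℕ) [n.AtLeastTwo] :
      HasTaylor U b (fun _ => (OfNat.ofNat n : 𝕜)) (OfNat.ofNat n) := by
    have := HasTaylor.const (U := U) (a := b) (OfNat.ofNat n : 𝕜)
    rwa [map_ofNat] at this
  have hneg : HasTaylor U b (fun _ => (-6 : 𝕜)) (-6) := by
    have := HasTaylor.const (U := U) (a := b) (-6 : 𝕜)
    rwa [map_neg, map_ofNat] at this
  have hone : HasTaylor U b (fun _ => (1 : 𝕜)) 1 := by
    have := HasTaylor.const (U := U) (a := b) (1 : 𝕜)
    rwa [map_one] at this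
  have hΔ := hone.add hU hb (hdot 0 0)
  have hinv : HasTaylor U b
      (fun v => (1 + (fun i => v (i, 0)) ⬝ᵥ (fun i => v (i, 0)))⁻¹) (jetInv a) :=
    hΔ.inv hU hb fun _ h => h
  have hinv2 : HasTaylor U b
      (fun v => ((1 + (fun i => v (i, 0)) ⬝ᵥ (fun i => v (i, 0))) ^ 2)⁻¹) (jetInv a ^ 2) := by
    have := hinv.pow hU hb 2
    simpa only [inv_pow] using this
  have hsum := HasTaylor.sum hU hb univ fun i =>
    (HasTaylor.const (U := U) (a := b) (r i.castSucc - r (Fin.last m))).mul hU hb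
      ((hu 0 i).pow hU hb 2)
  have h1 := ((((hnum 6).mul hU hb (hdot 0 1)).mul hU hb hinv).mul hU hb (hu 2 j))
  have h2 := (((hneg.mul hU hb (hdot 0 2)).mul hU hb hinv).add hU hb
    (((hnum 24).mul hU hb ((hdot 0 1).pow hU hb 2)).mul hU hb hinv2)).sub hU hb
    ((((hnum 6).mul hU hb (hdot 0 0)).mul hU hb (hdot 1 1)).mul hU hb hinv2)
  have h3 := (((hnum 6).mul hU hb (hdot 1 2)).mul hU hb hinv).sub hU hb
    ((((hnum 12).mul hU hb (hdot 0 1)).mul hU hb (hdot 1 1)).mul hU hb hinv2)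
  have h4 := ((HasTaylor.const (U := U) (a := b) (3 / 2 : 𝕜)).mul hU hb
    ((HasTaylor.const (U := U) (a := b) (r (Fin.last m))).add hU hb
      (((hnum 4).mul hU hb hinv2).mul hU hb hsum)))
  exact (((((hu 3 j).sub hU hb h1).add hU hb (h2.mul hU hb (hu 1 j))).add hU hb
    (h3.mul hU hb (hu 0 j))).add hU hb (h4.mul hU hb (hu 1 j))).2

lemma pderiv_jetU (a : Fin m × ℕ → 𝕜) (s : JetIdx m 4) (k : Fin 4) (i : Fin m) :
    MvPowerSeries.pderiv 𝕜 s (jetU a k i) = if s = (i, k) then 1 else 0 := by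
  rw [jetU, map_add, MvPowerSeries.pderiv_C, zero_add, MvPowerSeries.pderiv_X, Pi.single_apply]
  simp only [eq_comm]

end JetSeries

/-! ### Extension of power series to more variables -/

namespace LieSeries

open Finset

variable {𝕜 : Type*} [Field 𝕜] {σ τ : Type*} [DecidableEq σ] [DecidableEq τ] {L : Type*} [LieRing L]
  [LieAlgebra 𝕜 L]

/-- `FormalSeries.extend` as a map between the Lie algebras of power series. -/
def ext (ι : σ → τ) (c : FormalSeries σ L) : LieSeries τ L := FormalSeries.extend ι c

/-- The part of a power series that involves only the variables in the image of `ι`. -/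
def restr (ι : σ → τ) (c : LieSeries τ L) : FormalSeries σ L := fun γ => c (Finsupp.mapDomain ι γ)

lemma ext_mapDomain {ι : σ → τ} (hι : Function.Injective ι) (c : FormalSeries σ L) (γ : σ →₀ ℕ) :
    ext ι c (Finsupp.mapDomain ι γ) = c γ :=
  (Finsupp.mapDomain_injective hι).extend_apply _ _ _

lemma ext_of_notMem {ι : σ → τ} (c : FormalSeries σ L) {γ : τ →₀ ℕ}
    (h : γ ∉ Set.range (Finsupp.mapDomain ι : (σ →₀ ℕ) → τ →₀ ℕ)) : ext ι c γ = 0 :=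
  Function.extend_apply' _ _ _ h

lemma restr_ext {ι : σ → τ} (hι : Function.Injective ι) (c : FormalSeries σ L) :
    restr ι (ext ι c) = c :=
  funext fun γ => ext_mapDomain hι c γ

/-- The exponents that come from the smaller set of variables are those supported in the image of
`ι`. -/
lemma mem_range_mapDomain {ι : σ → τ} (hι : Function.Injective ι) (γ : τ →₀ ℕ) :
    γ ∈ Set.range (Finsupp.mapDomain ι : (σ →₀ ℕ) → τ →₀ ℕ) ↔ ∀ t ∉ Set.range ι, γ t = 0 := by
  constructor
  · rintro ⟨γ, rfl⟩ t ht
    exact Finsupp.mapDomain_of_notMem_range _ _ ht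
  · intro h
    refine ⟨Finsupp.comapDomain ι γ hι.injOn, Finsupp.mapDomain_comapDomain ι hι γ ?_⟩
    intro t ht
    by_contra h'
    exact Finsupp.mem_support_iff.1 ht (h t h')

lemma pd_ext {ι : σ → τ} (hι : Function.Injective ι) (c : FormalSeries σ L) (s : σ) :
    pd L (ι s) (ext ι c) = ext ι (FormalSeries.pderiv s c) := by
  funext γ
  change (γ (ι s) + 1) • ext ι c (γ + Finsupp.single (ι s) 1) = _
  by_cases h : γ ∈ Set.range (Finsupp.mapDomain ι : (σ →₀ ℕ) → τ →₀ ℕ)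
  · obtain ⟨γ, rfl⟩ := h
    rw [ext_mapDomain hι, ← Finsupp.mapDomain_single, ← Finsupp.mapDomain_add, ext_mapDomain hι,
      Finsupp.mapDomain_apply hι]
    rfl
  · rw [ext_of_notMem _ h, ext_of_notMem, smul_zero]
    rw [mem_range_mapDomain hι] at h ⊢
    intro h'
    refine h fun t ht => ?_
    have := h' t ht
    rw [Finsupp.add_apply] at this
    omega

lemma pd_ext_of_notMem {ι : σ → τ} (hι : Function.Injective ι) (c : FormalSeries σ L) {t : τ}
    (ht : t ∉ Set.range ι) : pd L t (ext ι c) = 0 := by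
  funext γ
  change (γ t + 1) • ext ι c (γ + Finsupp.single t 1) = 0
  rw [ext_of_notMem, smul_zero]
  rw [mem_range_mapDomain hι]
  intro h
  have := h t ht
  rw [Finsupp.add_apply, Finsupp.single_eq_same] at this
  omega

/-- A power series whose derivatives with respect to the variables outside the image of `ι` vanish
is a power series in the variables in the image. -/
lemma ext_restr [CharZero 𝕜] {ι : σ → τ} (hι : Function.Injective ι) (c : LieSeries τ L)
    (h : ∀ t ∉ Set.range ι, pd L t c = 0) : ext ι (restr ι c) = c := by
  funext γ
  by_cases hγ : γ ∈ Set.range (Finsupp.mapDomain ι : (σ →₀ ℕ) → τ →₀ ℕ)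
  · obtain ⟨γ, rfl⟩ := hγ
    rw [ext_mapDomain hι]
    rfl
  · rw [ext_of_notMem _ hγ]
    rw [mem_range_mapDomain hι] at hγ
    push Not at hγ
    obtain ⟨t, ht, h0⟩ := hγ
    have hle : Finsupp.single t 1 ≤ γ := by
      rw [Finsupp.single_le_iff]
      exact Nat.one_le_iff_ne_zero.2 h0
    have := congrFun (h t ht) (γ - Finsupp.single t 1)
    change ((γ - Finsupp.single t 1 : τ →₀ ℕ) t + 1) •
      c (γ - Finsupp.single t 1 + Finsupp.single t 1) = 0 at this
    rw [tsub_add_cancel_of_le hle, ← Nat.cast_smul_eq_nsmul 𝕜, smul_eq_zero] at this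
    exact (this.resolve_left (Nat.cast_ne_zero.2 (Nat.succ_ne_zero _))).symm

lemma map_ext {L' : Type*} [LieRing L'] [LieAlgebra 𝕜 L'] (f : L →ₗ⁅𝕜⁆ L') {ι : σ → τ}
    (hι : Function.Injective ι) (c : FormalSeries σ L) :
    map f (ext ι c) = ext ι (fun γ => f (c γ)) := by
  funext γ
  change f (ext ι c γ) = _
  by_cases h : γ ∈ Set.range (Finsupp.mapDomain ι : (σ →₀ ℕ) → τ →₀ ℕ)
  · obtain ⟨γ, rfl⟩ := h
    rw [ext_mapDomain hι, ext_mapDomain hι]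
  · rw [ext_of_notMem _ h, ext_of_notMem _ h, map_zero]

end LieSeries

/-! ### The zero-curvature equation for the Landau–Lifshitz system -/

section ZeroCurvature

open Finset

variable {𝕜 : Type*} [RCLike 𝕜] {m : ℕ} {L : Type*} [LieRing L] [LieAlgebra 𝕜 L]

lemma jetIncl_injective {M N : ℕ} (h : M ≤ N) :
    Function.Injective (jetIncl h : JetIdx m M → JetIdx m N) := by
  rintro ⟨i, k⟩ ⟨j, l⟩ h'
  simpa [jetIncl] using h'

/-- The total derivative `D_x` on scalar power series. -/
def scalarDx (a : Fin m × ℕ → 𝕜) :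
    Derivation 𝕜 (MvPowerSeries (JetIdx m 4) 𝕜) (MvPowerSeries (JetIdx m 4) 𝕜) :=
  scalarField (fun s : JetIdx m 3 => jetU a s.2.succ s.1) (fun s => (s.1, s.2.castSucc))

/-- The total derivative `D_t` on scalar power series that depend on `u^i_0` only. -/
def scalarDt (r : Fin (m + 1) → 𝕜) (a : Fin m × ℕ → 𝕜) :
    Derivation 𝕜 (MvPowerSeries (JetIdx m 4) 𝕜) (MvPowerSeries (JetIdx m 4) 𝕜) :=
  scalarField (jetF r a) (fun i => (i, 0))

namespace LieSeries

variable (L) in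
/-- The total derivative `D_x` on power series that do not depend on `u^i_3`. -/
def Dx (a : Fin m × ℕ → 𝕜) : LieSeries (JetIdx m 4) L →+ LieSeries (JetIdx m 4) L :=
  field L (fun s : JetIdx m 3 => jetU a s.2.succ s.1) (fun s => (s.1, s.2.castSucc))

variable (L) in
/-- The total derivative `D_t` on power series that depend on `u^i_0` only. -/
def Dt (r : Fin (m + 1) → 𝕜) (a : Fin m × ℕ → 𝕜) :
    LieSeries (JetIdx m 4) L →+ LieSeries (JetIdx m 4) L :=
  field L (jetF r a) (fun i => (i, 0))

lemma map_Dx {L' : Type*} [LieRing L'] [LieAlgebra 𝕜 L'] (φ : L →ₗ⁅𝕜⁆ L') (a : Fin m × ℕ → 𝕜)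
    (c : LieSeries (JetIdx m 4) L) : map φ (Dx L a c) = Dx L' a (map φ c) :=
  map_field φ _ _ c

lemma map_Dt {L' : Type*} [LieRing L'] [LieAlgebra 𝕜 L'] (φ : L →ₗ⁅𝕜⁆ L')
    (r : Fin (m + 1) → 𝕜) (a : Fin m × ℕ → 𝕜) (c : LieSeries (JetIdx m 4) L) :
    map φ (Dt L r a c) = Dt L' r a (map φ c) :=
  map_field φ _ _ c

end LieSeries

open LieSeries

/-- The definition mixes series in three different sets of variables. Here everything is moved into
the single Lie algebra of series in $u_0,\dots,u_3$, where `A` and `B` are singled out by vanishing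
derivatives. -/
lemma zeroCurvature_eq (r : Fin (m + 1) → 𝕜) (a : Fin m × ℕ → 𝕜) (ha : a ∈ jetDomain 𝕜 m)
    (A : FormalSeries (JetIdx m 1) L) (B : FormalSeries (JetIdx m 3) L) :
    @Eq (LieSeries (JetIdx m 4) L) (zeroCurvature (landauLifshitz r) a A B)
      (Dx L a (ext (jetIncl (Nat.le_succ 3)) B) - Dt L r a (ext (jetIncl (Nat.le_add_left 1 3)) A) +
        ⁅ext (jetIncl (Nat.le_add_left 1 3)) A, ext (jetIncl (Nat.le_succ 3)) B⁆) := by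
  have hx : totalDx a B = Dx L a (ext (jetIncl (Nat.le_succ 3)) B) := by
    rw [Dx, field_apply]
    refine sum_congr rfl fun s _ => ?_
    have := pd_ext (jetIncl_injective (Nat.le_succ 3)) B s
    change _ = _ • pd L (jetIncl (Nat.le_succ 3) s) _
    rw [this]
    rfl
  have ht : totalDt (landauLifshitz r) a A = Dt L r a (ext (jetIncl (Nat.le_add_left 1 3)) A) := by
    rw [Dt, field_apply]
    refine sum_congr rfl fun i _ => ?_
    have := pd_ext (jetIncl_injective (Nat.le_add_left 1 3)) A (i, 0)
    change _ = _ • pd L (jetIncl (Nat.le_add_left 1 3) (i, 0)) _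
    rw [this, ← taylorSeries_landauLifshitz r a ha]
    rfl
  change (_ : LieSeries (JetIdx m 4) L) - _ + _ = _
  rw [hx, ht]
  rfl

end ZeroCurvature

/-! ### Universal properties -/

namespace PresentedLieAlgebra

variable {𝕜 : Type*} [Field 𝕜] {X : Type*} {rels : Set (FreeLieAlgebra 𝕜 X)} {L : Type*} [LieRing L]
  [LieAlgebra 𝕜 L]

variable (rels) in
/-- The projection from the free Lie algebra. -/
def mk : FreeLieAlgebra 𝕜 X →ₗ⁅𝕜⁆ PresentedLieAlgebra 𝕜 rels where
  toLinearMap := (LieSubmodule.lieSpan 𝕜 (FreeLieAlgebra 𝕜 X) rels).toSubmodule.mkQ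
  map_lie' := rfl

lemma mk_of (x : X) : mk rels (FreeLieAlgebra.of 𝕜 x) = gen rels x := rfl

lemma mk_eq_zero_of_mem {y : FreeLieAlgebra 𝕜 X} (hy : y ∈ rels) : mk rels y = 0 :=
  (Submodule.Quotient.mk_eq_zero _).2 (LieSubmodule.subset_lieSpan hy)

lemma mk_surjective : Function.Surjective (mk rels) := Submodule.mkQ_surjective _

/-- The homomorphism from a presented Lie algebra determined by the images of the generators. -/
def lift (f : X → L) (h : ∀ y ∈ rels, FreeLieAlgebra.lift 𝕜 f y = 0) :
    PresentedLieAlgebra 𝕜 rels →ₗ⁅𝕜⁆ L where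
  toLinearMap := (LieSubmodule.lieSpan 𝕜 (FreeLieAlgebra 𝕜 X) rels).toSubmodule.liftQ
    (FreeLieAlgebra.lift 𝕜 f : FreeLieAlgebra 𝕜 X →ₗ[𝕜] L) (by
      have hle : LieSubmodule.lieSpan 𝕜 (FreeLieAlgebra 𝕜 X) rels ≤ (FreeLieAlgebra.lift 𝕜 f).ker :=
        LieSubmodule.lieSpan_le.2 fun y hy => (LieHom.mem_ker).2 (h y hy)
      intro y hy
      exact (LieHom.mem_ker).1 (hle hy))
  map_lie' {x y} := by
    obtain ⟨x, rfl⟩ := mk_surjective x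
    obtain ⟨y, rfl⟩ := mk_surjective y
    rw [← LieHom.map_lie]
    exact LieHom.map_lie (FreeLieAlgebra.lift 𝕜 f) x y

lemma lift_gen (f : X → L) (h : ∀ y ∈ rels, FreeLieAlgebra.lift 𝕜 f y = 0) (x : X) :
    lift f h (gen rels x) = f x :=
  FreeLieAlgebra.lift_of_apply (R := 𝕜) f x

lemma hom_ext {f g : PresentedLieAlgebra 𝕜 rels →ₗ⁅𝕜⁆ L}
    (h : ∀ x, f (gen rels x) = g (gen rels x)) : f = g := by
  have : f.comp (mk rels) = g.comp (mk rels) := FreeLieAlgebra.hom_ext h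
  ext y
  obtain ⟨y, rfl⟩ := mk_surjective y
  exact DFunLike.congr_fun this y

/-- A Lie subalgebra that contains the generators is everything. -/
lemma eq_top_of_gen_mem (S : LieSubalgebra 𝕜 (PresentedLieAlgebra 𝕜 rels))
    (h : ∀ x, gen rels x ∈ S) (y : PresentedLieAlgebra 𝕜 rels) : y ∈ S := by
  obtain ⟨y, rfl⟩ := mk_surjective y
  have : S.incl.comp (FreeLieAlgebra.lift 𝕜 fun x => (⟨gen rels x, h x⟩ : S)) = mk rels := by
    refine FreeLieAlgebra.hom_ext fun x => ?_
    rw [LieHom.comp_apply, FreeLieAlgebra.lift_of_apply]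
    rfl
  rw [← this]
  exact (FreeLieAlgebra.lift 𝕜 (fun x => (⟨gen rels x, h x⟩ : S)) y).2

end PresentedLieAlgebra

section WEUniversal

open LieSeries

variable {𝕜 : Type*} [RCLike 𝕜] {m : ℕ} {L : Type*} [LieRing L] [LieAlgebra 𝕜 L]

/-- The pair `(A, B)` of power series solves the zero-curvature equation, `A` depends on `u^i_0`
only, and `B` does not depend on `u^i_3`. -/
structure IsZCR (r : Fin (m + 1) → 𝕜) (a : Fin m × ℕ → 𝕜) (A B : LieSeries (JetIdx m 4) L) :
    Prop where
  pd_A : ∀ k : Fin 4, k ≠ 0 → ∀ i, pd L (i, k) A = 0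
  pd_B : ∀ i, pd L (i, 3) B = 0
  eq : Dx L a B - Dt L r a A + ⁅A, B⁆ = 0

lemma isZCR_ext {r : Fin (m + 1) → 𝕜} {a : Fin m × ℕ → 𝕜} (ha : a ∈ jetDomain 𝕜 m)
    (A : FormalSeries (JetIdx m 1) L) (B : FormalSeries (JetIdx m 3) L)
    (h : zeroCurvature (landauLifshitz r) a A B = 0) :
    IsZCR r a (ext (jetIncl (Nat.le_add_left 1 3)) A) (ext (jetIncl (Nat.le_succ 3)) B) where
  pd_A k hk i := by
    refine pd_ext_of_notMem (jetIncl_injective _) _ ?_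
    rintro ⟨⟨j, l⟩, h⟩
    obtain rfl : l = 0 := Subsingleton.elim _ _
    exact hk (Prod.ext_iff.1 h).2.symm
  pd_B i := by
    refine pd_ext_of_notMem (jetIncl_injective _) _ ?_
    rintro ⟨⟨j, l⟩, h⟩
    have := congrArg Fin.val (Prod.ext_iff.1 h).2
    simp only [jetIncl, Fin.val_castLE] at this
    have h3 : ((3 : Fin 4) : ℕ) = 3 := rfl
    omega
  eq := by
    rw [← zeroCurvature_eq r a ha]
    exact h

variable (r : Fin (m + 1) → 𝕜) (a : Fin m × ℕ → 𝕜)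

/-- The generating series `A` of the Wahlquist–Estabrook algebra. -/
def weA : LieSeries (JetIdx m 4) (WEAlgebra (landauLifshitz r) a) :=
  ext (jetIncl (Nat.le_add_left 1 3)) fun α => PresentedLieAlgebra.gen _ (Sum.inl α)

/-- The generating series `B` of the Wahlquist–Estabrook algebra. -/
def weB : LieSeries (JetIdx m 4) (WEAlgebra (landauLifshitz r) a) :=
  ext (jetIncl (Nat.le_succ 3)) fun β => PresentedLieAlgebra.gen _ (Sum.inr β)

variable {r a}

/-- The vector fields have scalar coefficients, so a homomorphism applied coefficientwise commutes
with them as well as with the bracket. -/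
lemma zeroCurvature_map {L' : Type*} [LieRing L'] [LieAlgebra 𝕜 L'] (ha : a ∈ jetDomain 𝕜 m)
    (f : L →ₗ⁅𝕜⁆ L') (A : FormalSeries (JetIdx m 1) L) (B : FormalSeries (JetIdx m 3) L) :
    @Eq (LieSeries (JetIdx m 4) L')
      (zeroCurvature (landauLifshitz r) a (fun α => f (A α)) (fun β => f (B β)))
      (map f (zeroCurvature (landauLifshitz r) a A B)) := by
  rw [zeroCurvature_eq r a ha, zeroCurvature_eq r a ha, map_add, map_sub, LieHom.map_lie,
    map_Dx, map_Dt, map_ext _ (jetIncl_injective _), map_ext _ (jetIncl_injective _)]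

/-- The universal solution: the coefficients of its zero-curvature expression are exactly the
classes of the relators. -/
lemma isZCR_we (ha : a ∈ jetDomain 𝕜 m) : IsZCR r a (weA r a) (weB r a) := by
  refine isZCR_ext ha _ _ ?_
  have := zeroCurvature_map (r := r) ha
    (PresentedLieAlgebra.mk (Set.range (weRelator (landauLifshitz r) a)))
    (fun α => FreeLieAlgebra.of 𝕜 (Sum.inl α)) (fun β => FreeLieAlgebra.of 𝕜 (Sum.inr β))
  refine this.trans ?_
  funext γ
  exact PresentedLieAlgebra.mk_eq_zero_of_mem (Set.mem_range_self γ)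

/-- Solutions of the zero-curvature equation correspond to homomorphisms from the
Wahlquist–Estabrook algebra. -/
lemma exists_weHom (ha : a ∈ jetDomain 𝕜 m) {A B : LieSeries (JetIdx m 4) L} (h : IsZCR r a A B) :
    ∃ f : WEAlgebra (landauLifshitz r) a →ₗ⁅𝕜⁆ L, map f (weA r a) = A ∧ map f (weB r a) = B := by
  have hA : ext (jetIncl (Nat.le_add_left 1 3)) (restr (jetIncl (Nat.le_add_left 1 3)) A) = A := by
    refine ext_restr (𝕜 := 𝕜) (jetIncl_injective _) A ?_
    rintro ⟨i, k⟩ hk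
    refine h.pd_A k ?_ i
    rintro rfl
    exact hk ⟨(i, 0), rfl⟩
  have hB : ext (jetIncl (Nat.le_succ 3)) (restr (jetIncl (Nat.le_succ 3)) B) = B := by
    refine ext_restr (𝕜 := 𝕜) (jetIncl_injective _) B ?_
    rintro ⟨i, k⟩ hk
    have : k = 3 := by
      by_contra h3
      have hlt : (k : ℕ) < 3 := by
        have : (k : ℕ) ≠ 3 := fun h' => h3 (Fin.ext h')
        omega
      exact hk ⟨(i, ⟨k, hlt⟩), rfl⟩
    rw [this]
    exact h.pd_B i
  let A' : FormalSeries (JetIdx m 1) L := restr (jetIncl (Nat.le_add_left 1 3)) A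
  let B' : FormalSeries (JetIdx m 3) L := restr (jetIncl (Nat.le_succ 3)) B
  let f' : WEGen m 3 → L := Sum.elim A' B'
  have hrel : ∀ y ∈ Set.range (weRelator (landauLifshitz r) a), FreeLieAlgebra.lift 𝕜 f' y = 0 := by
    rintro _ ⟨γ, rfl⟩
    have h1 := zeroCurvature_map (r := r) ha (FreeLieAlgebra.lift 𝕜 f')
      (fun α => FreeLieAlgebra.of 𝕜 (Sum.inl α)) (fun β => FreeLieAlgebra.of 𝕜 (Sum.inr β))
    simp only [FreeLieAlgebra.lift_of_apply] at h1
    have h2 : zeroCurvature (landauLifshitz r) a (fun α => f' (Sum.inl α))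
        (fun β => f' (Sum.inr β)) = 0 := by
      refine (zeroCurvature_eq r a ha _ _).trans ?_
      change Dx L a (ext _ (restr (jetIncl (Nat.le_succ 3)) B)) -
        Dt L r a (ext _ (restr (jetIncl (Nat.le_add_left 1 3)) A)) +
        ⁅ext _ (restr (jetIncl (Nat.le_add_left 1 3)) A),
          ext _ (restr (jetIncl (Nat.le_succ 3)) B)⁆ = 0
      rw [hA, hB]
      exact h.eq
    exact (congrFun (h2.symm.trans h1) γ).symm
  refine ⟨PresentedLieAlgebra.lift f' hrel, ?_, ?_⟩
  · rw [weA, map_ext _ (jetIncl_injective _)]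
    simp only [PresentedLieAlgebra.lift_gen]
    exact hA
  · rw [weB, map_ext _ (jetIncl_injective _)]
    simp only [PresentedLieAlgebra.lift_gen]
    exact hB

/-- The coefficients of the two generating series are the generators of the algebra. -/
lemma weHom_ext {f g : WEAlgebra (landauLifshitz r) a →ₗ⁅𝕜⁆ L}
    (hA : map f (weA r a) = map g (weA r a)) (hB : map f (weB r a) = map g (weB r a)) : f = g := by
  rw [weA, map_ext _ (jetIncl_injective _), map_ext _ (jetIncl_injective _)] at hA
  rw [weB, map_ext _ (jetIncl_injective _), map_ext _ (jetIncl_injective _)] at hB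
  refine PresentedLieAlgebra.hom_ext ?_
  rintro (α | β)
  · have := congrFun (congrArg (restr (jetIncl (Nat.le_add_left 1 3))) hA) α
    rwa [restr_ext (jetIncl_injective _), restr_ext (jetIncl_injective _)] at this
  · have := congrFun (congrArg (restr (jetIncl (Nat.le_succ 3))) hB) β
    rwa [restr_ext (jetIncl_injective _), restr_ext (jetIncl_injective _)] at this

end WEUniversal

/-! ### The structure of Lie algebras with the relations of `𝔤(n)` -/

/-- The hypothesis $n\ge3$ enters the study of $\mathfrak g(n)$ in this form, as the existence of a
third index. -/
lemma Fin.exists_ne_and_ne {n : ℕ} (hn : 3 ≤ n) (i j : Fin n) : ∃ l, l ≠ i ∧ l ≠ j := by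
  obtain ⟨l, -, hl⟩ := Finset.exists_mem_notMem_of_card_lt_card (s := {i, j}) (t := Finset.univ)
    (by rw [Finset.card_univ, Fintype.card_fin]; exact lt_of_le_of_lt Finset.card_le_two hn)
  simp only [Finset.mem_insert, Finset.mem_singleton, not_or] at hl
  exact ⟨l, hl⟩

section GRelations

variable {𝕜 : Type*} [RCLike 𝕜] {n : ℕ} {L : Type*} [LieRing L] [LieAlgebra 𝕜 L]

/-- The elements `p_1, …, p_n` satisfy the relations of `𝔤(n)`. -/
structure GRel (r : Fin n → 𝕜) (p : Fin n → L) : Prop where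
  distinct : ∀ i j k : Fin n, i ≠ j → j ≠ k → k ≠ i → ⁅p i, ⁅p j, p k⁆⁆ = 0
  double : ∀ i j k : Fin n, i ≠ k → j ≠ k →
    ⁅p i, ⁅p i, p k⁆⁆ + r i • p k = ⁅p j, ⁅p j, p k⁆⁆ + r j • p k

/-- The elements `p_k λ^s`, defined recursively by `p_k λ^{s+1} = [p_i, [p_i, p_k λ^s]] + r_i p_k λ^s`
for `i = o k ≠ k`. -/
def gTower (o : Fin n → Fin n) (r : Fin n → 𝕜) (p : Fin n → L) : ℕ → Fin n → L
  | 0 => p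
  | s + 1 => fun k => ⁅p (o k), ⁅p (o k), gTower o r p s k⁆⁆ + r (o k) • gTower o r p s k

/-- The multiplication table of the elements `x s k = p_k λ^s` up to total degree `N`. -/
structure TowerRel (r : Fin n → 𝕜) (x : ℕ → Fin n → L) (N : ℕ) : Prop where
  lie_ne : ∀ a b, a + b ≤ N → ∀ i j, i ≠ j → ⁅x a i, x b j⁆ = ⁅x 0 i, x (a + b) j⁆
  lie_same : ∀ a b, a + b ≤ N → ∀ i, ⁅x a i, x b i⁆ = 0
  lie_distinct : ∀ a b, a + b ≤ N → ∀ i j k, i ≠ j → j ≠ k → k ≠ i → ⁅x a i, ⁅x 0 j, x b k⁆⁆ = 0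
  lie_lie : ∀ a b, a + b ≤ N → ∀ i k, i ≠ k →
    ⁅x a i, ⁅x 0 i, x b k⁆⁆ = x (a + b + 1) k - r i • x (a + b) k

namespace TowerRel

variable {r : Fin n → 𝕜} {x : ℕ → Fin n → L} {N : ℕ}

lemma skew (h : TowerRel r x N) {s : ℕ} (hs : s ≤ N) {i j : Fin n} (hij : i ≠ j) :
    ⁅x s i, x 0 j⁆ = ⁅x 0 i, x s j⁆ := by
  simpa using h.lie_ne s 0 (by omega) i j hij

lemma skew' (h : TowerRel r x N) {s : ℕ} (hs : s ≤ N) {i j : Fin n} (hij : i ≠ j) :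
    ⁅x 0 j, x s i⁆ = -⁅x 0 i, x s j⁆ := by
  rw [← h.skew hs hij, lie_skew]

lemma succ_eq (h : TowerRel r x N) {s : ℕ} (hs : s ≤ N) {l k : Fin n} (hlk : l ≠ k) :
    x (s + 1) k = ⁅x 0 l, ⁅x 0 l, x s k⁆⁆ + r l • x s k := by
  rw [h.lie_lie 0 s (by omega) l k hlk, zero_add, sub_add_cancel]

/-- Write $x_{N+1,j}$ as $(\operatorname{ad} x_{0,l})^2x_{N,j}+r_lx_{N,j}$ with a third index $l$.
Because brackets with three distinct indices vanish, the Jacobi identity carries both factors with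
index $l$ over to index $i$. -/
lemma skew_succ (h : TowerRel r x N) {i j l : Fin n} (hij : i ≠ j) (hil : l ≠ i) (hjl : l ≠ j) :
    ⁅x (N + 1) i, x 0 j⁆ = ⁅x 0 i, x (N + 1) j⁆ := by
  have h1 : ⁅x 0 i, ⁅x 0 l, ⁅x 0 l, x N j⁆⁆⁆ = ⁅x (N + 1) i - r l • x N i, x 0 j⁆ := by
    rw [leibniz_lie, h.lie_distinct 0 N (by omega) i l j hil.symm hjl hij.symm, lie_zero, add_zero,
      ← h.skew le_rfl hjl, leibniz_lie, ← lie_skew ⁅x 0 i, x 0 l⁆ (x 0 j),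
      h.lie_distinct 0 0 (by omega) j i l hij.symm hil.symm hjl, neg_zero, lie_zero, add_zero,
      ← lie_skew ⁅x 0 i, x 0 l⁆ (x N l), ← lie_skew (x 0 i) (x 0 l), lie_neg, neg_neg,
      h.lie_lie N 0 (by omega) l i hil, add_zero]
  rw [h.succ_eq le_rfl hjl, lie_add, h1, lie_smul, sub_lie, smul_lie, h.skew le_rfl hij,
    sub_add_cancel]

lemma lie_ne_succ (h : TowerRel r x N) (hn : ∀ i j : Fin n, ∃ l, l ≠ i ∧ l ≠ j) (a b : ℕ)
    (hab : a + b = N + 1) (i j : Fin n) (hij : i ≠ j) : ⁅x a i, x b j⁆ = ⁅x 0 i, x (N + 1) j⁆ := by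
  obtain _ | b := b
  · obtain rfl : a = N + 1 := hab
    obtain ⟨l, hli, hlj⟩ := hn i j
    exact h.skew_succ hij hli hlj
  -- For `b > 0` no third index is needed: expand the second factor by `i` itself and use that `x a
  -- i` commutes with `x 0 i`.
  · obtain rfl : N = a + b := by omega
    rw [h.succ_eq (Nat.le_add_left b a) hij, lie_add, leibniz_lie,
      h.lie_same a 0 (by omega), zero_lie, zero_add,
      h.lie_lie a b le_rfl i j hij, lie_smul, h.lie_ne a b le_rfl i j hij, lie_sub, lie_smul,
      sub_add_cancel]

/-- The expansion of the second factor by `l` isolates a double bracket that is antisymmetric in `a`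
and `b`, so it drops out when the two ways of raising the total degree are compared. -/
lemma same_step (h : TowerRel r x N) (a b : ℕ) (hab : a + b = N) (i l : Fin n) (hil : i ≠ l) :
    ⁅x a i, x (b + 1) i⁆ = -⁅⁅x 0 i, x a l⁆, ⁅x 0 i, x b l⁆⁆ - ⁅x 0 l, x (N + 1) l⁆ := by
  rw [h.succ_eq (by omega : b ≤ N) hil.symm, lie_add, lie_smul, h.lie_same a b hab.le, smul_zero,
    add_zero, leibniz_lie, h.skew (by omega) hil, h.skew' (by omega) hil, lie_neg, lie_neg, lie_neg,
    h.lie_lie a b hab.le i l hil, lie_sub, lie_smul, hab,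
    h.lie_same 0 N (by omega), smul_zero, sub_zero]
  abel

lemma same_recursion (h : TowerRel r x N) (a b : ℕ) (hab : a + b = N) (i l : Fin n) (hil : i ≠ l) :
    ⁅x (a + 1) i, x b i⁆ = ⁅x a i, x (b + 1) i⁆ + (2 : 𝕜) • ⁅x 0 l, x (N + 1) l⁆ := by
  have h1 := h.same_step a b hab i l hil
  have h2 := h.same_step b a (by omega) i l hil
  rw [← lie_skew ⁅x 0 i, x b l⁆, ← lie_skew (x b i)] at h2
  rw [h1, ← neg_inj, h2]
  module

/-- Put $c_i=[x_{0,i},x_{N+1,i}]$. The recursion gives $[x_{a,i},x_{b,i}]=c_i+2a\,c_l$; for $a=N+1$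
antisymmetry yields $c_i=-(N+1)c_l$ for all $i\ne l$. Three distinct indices then give $(N+2)c_i=0$.
-/
lemma lie_same_succ (h : TowerRel r x N) (hn : ∀ i j : Fin n, ∃ l, l ≠ i ∧ l ≠ j) (a b : ℕ)
    (hab : a + b = N + 1) (i : Fin n) : ⁅x a i, x b i⁆ = 0 := by
  have key (i l : Fin n) (hil : i ≠ l) : ∀ a b : ℕ, a + b = N + 1 →
      ⁅x a i, x b i⁆ = ⁅x 0 i, x (N + 1) i⁆ + (2 * a : 𝕜) • ⁅x 0 l, x (N + 1) l⁆ := by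
    intro a
    induction a with
    | zero =>
      intro b hb
      rw [zero_add] at hb
      rw [hb]
      simp
    | succ a ih =>
      intro b hb
      rw [h.same_recursion a b (by omega) i l hil, ih (b + 1) (by omega)]
      push_cast
      module
  have hrec (i l : Fin n) (hil : i ≠ l) :
      ⁅x 0 i, x (N + 1) i⁆ = (-(N + 1) : 𝕜) • ⁅x 0 l, x (N + 1) l⁆ := by
    have h1 := key i l hil (N + 1) 0 rfl
    rw [← lie_skew] at h1
    have h2 : (2 : 𝕜) • (⁅x 0 i, x (N + 1) i⁆ - (-(N + 1) : 𝕜) • ⁅x 0 l, x (N + 1) l⁆) = 0 := by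
      have h3 : (2 : 𝕜) • (⁅x 0 i, x (N + 1) i⁆ - (-(N + 1) : 𝕜) • ⁅x 0 l, x (N + 1) l⁆) =
        (⁅x 0 i, x (N + 1) i⁆ + (2 * (N + 1 : ℕ) : 𝕜) • ⁅x 0 l, x (N + 1) l⁆) -
          -⁅x 0 i, x (N + 1) i⁆ := by
        push_cast
        module
      rw [h3, ← h1, sub_self]
    exact sub_eq_zero.1 ((smul_eq_zero.1 h2).resolve_left two_ne_zero)
  have hzero (i : Fin n) : ⁅x 0 i, x (N + 1) i⁆ = 0 := by
    obtain ⟨l, hli, -⟩ := hn i i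
    obtain ⟨k, hki, hkl⟩ := hn i l
    have h1 := hrec i l hli.symm
    have h2 := hrec i k hki.symm
    have h3 := hrec k l hkl
    have h4 := hrec l i hli
    rw [h3, ← h1] at h2
    have h5 : ((N : 𝕜) + 2) • ⁅x 0 i, x (N + 1) i⁆ = 0 := by
      have : ((N : 𝕜) + 2) • ⁅x 0 i, x (N + 1) i⁆ =
        ⁅x 0 i, x (N + 1) i⁆ - (-(N + 1) : 𝕜) • ⁅x 0 i, x (N + 1) i⁆ := by module
      rw [this, ← h2, sub_self]
    refine (smul_eq_zero.1 h5).resolve_left ?_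
    exact_mod_cast Nat.succ_ne_zero (N + 1)
  obtain ⟨l, hli, -⟩ := hn i i
  rw [key i l hli.symm a b hab, hzero, hzero, smul_zero, add_zero]

/-- The Jacobi identity for `x a i`, `x b j`, `x c k`, with the whole degree of each inner bracket
moved to its second entry. -/
lemma distinct_jacobi (h : TowerRel r x N) (hn : ∀ i j : Fin n, ∃ l, l ≠ i ∧ l ≠ j) (a b c : ℕ)
    (habc : a + b + c = N + 1) (i j k : Fin n) (hij : i ≠ j) (hjk : j ≠ k) (hki : k ≠ i) :
    ⁅x a i, ⁅x 0 j, x (b + c) k⁆⁆ + ⁅x b j, ⁅x 0 k, x (c + a) i⁆⁆ +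
      ⁅x c k, ⁅x 0 i, x (a + b) j⁆⁆ = 0 := by
  have hl (b c : ℕ) (hbc : b + c ≤ N + 1) (j k : Fin n) (hjk : j ≠ k) :
      ⁅x 0 j, x (b + c) k⁆ = ⁅x b j, x c k⁆ := by
    rcases Nat.lt_or_ge N (b + c) with h' | h'
    · rw [h.lie_ne_succ hn b c (by omega) j k hjk, show b + c = N + 1 by omega]
    · rw [h.lie_ne b c h' j k hjk]
  rw [hl b c (by omega) j k hjk, hl c a (by omega) k i hki, hl a b (by omega) i j hij]
  exact lie_jacobi _ _ _

/-- The element `x (a + 1) i` is expanded by `j`, the middle index. Together with the Jacobi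
identity this gives a recursion on the position of the degree. -/
lemma distinct_step (h : TowerRel r x N) (hn : ∀ i j : Fin n, ∃ l, l ≠ i ∧ l ≠ j) (a b : ℕ)
    (hab : a + b = N) (i j k : Fin n) (hij : i ≠ j) (hjk : j ≠ k) (hki : k ≠ i) :
    ⁅x (a + 1) i, ⁅x 0 j, x b k⁆⁆ = ⁅x 0 j, ⁅x 0 k, x (N + 1) i⁆⁆ -
      ⁅x (b + 1) k, ⁅x 0 i, x a j⁆⁆ := by
  have hq : ⁅⁅x 0 j, x a i⁆, x b k⁆ = 0 := by
    rw [← lie_skew, h.lie_distinct b a (by omega) k j i hjk.symm hij.symm hki.symm, neg_zero]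
  have h1 : ⁅⁅x 0 j, x a i⁆, ⁅x 0 j, x b k⁆⁆ = ⁅x 0 k, x (N + 1) i⁆ + r j • ⁅x 0 i, x N k⁆ := by
    rw [leibniz_lie, hq, lie_zero, add_zero, ← lie_skew ⁅x 0 j, x a i⁆ (x 0 j),
      h.lie_lie 0 a (by omega) j i hij.symm, neg_lie, sub_lie, smul_lie, zero_add,
      h.lie_ne_succ hn (a + 1) b (by omega) i k hki.symm, h.lie_ne a b hab.le i k hki.symm, hab,
      ← h.lie_ne_succ hn (N + 1) 0 rfl i k hki.symm, ← lie_skew (x (N + 1) i)]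
    abel
  have h2 : ⁅⁅x 0 j, x a i⁆, ⁅x 0 j, ⁅x 0 j, x b k⁆⁆⁆ = ⁅x (b + 1) k, ⁅x 0 i, x a j⁆⁆ := by
    rw [h.lie_lie 0 b (by omega) j k hjk, lie_sub, lie_smul, zero_add, hq, smul_zero, sub_zero,
      ← lie_skew, h.skew' (by omega) hij, lie_neg, neg_neg]
  rw [h.succ_eq (by omega : a ≤ N) hij.symm, add_lie, smul_lie,
    h.lie_distinct a b hab.le i j k hij hjk hki, smul_zero, add_zero, _root_.lie_lie, h1, h2, lie_add,
    lie_smul, h.lie_distinct 0 N (by omega) j i k hij.symm hki.symm hjk.symm, smul_zero, add_zero]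

lemma lie_distinct_succ (h : TowerRel r x N) (hn : ∀ i j : Fin n, ∃ l, l ≠ i ∧ l ≠ j) (a b : ℕ)
    (hab : a + b = N + 1) (i j k : Fin n) (hij : i ≠ j) (hjk : j ≠ k) (hki : k ≠ i) :
    ⁅x a i, ⁅x 0 j, x b k⁆⁆ = 0 := by
  have key (i j k : Fin n) (hij : i ≠ j) (hjk : j ≠ k) (hki : k ≠ i) : ∀ b a : ℕ, b + a = N + 1 →
      ⁅x b k, ⁅x 0 i, x a j⁆⁆ =
        ⁅x 0 k, ⁅x 0 i, x (N + 1) j⁆⁆ + (2 * b : 𝕜) • ⁅x 0 j, ⁅x 0 k, x (N + 1) i⁆⁆ := by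
    intro b
    induction b with
    | zero =>
      intro a ha
      rw [zero_add] at ha
      rw [ha]
      simp
    | succ b ih =>
      intro a ha
      have h1 := h.distinct_step hn a b (by omega) i j k hij hjk hki
      have h2 := h.distinct_jacobi hn (a + 1) 0 b (by omega) i j k hij hjk hki
      rw [zero_add, add_zero, h1, show b + (a + 1) = N + 1 by omega, ih (a + 1) (by omega)] at h2
      rw [← sub_eq_zero, ← neg_eq_zero, ← h2]
      push_cast
      module
  -- The three cyclic permutations of $[x_{0,i},[x_{0,j},x_{N+1,k}]]$ satisfy a circulant linear
  -- system. Differences of its equations carry the factor $2N+2$ and show that the three are equal;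
  -- then each is annihilated by $2N+5$.
  have hsum (i j k : Fin n) (hij : i ≠ j) (hjk : j ≠ k) (hki : k ≠ i) :
      ⁅x 0 i, ⁅x 0 j, x (N + 1) k⁆⁆ + ⁅x 0 k, ⁅x 0 i, x (N + 1) j⁆⁆ +
        (2 * N + 3 : 𝕜) • ⁅x 0 j, ⁅x 0 k, x (N + 1) i⁆⁆ = 0 := by
    have h2 := h.distinct_jacobi hn 0 0 (N + 1) (by omega) i j k hij hjk hki
    rw [zero_add, add_zero, add_zero, key i j k hij hjk hki (N + 1) 0 rfl] at h2
    rw [← h2]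
    push_cast
    module
  have hN : (2 * N + 2 : 𝕜) ≠ 0 := by exact_mod_cast (by omega : 2 * N + 2 ≠ 0)
  have hzero (i j k : Fin n) (hij : i ≠ j) (hjk : j ≠ k) (hki : k ≠ i) :
      ⁅x 0 i, ⁅x 0 j, x (N + 1) k⁆⁆ = 0 := by
    have h1 := hsum i j k hij hjk hki
    have h2 := hsum j k i hjk hki hij
    have h3 := hsum k i j hki hij hjk
    have h4 : (2 * N + 2 : 𝕜) • (⁅x 0 i, ⁅x 0 j, x (N + 1) k⁆⁆ -
        ⁅x 0 j, ⁅x 0 k, x (N + 1) i⁆⁆) = 0 := by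
      rw [← sub_eq_zero.2 (h3.trans h1.symm)]
      module
    have h5 : (2 * N + 2 : 𝕜) • (⁅x 0 i, ⁅x 0 j, x (N + 1) k⁆⁆ -
        ⁅x 0 k, ⁅x 0 i, x (N + 1) j⁆⁆) = 0 := by
      rw [← sub_eq_zero.2 (h3.trans h2.symm)]
      module
    have h4' := sub_eq_zero.1 ((smul_eq_zero.1 h4).resolve_left hN)
    have h5' := sub_eq_zero.1 ((smul_eq_zero.1 h5).resolve_left hN)
    rw [← h4', ← h5'] at h1
    have h6 : (2 * N + 5 : 𝕜) • ⁅x 0 i, ⁅x 0 j, x (N + 1) k⁆⁆ = 0 := by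
      rw [← h1]
      module
    refine (smul_eq_zero.1 h6).resolve_left ?_
    exact_mod_cast (by omega : 2 * N + 5 ≠ 0)
  rw [key j k i hjk hki hij a b hab, hzero i j k hij hjk hki, hzero k i j hki hij hjk, smul_zero,
    add_zero]

lemma lie_lie_succ_eq (h : TowerRel r x N) (hn : ∀ i j : Fin n, ∃ l, l ≠ i ∧ l ≠ j) (a b : ℕ)
    (hab : a + b = N + 1) (i k : Fin n) (hik : i ≠ k) :
    ⁅x a i, ⁅x 0 i, x b k⁆⁆ = ⁅x 0 i, ⁅x 0 i, x (N + 1) k⁆⁆ := by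
  have h0 : ⁅x a i, x 0 i⁆ = 0 := by
    rcases Nat.lt_or_ge N a with h' | h'
    · exact h.lie_same_succ hn a 0 (by omega) i
    · exact h.lie_same a 0 h' i
  rw [leibniz_lie, h0, zero_lie, zero_add, h.lie_ne_succ hn a b hab i k hik]

/-- Apply $(\operatorname{ad}x_{0,i})^2$ to $(\operatorname{ad}x_{0,j})^2x_{N,k}$. Since
$[x_{0,i},[x_{0,j},x_{N,k}]]=0$, both derivations act on the outer $x_{0,j}$, where they produce
$x_{1,j}-r_ix_{0,j}$; the total degree is then moved back to the entry with index $k$. -/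
lemma double_succ (h : TowerRel r x N) (hn : ∀ i j : Fin n, ∃ l, l ≠ i ∧ l ≠ j)
    (i j k : Fin n) (hij : i ≠ j) (hik : i ≠ k) (hjk : j ≠ k) :
    ⁅x 0 i, ⁅x 0 i, x (N + 1) k⁆⁆ + r i • x (N + 1) k =
      ⁅x 0 j, ⁅x 0 j, x (N + 1) k⁆⁆ + r j • x (N + 1) k := by
  have h0 := h.lie_distinct 0 N (by omega) i j k hij hjk hik.symm
  have h1 := h.lie_lie 0 N (by omega) j k hjk
  have h2 := h.lie_lie 0 N (by omega) i k hik
  have h3 := h.lie_lie 0 0 (by omega) i j hij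
  rw [zero_add] at h1 h2 h3
  have h4 := h.lie_lie_succ_eq hn 1 N (by omega) j k hjk
  have h5 : ⁅x 0 i, ⁅x 0 i, ⁅x 0 j, ⁅x 0 j, x N k⁆⁆⁆⁆ =
      ⁅x 0 j, ⁅x 0 j, x (N + 1) k⁆⁆ - r i • (x (N + 1) k - r j • x N k) := by
    rw [leibniz_lie (x 0 i) (x 0 j), h0, lie_zero, add_zero, leibniz_lie, h0, lie_zero, add_zero, h3,
      sub_lie, smul_lie, h1, h4]
  rw [show ⁅x 0 i, ⁅x 0 i, x (N + 1) k⁆⁆ = ⁅x 0 j, ⁅x 0 j, x (N + 1) k⁆⁆ -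
      r i • (x (N + 1) k - r j • x N k) + r j • (x (N + 1) k - r i • x N k) by
    rw [h.succ_eq le_rfl hjk, lie_add, lie_add, h5, lie_smul, lie_smul, h2,
      ← h.succ_eq le_rfl hjk]]
  module

end TowerRel

/-- In degree `N` the field `lie_lie` already reaches `x (N + 1)`, and this is what allows the
passage to degree `N + 1`. The defining relations of $\mathfrak g(n)$ are the case `N = 0`; in
particular the tower does not depend on the choice of `o`. -/
lemma GRel.towerRel {r : Fin n → 𝕜} {p : Fin n → L} (h : GRel r p) {o : Fin n → Fin n}
    (ho : ∀ k, o k ≠ k) (hn : ∀ i j : Fin n, ∃ l, l ≠ i ∧ l ≠ j) (N : ℕ) :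
    TowerRel r (gTower o r p) N := by
  have hsucc (s : ℕ) (k : Fin n) : gTower o r p (s + 1) k =
    ⁅gTower o r p 0 (o k), ⁅gTower o r p 0 (o k), gTower o r p s k⁆⁆ +
      r (o k) • gTower o r p s k := rfl
  induction N with
  | zero =>
    refine ⟨?_, ?_, ?_, ?_⟩
    · intro a b hab i j _
      obtain ⟨rfl, rfl⟩ : a = 0 ∧ b = 0 := by omega
      rfl
    · intro a b hab i
      obtain ⟨rfl, rfl⟩ : a = 0 ∧ b = 0 := by omega
      exact lie_self _
    · intro a b hab i j k
      obtain ⟨rfl, rfl⟩ : a = 0 ∧ b = 0 := by omega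
      exact h.distinct i j k
    · intro a b hab i k hik
      obtain ⟨rfl, rfl⟩ : a = 0 ∧ b = 0 := by omega
      rw [add_zero, hsucc, eq_sub_iff_add_eq]
      exact h.double i (o k) k hik (ho k)
  | succ N ih =>
    have hsplit (a b : ℕ) (hab : a + b ≤ N + 1) : a + b ≤ N ∨ a + b = N + 1 := by omega
    refine ⟨?_, ?_, ?_, ?_⟩
    · intro a b hab i j hij
      rcases hsplit a b hab with h' | h'
      · exact ih.lie_ne a b h' i j hij
      · rw [ih.lie_ne_succ hn a b h' i j hij, h']
    · intro a b hab i
      rcases hsplit a b hab with h' | h'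
      · exact ih.lie_same a b h' i
      · exact ih.lie_same_succ hn a b h' i
    · intro a b hab i j k hij hjk hki
      rcases hsplit a b hab with h' | h'
      · exact ih.lie_distinct a b h' i j k hij hjk hki
      · exact ih.lie_distinct_succ hn a b h' i j k hij hjk hki
    · intro a b hab i k hik
      rcases hsplit a b hab with h' | h'
      · exact ih.lie_lie a b h' i k hik
      · rw [ih.lie_lie_succ_eq hn a b h' i k hik, h', hsucc (N + 1), eq_sub_iff_add_eq]
        by_cases hi : i = o k
        · rw [hi]
        · exact ih.double_succ hn i (o k) k hi hik (ho k)

end GRelations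

/-! ### The isomorphism between `𝔤(n)` and `L(n)` -/

section GBasis

variable {𝕜 : Type*} [RCLike 𝕜] {n : ℕ} {L : Type*} [LieRing L] [LieAlgebra 𝕜 L]

/-- The relabelling `g` allows the same argument to serve both for $\mathfrak g(n)$ and for the
generators $p_1,\dots,p_n$ inside the larger presentation. -/
lemma lift_gRelators {X : Type*} (r : Fin n → 𝕜) (g : Fin n → X) (f : X → L)
    (h : GRel r (f ∘ g)) :
    ∀ y ∈ gRelators r (fun l => FreeLieAlgebra.of 𝕜 (g l)), FreeLieAlgebra.lift 𝕜 f y = 0 := by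
  rintro x (⟨i, j, k, hij, hjk, hki, rfl⟩ | ⟨i, j, k, hik, hjk, rfl⟩)
  · simp only [LieHom.map_lie, FreeLieAlgebra.lift_of_apply]
    exact h.distinct i j k hij hjk hki
  · simp only [LieHom.map_lie, map_sub, map_smul, FreeLieAlgebra.lift_of_apply]
    have := h.double i j k hik hjk
    simp only [Function.comp_apply] at this
    rw [← sub_eq_zero] at this
    rw [← this]
    module

/-- The homomorphism from `𝔤(n)` determined by elements that satisfy its relations. -/
def gAlgebra.lift (r : Fin n → 𝕜) (p : Fin n → L) (h : GRel r p) : gAlgebra r →ₗ⁅𝕜⁆ L :=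
  PresentedLieAlgebra.lift p (lift_gRelators r id p h)

lemma gAlgebra.lift_p (r : Fin n → 𝕜) (p : Fin n → L) (h : GRel r p) (l : Fin n) :
    gAlgebra.lift r p h (gAlgebra.p r l) = p l :=
  PresentedLieAlgebra.lift_gen _ _ _

lemma gRel_of_presented {X : Type*} {rels : Set (FreeLieAlgebra 𝕜 X)} (r : Fin n → 𝕜)
    (g : Fin n → X) (h : gRelators r (fun l => FreeLieAlgebra.of 𝕜 (g l)) ⊆ rels) :
    GRel r (fun l => PresentedLieAlgebra.gen rels (g l)) where
  distinct i j k hij hjk hki := by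
    simp only [← PresentedLieAlgebra.mk_of, ← LieHom.map_lie]
    exact PresentedLieAlgebra.mk_eq_zero_of_mem (h (Or.inl ⟨i, j, k, hij, hjk, hki, rfl⟩))
  double i j k hik hjk := by
    have := PresentedLieAlgebra.mk_eq_zero_of_mem (h (Or.inr ⟨i, j, k, hik, hjk, rfl⟩))
    simp only [← PresentedLieAlgebra.mk_of, ← LieHom.map_lie]
    simp only [map_sub, map_smul] at this
    rw [← sub_eq_zero, ← this]
    module

lemma gAlgebra.gRel (r : Fin n → 𝕜) : GRel r (gAlgebra.p r) :=
  gRel_of_presented r id subset_rfl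

/-- The multiples `p_k P(λ)` of the generators, for polynomials `P`. -/
def towerMap (x : ℕ → Fin n → L) (k : Fin n) : Polynomial 𝕜 →ₗ[𝕜] L :=
  Polynomial.lsum fun s => LinearMap.toSpanSingleton 𝕜 L (x s k)

lemma towerMap_monomial (x : ℕ → Fin n → L) (k : Fin n) (s : ℕ) (t : 𝕜) :
    towerMap x k (Polynomial.monomial s t) = t • x s k := by
  rw [towerMap, Polynomial.lsum_apply, Polynomial.sum_monomial_index _ _ (by simp)]
  simp

/-- The linear map that sends polynomials `P_k`, `Q_{ij}` to
`∑ p_k P_k(λ) + ∑ [p_i, p_j Q_{ij}(λ)]`. -/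
def towerSum (x : ℕ → Fin n → L) :
    ((Fin n → Polynomial 𝕜) × (Fin n → Fin n → Polynomial 𝕜)) →ₗ[𝕜] L where
  toFun P := ∑ k, towerMap x k (P.1 k) + ∑ i, ∑ j, ⁅x 0 i, towerMap x j (P.2 i j)⁆
  map_add' P Q := by
    simp only [Prod.fst_add, Prod.snd_add, Pi.add_apply, map_add, lie_add, Finset.sum_add_distrib]
    abel
  map_smul' t P := by
    simp only [Prod.smul_fst, Prod.smul_snd, Pi.smul_apply, map_smul, lie_smul, RingHom.id_apply,
      smul_add, Finset.smul_sum]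

lemma towerSum_single_fst (x : ℕ → Fin n → L) (k : Fin n) (P : Polynomial 𝕜) :
    towerSum x (Pi.single k P, 0) = towerMap x k P := by
  change ∑ k', towerMap x k' ((Pi.single k P : Fin n → Polynomial 𝕜) k') +
    ∑ i, ∑ j, ⁅x 0 i, towerMap x j (0 : Polynomial 𝕜)⁆ = _
  rw [Finset.sum_eq_single k]
  · simp
  · intro k' _ h
    simp [h]
  · simp

lemma towerSum_single_snd (x : ℕ → Fin n → L) (i j : Fin n) (P : Polynomial 𝕜) :
    towerSum x (0, Pi.single i (Pi.single j P)) = ⁅x 0 i, towerMap x j P⁆ := by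
  change ∑ k', towerMap x k' (0 : Polynomial 𝕜) + ∑ i', ∑ j', ⁅x 0 i', towerMap x j'
    ((Pi.single i (Pi.single j P) : Fin n → Fin n → Polynomial 𝕜) i' j')⁆ = _
  simp only [map_zero, Finset.sum_const_zero, zero_add]
  rw [Finset.sum_eq_single i (fun i' _ h => by simp [h]) (by simp),
    Finset.sum_eq_single j (fun j' _ h => by simp [h]) (by simp)]
  simp

lemma lie_towerMap_skew {r : Fin n → 𝕜} {x : ℕ → Fin n → L} (hx : ∀ N, TowerRel r x N)
    (i j : Fin n) (P : Polynomial 𝕜) : ⁅x 0 i, towerMap x j P⁆ = -⁅x 0 j, towerMap x i P⁆ := by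
  induction P using Polynomial.induction_on' with
  | add P Q hP hQ => rw [map_add, lie_add, hP, hQ, map_add, lie_add, neg_add]
  | monomial s t =>
    rw [towerMap_monomial, towerMap_monomial, lie_smul, lie_smul, ← smul_neg]
    by_cases h : i = j
    · subst h
      rw [(hx s).lie_same 0 s (by omega), neg_zero]
    · rw [(hx s).skew' le_rfl h, neg_neg]

/-- A double bracket $[p_l,[p_i,p_j\lambda^s]]$ is again a combination of $p_k\lambda^{s'}$ by the
multiplication table. Thus the span of the $p_k\lambda^s$ and $[p_i,p_j\lambda^s]$ is stable under
the generators. -/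
lemma lie_range_towerSum {r : Fin n → 𝕜} {x : ℕ → Fin n → L} (hx : ∀ N, TowerRel r x N)
    (l : Fin n) (y : L) (hy : y ∈ LinearMap.range (towerSum (𝕜 := 𝕜) x)) :
    ⁅x 0 l, y⁆ ∈ LinearMap.range (towerSum (𝕜 := 𝕜) x) := by
  have hx1 (s : ℕ) (k : Fin n) : x s k ∈ LinearMap.range (towerSum (𝕜 := 𝕜) x) :=
    ⟨_, by rw [towerSum_single_fst x k (Polynomial.monomial s 1), towerMap_monomial, one_smul]⟩
  have hx2 (k : Fin n) (P : Polynomial 𝕜) :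
      ⁅x 0 l, towerMap x k P⁆ ∈ LinearMap.range (towerSum (𝕜 := 𝕜) x) :=
    ⟨_, towerSum_single_snd x l k P⟩
  have hx3 (i j : Fin n) (P : Polynomial 𝕜) :
      ⁅x 0 l, ⁅x 0 i, towerMap x j P⁆⁆ ∈ LinearMap.range (towerSum (𝕜 := 𝕜) x) := by
    induction P using Polynomial.induction_on' with
    | add P Q hP hQ => rw [map_add, lie_add, lie_add]; exact add_mem hP hQ
    | monomial s t =>
      rw [towerMap_monomial, lie_smul, lie_smul]
      refine Submodule.smul_mem _ _ ?_
      by_cases hij : i = j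
      · subst hij
        rw [(hx s).lie_same 0 s (by omega), lie_zero]
        exact zero_mem _
      by_cases hli : l = i
      · subst hli
        rw [(hx s).lie_lie 0 s (by omega) l j hij]
        exact sub_mem (hx1 _ _) (Submodule.smul_mem _ _ (hx1 _ _))
      by_cases hlj : l = j
      · subst hlj
        rw [(hx s).skew' le_rfl hli, lie_neg, (hx s).lie_lie 0 s (by omega) l i hli]
        exact neg_mem (sub_mem (hx1 _ _) (Submodule.smul_mem _ _ (hx1 _ _)))
      · rw [(hx s).lie_distinct 0 s (by omega) l i j hli hij (Ne.symm hlj)]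
        exact zero_mem _
  obtain ⟨⟨P, Q⟩, rfl⟩ := hy
  change ⁅x 0 l, ∑ k, towerMap x k (P k) + ∑ i, ∑ j, ⁅x 0 i, towerMap x j (Q i j)⁆⁆ ∈ _
  rw [lie_add, lie_sum, lie_sum]
  refine add_mem (sum_mem fun k _ => hx2 k _) (sum_mem fun i _ => ?_)
  rw [lie_sum]
  exact sum_mem fun j _ => hx3 i j _

/-- A subspace that contains the generators and is stable under brackets with them is everything. -/
lemma PresentedLieAlgebra.eq_top_of_lie_gen_mem {X : Type*} {rels : Set (FreeLieAlgebra 𝕜 X)}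
    (V : Submodule 𝕜 (PresentedLieAlgebra 𝕜 rels)) (h : ∀ x, gen rels x ∈ V)
    (hlie : ∀ x, ∀ v ∈ V, ⁅gen rels x, v⁆ ∈ V) (y : PresentedLieAlgebra 𝕜 rels) : y ∈ V := by
  -- The elements whose adjoint action preserves `V` form a subalgebra that contains the generators.
  -- Hence it is everything, and `V` itself is a subalgebra.
  let S : LieSubalgebra 𝕜 (PresentedLieAlgebra 𝕜 rels) :=
    { carrier := {z | ∀ v ∈ V, ⁅z, v⁆ ∈ V}
      add_mem' := fun hx hy v hv => by
        rw [add_lie]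
        exact add_mem (hx v hv) (hy v hv)
      zero_mem' := fun v _ => by
        rw [zero_lie]
        exact zero_mem _
      smul_mem' := fun t x hx v hv => by
        rw [smul_lie]
        exact V.smul_mem _ (hx v hv)
      lie_mem' := fun {x y} hx hy v hv => by
        rw [lie_lie]
        exact sub_mem (hx _ (hy v hv)) (hy _ (hx v hv)) }
  have hS (z : PresentedLieAlgebra 𝕜 rels) : z ∈ S := eq_top_of_gen_mem S hlie z
  let T : LieSubalgebra 𝕜 (PresentedLieAlgebra 𝕜 rels) :=
    { V with lie_mem' := fun {x y} _ hy => hS x y hy }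
  exact eq_top_of_gen_mem T h y

end GBasis

/-! ### Injectivity of the map from $\mathfrak g(n)$ to matrix-valued functions on the curve. -/

section CurveAlgebra

variable {𝕜 : Type*} [RCLike 𝕜] {n : ℕ}

/-- The coordinate function `λ_i`. -/
def CurveRing.coord (r : Fin n → 𝕜) (i : Fin n) : CurveRing r :=
  Ideal.Quotient.mk _ (MvPolynomial.X i)

/-- The function $\lambda=\lambda_i^2+r_i$ on the curve does not depend on $i$; multiplication by it
corresponds to a step in the tower. -/
lemma CurveRing.coord_sq (r : Fin n → 𝕜) (i j : Fin n) :
    coord r i ^ 2 + algebraMap 𝕜 _ (r i) = coord r j ^ 2 + algebraMap 𝕜 _ (r j) := by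
  rw [← sub_eq_zero]
  have h : (MvPolynomial.X i ^ 2 - MvPolynomial.X j ^ 2 + MvPolynomial.C (r i - r j) :
      MvPolynomial (Fin n) 𝕜) ∈ Ideal.span (Set.range fun ij : Fin n × Fin n =>
    (MvPolynomial.X ij.1 ^ 2 - MvPolynomial.X ij.2 ^ 2 + MvPolynomial.C (r ij.1 - r ij.2) :
      MvPolynomial (Fin n) 𝕜)) := Ideal.subset_span ⟨(i, j), rfl⟩
  rw [← Ideal.Quotient.eq_zero_iff_mem] at h
  rw [← h, map_add, map_sub, map_pow, map_pow, map_sub, map_sub]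
  change coord r i ^ 2 + algebraMap 𝕜 _ (r i) - (coord r j ^ 2 + algebraMap 𝕜 _ (r j)) =
    coord r i ^ 2 - coord r j ^ 2 + (algebraMap 𝕜 _ (r i) - algebraMap 𝕜 _ (r j))
  ring

lemma boost_lie (i j : Fin n) : ((⁅boost 𝕜 i, boost 𝕜 j⁆ : LieAlgebra.Orthogonal.so' _ _ 𝕜) :
    Matrix (Fin n ⊕ Fin 1) (Fin n ⊕ Fin 1) 𝕜) =
      Matrix.single (Sum.inl i) (Sum.inl j) 1 - Matrix.single (Sum.inl j) (Sum.inl i) 1 := by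
  change (boost 𝕜 i : Matrix (Fin n ⊕ Fin 1) (Fin n ⊕ Fin 1) 𝕜) * boost 𝕜 j - boost 𝕜 j * boost 𝕜 i = _
  by_cases h : i = j
  · subst h
    simp
  · simp [boost, mul_add, add_mul, h, Ne.symm h]

lemma boost_lie_lie (i j k : Fin n) : ⁅boost 𝕜 i, ⁅boost 𝕜 j, boost 𝕜 k⁆⁆ =
    (if i = j then boost 𝕜 k else 0) - (if i = k then boost 𝕜 j else 0) := by
  apply Subtype.ext
  change (boost 𝕜 i : Matrix (Fin n ⊕ Fin 1) (Fin n ⊕ Fin 1) 𝕜) * (⁅boost 𝕜 j, boost 𝕜 k⁆ :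
    LieAlgebra.Orthogonal.so' _ _ 𝕜) - (⁅boost 𝕜 j, boost 𝕜 k⁆ :
    LieAlgebra.Orthogonal.so' _ _ 𝕜) * boost 𝕜 i = _
  rw [boost_lie]
  by_cases hij : i = j <;> by_cases hik : i = k
  · subst hij hik
    simp
  · subst hij
    simp [boost, mul_sub, sub_mul, mul_add, add_mul, hik, Ne.symm hik]
    rw [add_comm]
  · subst hik
    simp [boost, mul_sub, sub_mul, mul_add, add_mul, hij, Ne.symm hij]
    rw [sub_eq_add_neg]
  · simp [boost, mul_sub, sub_mul, mul_add, add_mul, hik, Ne.symm hik, hij, Ne.symm hij]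

lemma curveQ_eq (r : Fin n → 𝕜) (i : Fin n) : curveQ r i = CurveRing.coord r i ⊗ₜ boost 𝕜 i := rfl

lemma CurveRing.smul_tmul (r : Fin n → 𝕜) (t : 𝕜) (c : CurveRing r)
    (X : LieAlgebra.Orthogonal.so' (Fin n) (Fin 1) 𝕜) :
    t • (c ⊗ₜ[𝕜] X) = (algebraMap 𝕜 (CurveRing r) t * c) ⊗ₜ[𝕜] X := by
  rw [TensorProduct.smul_tmul']
  congr 1
  exact Algebra.smul_def t c

/-- For $i\ne k$, $(\operatorname{ad}Q_i)^2Q_k+r_iQ_k=(\lambda_i^2+r_i)Q_k$, and the factor is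
independent of $i$. -/
lemma curveQ_gRel (r : Fin n → 𝕜) : GRel r (curveQ r) where
  distinct i j k hij hjk hki := by
    simp only [curveQ_eq, LieAlgebra.ExtendScalars.bracket_tmul, boost_lie_lie, if_neg hij,
      if_neg hki.symm, sub_zero, TensorProduct.tmul_zero]
  double i j k hik hjk := by
    have key (i : Fin n) (hik : i ≠ k) : ⁅curveQ r i, ⁅curveQ r i, curveQ r k⁆⁆ + r i • curveQ r k =
        ((CurveRing.coord r i ^ 2 + algebraMap 𝕜 _ (r i)) * CurveRing.coord r k) ⊗ₜ boost 𝕜 k := by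
      simp only [curveQ_eq, LieAlgebra.ExtendScalars.bracket_tmul, boost_lie_lie, if_true,
        if_neg hik, sub_zero, CurveRing.smul_tmul, ← TensorProduct.add_tmul]
      congr 1
      ring
    rw [key i hik, key j hjk, CurveRing.coord_sq r i j]

lemma map_gTower_curve {L : Type*} [LieRing L] [LieAlgebra 𝕜 L] {r : Fin n → 𝕜} {p : Fin n → L}
    {o : Fin n → Fin n} (ho : ∀ k, o k ≠ k) (i₀ : Fin n)
    (f : L →ₗ⁅𝕜⁆ CurveRing r ⊗[𝕜] LieAlgebra.Orthogonal.so' (Fin n) (Fin 1) 𝕜)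
    (hf : ∀ i, f (p i) = curveQ r i) (k : Fin n) (s : ℕ) :
    f (gTower o r p s k) = ((CurveRing.coord r i₀ ^ 2 + algebraMap 𝕜 _ (r i₀)) ^ s *
      CurveRing.coord r k) ⊗ₜ boost 𝕜 k := by
  induction s with
  | zero =>
    rw [pow_zero, one_mul]
    exact hf k
  | succ s ih =>
    change f (⁅p (o k), ⁅p (o k), gTower o r p s k⁆⁆ + r (o k) • gTower o r p s k) = _
    rw [map_add, LieHom.map_lie, LieHom.map_lie, map_smul, ih, hf, curveQ_eq,
      LieAlgebra.ExtendScalars.bracket_tmul, LieAlgebra.ExtendScalars.bracket_tmul, boost_lie_lie,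
      if_pos rfl, if_neg (ho k), sub_zero, CurveRing.smul_tmul, ← TensorProduct.add_tmul,
      pow_succ _ s, CurveRing.coord_sq r i₀ (o k)]
    congr 1
    ring

lemma map_towerMap_curve {L : Type*} [LieRing L] [LieAlgebra 𝕜 L] {r : Fin n → 𝕜} {p : Fin n → L}
    {o : Fin n → Fin n} (ho : ∀ k, o k ≠ k) (i₀ : Fin n)
    (f : L →ₗ⁅𝕜⁆ CurveRing r ⊗[𝕜] LieAlgebra.Orthogonal.so' (Fin n) (Fin 1) 𝕜)
    (hf : ∀ i, f (p i) = curveQ r i) (k : Fin n) (P : Polynomial 𝕜) :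
    f (towerMap (gTower o r p) k P) =
      (Polynomial.aeval (CurveRing.coord r i₀ ^ 2 + algebraMap 𝕜 _ (r i₀)) P *
        CurveRing.coord r k) ⊗ₜ boost 𝕜 k := by
  induction P using Polynomial.induction_on' with
  | add P Q hP hQ => rw [map_add, map_add, hP, hQ, map_add, add_mul, TensorProduct.add_tmul]
  | monomial s t =>
    rw [towerMap_monomial, map_smul, map_gTower_curve ho i₀ f hf, Polynomial.aeval_monomial,
      CurveRing.smul_tmul, mul_assoc]

/-- The evaluation at a point of the curve with coordinates in an extension of the ground field. -/
def CurveRing.eval {K : Type*} [Field K] [Algebra 𝕜 K] (r : Fin n → 𝕜) (t : 𝕜) (μ : Fin n → K)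
    (hμ : ∀ i, μ i ^ 2 = algebraMap 𝕜 K (t - r i)) : CurveRing r →ₐ[𝕜] K :=
  Ideal.Quotient.liftₐ _ (MvPolynomial.aeval μ) (by
    intro x hx
    have : Ideal.span (Set.range fun ij : Fin n × Fin n =>
        (MvPolynomial.X ij.1 ^ 2 - MvPolynomial.X ij.2 ^ 2 + MvPolynomial.C (r ij.1 - r ij.2) :
        MvPolynomial (Fin n) 𝕜)) ≤ RingHom.ker (MvPolynomial.aeval (R := 𝕜) μ) := by
      rw [Ideal.span_le]
      rintro _ ⟨⟨i, j⟩, rfl⟩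
      simp only [SetLike.mem_coe, RingHom.mem_ker, map_add, map_sub, map_pow, MvPolynomial.aeval_X,
        hμ, MvPolynomial.aeval_C]
      ring
    exact this hx)

lemma CurveRing.eval_coord {K : Type*} [Field K] [Algebra 𝕜 K] (r : Fin n → 𝕜) (t : 𝕜)
    (μ : Fin n → K) (hμ : ∀ i, μ i ^ 2 = algebraMap 𝕜 K (t - r i)) (i : Fin n) :
    CurveRing.eval r t μ hμ (CurveRing.coord r i) = μ i :=
  MvPolynomial.aeval_X μ i

/-- A matrix entry of the value of a matrix-valued function at a point of the curve. -/
def curveEntry {K : Type*} [Field K] [Algebra 𝕜 K] {r : Fin n → 𝕜} (ev : CurveRing r →ₐ[𝕜] K)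
    (a b : Fin n ⊕ Fin 1) :
    CurveRing r ⊗[𝕜] LieAlgebra.Orthogonal.so' (Fin n) (Fin 1) 𝕜 →ₗ[𝕜] K :=
  TensorProduct.lift (LinearMap.mk₂ 𝕜
    (fun c X => ev c * algebraMap 𝕜 K ((X : Matrix (Fin n ⊕ Fin 1) (Fin n ⊕ Fin 1) 𝕜) a b))
    (fun c d X => by rw [map_add, add_mul])
    (fun t c X => by rw [map_smul, Algebra.smul_mul_assoc])
    (fun c X Y => by
      rw [← mul_add, ← map_add]
      rfl)
    (fun t c X => by
      change ev c * algebraMap 𝕜 K (t * (X : Matrix (Fin n ⊕ Fin 1) (Fin n ⊕ Fin 1) 𝕜) a b) = _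
      rw [map_mul, Algebra.smul_def]
      ring))

lemma curveEntry_tmul {K : Type*} [Field K] [Algebra 𝕜 K] {r : Fin n → 𝕜}
    (ev : CurveRing r →ₐ[𝕜] K) (a b : Fin n ⊕ Fin 1) (c : CurveRing r)
    (X : LieAlgebra.Orthogonal.so' (Fin n) (Fin 1) 𝕜) :
    curveEntry ev a b (c ⊗ₜ X) =
      ev c * algebraMap 𝕜 K ((X : Matrix (Fin n ⊕ Fin 1) (Fin n ⊕ Fin 1) 𝕜) a b) := rfl

/-- A polynomial that vanishes at all values of a parameter outside a finite set is zero. -/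
lemma Polynomial.eq_zero_of_eval_eq_zero_of_notMem (r : Fin n → 𝕜) (P : Polynomial 𝕜)
    (h : ∀ t, (∀ i, t ≠ r i) → P.eval t = 0) : P = 0 := by
  refine P.eq_zero_of_infinite_isRoot ?_
  refine Set.Infinite.mono (s := (Set.range r)ᶜ) ?_ (Set.finite_range r).infinite_compl
  intro t ht
  exact h t fun i hi => ht ⟨i, hi.symm⟩

/-- The image of $\sum p_kP_k(\lambda)+\sum[p_i,p_jQ_{ij}(\lambda)]$ is a matrix whose last column
contains the $P_k\lambda_k$ and whose $\mathfrak{so}_n$ block contains the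
$(Q_{ij}-Q_{ji})\lambda_i\lambda_j$. If it vanishes, then $P=0$ and $Q$ is symmetric, and for
symmetric $Q$ the sum of brackets is already zero in `L`. -/
lemma towerSum_eq_zero {L : Type*} [LieRing L] [LieAlgebra 𝕜 L] {r : Fin n → 𝕜} {p : Fin n → L}
    {o : Fin n → Fin n} (ho : ∀ k, o k ≠ k) (hx : ∀ N, TowerRel r (gTower o r p) N)
    (f : L →ₗ⁅𝕜⁆ CurveRing r ⊗[𝕜] LieAlgebra.Orthogonal.so' (Fin n) (Fin 1) 𝕜)
    (hf : ∀ i, f (p i) = curveQ r i)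
    (P : (Fin n → Polynomial 𝕜) × (Fin n → Fin n → Polynomial 𝕜))
    (h : f (towerSum (gTower o r p) P) = 0) : towerSum (gTower o r p) P = 0 := by
  obtain ⟨P, Q⟩ := P
  -- A point of the curve over the parameter `t` needs square roots of all `t - r i`, which may be
  -- missing over the real numbers. Parameters different from all `r i` give points with nonzero
  -- coordinates.
  let K := AlgebraicClosure 𝕜
  have hpt (t : 𝕜) (ht : ∀ i, t ≠ r i) : ∃ μ : Fin n → K, (∀ i, μ i ^ 2 = algebraMap 𝕜 K (t - r i)) ∧
      ∀ i, μ i ≠ 0 := by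
    have h1 (i : Fin n) : ∃ z : K, z ^ 2 = algebraMap 𝕜 K (t - r i) :=
      IsAlgClosed.exists_pow_nat_eq _ two_pos
    choose μ hμ using h1
    refine ⟨μ, hμ, fun i hi => ?_⟩
    have := hμ i
    rw [hi, zero_pow two_ne_zero, eq_comm, map_eq_zero, sub_eq_zero] at this
    exact ht i this
  change f (∑ k, towerMap (gTower o r p) k (P k) +
    ∑ i, ∑ j, ⁅p i, towerMap (gTower o r p) j (Q i j)⁆) = 0 at h
  simp only [map_add, map_sum, LieHom.map_lie, hf] at h
  have hent (i₀ : Fin n) (t : 𝕜) (μ : Fin n → K) (hμ : ∀ i, μ i ^ 2 = algebraMap 𝕜 K (t - r i))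
      (a b : Fin n ⊕ Fin 1) :
      ∑ k, algebraMap 𝕜 K ((P k).eval t) * μ k * algebraMap 𝕜 K
        ((boost 𝕜 k : Matrix (Fin n ⊕ Fin 1) (Fin n ⊕ Fin 1) 𝕜) a b) +
      ∑ i, ∑ j, μ i * (algebraMap 𝕜 K ((Q i j).eval t) * μ j) * algebraMap 𝕜 K
        ((Matrix.single (Sum.inl i) (Sum.inl j) 1 - Matrix.single (Sum.inl j) (Sum.inl i) 1 :
          Matrix (Fin n ⊕ Fin 1) (Fin n ⊕ Fin 1) 𝕜) a b) = 0 := by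
    have h1 := congrArg (curveEntry (CurveRing.eval r t μ hμ) a b) h
    have hΛ : CurveRing.eval r t μ hμ (CurveRing.coord r i₀ ^ 2 + algebraMap 𝕜 _ (r i₀)) =
        algebraMap 𝕜 K t := by
      rw [map_add, map_pow, CurveRing.eval_coord, hμ, AlgHom.commutes, ← map_add, sub_add_cancel]
    have hev (R : Polynomial 𝕜) : CurveRing.eval r t μ hμ
        (Polynomial.aeval (CurveRing.coord r i₀ ^ 2 + algebraMap 𝕜 _ (r i₀)) R) =
          algebraMap 𝕜 K (R.eval t) := by
      rw [← Polynomial.aeval_algHom_apply, hΛ, Polynomial.aeval_algebraMap_apply,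
        Polynomial.coe_aeval_eq_eval]
    simp only [map_towerMap_curve ho i₀ f hf, curveQ_eq, LieAlgebra.ExtendScalars.bracket_tmul,
      map_add, map_sum, map_zero, curveEntry_tmul, map_mul, CurveRing.eval_coord, hev,
      boost_lie] at h1
    exact h1
  have hP (k : Fin n) : P k = 0 := by
    refine Polynomial.eq_zero_of_eval_eq_zero_of_notMem r _ fun t ht => ?_
    obtain ⟨μ, hμ, hμ0⟩ := hpt t ht
    -- In the last column only the boosts contribute.
    have h1 := hent k t μ hμ (Sum.inl k) (Sum.inr 0)
    simp only [Matrix.sub_apply, Matrix.single_apply, reduceCtorEq, and_false, if_false, sub_zero,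
      map_zero, mul_zero, Finset.sum_const_zero, add_zero] at h1
    rw [Finset.sum_eq_single k] at h1
    · simpa [boost, hμ0 k] using h1
    · intro j _ hj
      simp [boost, hj]
    · simp
  have hQ (i j : Fin n) (hij : i ≠ j) : Q i j = Q j i := by
    rw [← sub_eq_zero]
    refine Polynomial.eq_zero_of_eval_eq_zero_of_notMem r _ fun t ht => ?_
    obtain ⟨μ, hμ, hμ0⟩ := hpt t ht
    -- In the block of rotations only the brackets remain, since `P` vanishes.
    have h1 := hent i t μ hμ (Sum.inl i) (Sum.inl j)
    have hs (c : Fin n → Fin n → K) : ∑ x, ∑ y, c x y * algebraMap 𝕜 K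
        ((Matrix.single (Sum.inl x) (Sum.inl y) 1 - Matrix.single (Sum.inl y) (Sum.inl x) 1 :
          Matrix (Fin n ⊕ Fin 1) (Fin n ⊕ Fin 1) 𝕜) (Sum.inl i) (Sum.inl j)) = c i j - c j i := by
      simp only [Matrix.sub_apply, map_sub, mul_sub, Finset.sum_sub_distrib]
      congr 1
      · rw [Finset.sum_eq_single i (fun x _ hx => by simp [hx]) (by simp),
          Finset.sum_eq_single j (fun y _ hy => by simp [hy]) (by simp)]
        simp
      · rw [Finset.sum_eq_single j (fun x _ hx => by simp [hx]) (by simp),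
          Finset.sum_eq_single i (fun y _ hy => by simp [hy]) (by simp)]
        simp
    rw [hs] at h1
    simp only [hP, Polynomial.eval_zero, map_zero, zero_mul, Finset.sum_const_zero, zero_add] at h1
    have h2 : algebraMap 𝕜 K ((Q i j - Q j i).eval t) * (μ i * μ j) = 0 := by
      rw [← h1, Polynomial.eval_sub, map_sub]
      ring
    have h3 := (mul_eq_zero.1 h2).resolve_right (mul_ne_zero (hμ0 i) (hμ0 j))
    rwa [map_eq_zero] at h3
  change ∑ k, towerMap (gTower o r p) k (P k) +
    ∑ i, ∑ j, ⁅gTower o r p 0 i, towerMap (gTower o r p) j (Q i j)⁆ = 0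
  have hQ' (i j : Fin n) : Q i j = Q j i := by
    by_cases hij : i = j
    · rw [hij]
    · exact hQ i j hij
  -- A symmetric array is paired here with a bracket that is skew in `i`, `j`.
  have hskew : ∑ i, ∑ j, ⁅gTower o r p 0 i, towerMap (gTower o r p) j (Q i j)⁆ =
      -∑ i, ∑ j, ⁅gTower o r p 0 i, towerMap (gTower o r p) j (Q i j)⁆ := by
    conv_rhs => rw [Finset.sum_comm]
    simp only [← Finset.sum_neg_distrib]
    refine Finset.sum_congr rfl fun i _ => Finset.sum_congr rfl fun j _ => ?_
    rw [lie_towerMap_skew hx, hQ' i j]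
  have h2 : (2 : 𝕜) • ∑ i, ∑ j, ⁅gTower o r p 0 i, towerMap (gTower o r p) j (Q i j)⁆ = 0 := by
    rw [two_smul, add_eq_zero_iff_eq_neg]
    exact hskew
  rw [(smul_eq_zero.1 h2).resolve_left two_ne_zero, add_zero]
  exact Finset.sum_eq_zero fun k _ => by rw [hP, map_zero]

lemma curveQ_mem (r : Fin n → 𝕜) (y : gAlgebra r) :
    gAlgebra.lift r (curveQ r) (curveQ_gRel r) y ∈ curveAlgebra r := by
  refine PresentedLieAlgebra.eq_top_of_gen_mem
    ((curveAlgebra r).comap (gAlgebra.lift r (curveQ r) (curveQ_gRel r))) (fun l => ?_) y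
  rw [LieSubalgebra.mem_comap]
  change gAlgebra.lift r (curveQ r) (curveQ_gRel r) (gAlgebra.p r l) ∈ _
  rw [gAlgebra.lift_p]
  exact LieSubalgebra.subset_lieSpan (Set.mem_range_self l)

/-- For `n ≥ 3`, the algebras `𝔤(n)` and `L(n)` are isomorphic. -/
lemma exists_gAlgebra_equiv (hn : 3 ≤ n) (r : Fin n → 𝕜) :
    ∃ e : gAlgebra r ≃ₗ⁅𝕜⁆ curveAlgebra r, ∀ l, e (gAlgebra.p r l) = curveAlgebra.Q r l := by
  have hn' := fun i j => Fin.exists_ne_and_ne hn i j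
  have ho : ∀ k : Fin n, ∃ l, l ≠ k := fun k => ⟨_, (hn' k k).choose_spec.1⟩
  choose o ho using ho
  let F : gAlgebra r →ₗ⁅𝕜⁆ CurveRing r ⊗[𝕜] LieAlgebra.Orthogonal.so' (Fin n) (Fin 1) 𝕜 :=
    gAlgebra.lift r (curveQ r) (curveQ_gRel r)
  have hx := (gAlgebra.gRel r).towerRel ho hn'
  have hinj : Function.Injective F := by
    rw [injective_iff_map_eq_zero]
    intro y hy
    have hmem : y ∈ LinearMap.range (towerSum (𝕜 := 𝕜) (gTower o r (gAlgebra.p r))) := by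
      refine PresentedLieAlgebra.eq_top_of_lie_gen_mem _ (fun l => ?_) (fun l v hv => ?_) y
      · exact ⟨_, by rw [towerSum_single_fst _ l (Polynomial.monomial 0 1), towerMap_monomial,
          one_smul]; rfl⟩
      · exact lie_range_towerSum hx l v hv
    obtain ⟨P, rfl⟩ := hmem
    exact towerSum_eq_zero ho hx F (gAlgebra.lift_p r _ _) P hy
  let F' : gAlgebra r →ₗ⁅𝕜⁆ curveAlgebra r :=
    { toFun := fun y => ⟨F y, curveQ_mem r y⟩
      map_add' := fun x y => Subtype.ext (map_add F x y)
      map_smul' := fun t x => Subtype.ext (map_smul F t x)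
      map_lie' := fun {x y} => Subtype.ext (LieHom.map_lie F x y) }
  have hsurj : Function.Surjective F' := by
    rintro ⟨z, hz⟩
    have hle : curveAlgebra r ≤ F.range := by
      refine LieSubalgebra.lieSpan_le.2 ?_
      rintro _ ⟨l, rfl⟩
      exact ⟨gAlgebra.p r l, gAlgebra.lift_p r _ _ l⟩
    obtain ⟨y, hy⟩ := hle hz
    exact ⟨y, Subtype.ext hy⟩
  refine ⟨LieEquiv.ofBijective F' ⟨fun x y h => hinj (congrArg Subtype.val h), hsurj⟩, fun l => ?_⟩
  exact Subtype.ext (gAlgebra.lift_p r _ _ l)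

end CurveAlgebra

/-! ### The decomposition of the algebra with generators `p_0, …, p_{n+1}` -/

section HAlgebra

variable {𝕜 : Type*} [RCLike 𝕜] {n : ℕ} {L : Type*} [LieRing L] [LieAlgebra 𝕜 L]

/-- The elements `q_0`, `q_1` commute with each other and with all `p_l`, and the elements `p_l`
satisfy the relations of `𝔤(n)`. -/
structure HRel (r : Fin n → 𝕜) (q₀ q₁ : L) (p : Fin n → L) : Prop where
  gRel : GRel r p
  lie_p₀ : ∀ l, ⁅q₀, p l⁆ = 0
  lie_p₁ : ∀ l, ⁅q₁, p l⁆ = 0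
  lie_q : ⁅q₀, q₁⁆ = 0

lemma Fin.eq_zero_or_last_or_mid (i : Fin (n + 2)) :
    i = 0 ∨ i = Fin.last (n + 1) ∨ ∃ l : Fin n, i = l.succ.castSucc := by
  induction i using Fin.lastCases with
  | last => exact Or.inr (Or.inl rfl)
  | cast i =>
    induction i using Fin.cases with
    | zero => exact Or.inl rfl
    | succ l => exact Or.inr (Or.inr ⟨l, rfl⟩)

lemma hAlgebra.hom_ext {r : Fin n → 𝕜} {f g : hAlgebra r →ₗ⁅𝕜⁆ L}
    (h₀ : f (hAlgebra.p r 0) = g (hAlgebra.p r 0))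
    (h₁ : f (hAlgebra.p r (Fin.last (n + 1))) = g (hAlgebra.p r (Fin.last (n + 1))))
    (h : ∀ l : Fin n, f (hAlgebra.p r l.succ.castSucc) = g (hAlgebra.p r l.succ.castSucc)) :
    f = g := by
  refine PresentedLieAlgebra.hom_ext fun i => ?_
  rcases Fin.eq_zero_or_last_or_mid i with rfl | rfl | ⟨l, rfl⟩
  · exact h₀
  · exact h₁
  · exact h l

lemma hAlgebra.hRel (r : Fin n → 𝕜) : HRel r (hAlgebra.p r 0) (hAlgebra.p r (Fin.last (n + 1)))
    (fun l : Fin n => hAlgebra.p r l.succ.castSucc) where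
  gRel := gRel_of_presented r (fun l : Fin n => l.succ.castSucc) fun _ h => Or.inr h
  lie_p₀ l := PresentedLieAlgebra.mk_eq_zero_of_mem
    (rels := hRelators r) (Or.inl (Or.inl (Or.inl ⟨l, rfl⟩)))
  lie_p₁ l := PresentedLieAlgebra.mk_eq_zero_of_mem
    (rels := hRelators r) (Or.inl (Or.inl (Or.inr ⟨l, rfl⟩)))
  lie_q := PresentedLieAlgebra.mk_eq_zero_of_mem (rels := hRelators r) (Or.inl (Or.inr rfl))

lemma hAlgebra.exists_lift {r : Fin n → 𝕜} {q₀ q₁ : L} {p : Fin n → L} (h : HRel r q₀ q₁ p) :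
    ∃ f : hAlgebra r →ₗ⁅𝕜⁆ L, f (hAlgebra.p r 0) = q₀ ∧ f (hAlgebra.p r (Fin.last (n + 1))) = q₁ ∧
      ∀ l : Fin n, f (hAlgebra.p r l.succ.castSucc) = p l := by
  let g : Fin (n + 2) → L := Fin.snoc (α := fun _ => L) (Fin.cons (α := fun _ => L) q₀ p) q₁
  have g₀ : g 0 = q₀ := Fin.snoc_castSucc (α := fun _ => L) q₁ (Fin.cons (α := fun _ => L) q₀ p) 0
  have g₁ : g (Fin.last (n + 1)) = q₁ := Fin.snoc_last (α := fun _ => L) _ _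
  have gp (l : Fin n) : g l.succ.castSucc = p l :=
    Fin.snoc_castSucc (α := fun _ => L) q₁ (Fin.cons (α := fun _ => L) q₀ p) l.succ
  have hrel : ∀ y ∈ hRelators r, FreeLieAlgebra.lift 𝕜 g y = 0 := by
    rintro y (((⟨l, rfl⟩ | ⟨l, rfl⟩) | rfl) | hy)
    · simp only [LieHom.map_lie, FreeLieAlgebra.lift_of_apply, g₀, gp]
      exact h.lie_p₀ l
    · simp only [LieHom.map_lie, FreeLieAlgebra.lift_of_apply, g₁, gp]
      exact h.lie_p₁ l
    · simp only [LieHom.map_lie, FreeLieAlgebra.lift_of_apply, g₀, g₁]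
      exact h.lie_q
    · refine lift_gRelators r (fun l : Fin n => l.succ.castSucc) g ?_ y hy
      have : g ∘ (fun l : Fin n => l.succ.castSucc) = p := funext gp
      rw [this]
      exact h.gRel
  refine ⟨PresentedLieAlgebra.lift g hrel, ?_, ?_, fun l => ?_⟩
  · exact (PresentedLieAlgebra.lift_gen _ _ _).trans g₀
  · exact (PresentedLieAlgebra.lift_gen _ _ _).trans g₁
  · exact (PresentedLieAlgebra.lift_gen _ _ _).trans (gp l)

lemma gAlgebra.hom_ext {r : Fin n → 𝕜} {f g : gAlgebra r →ₗ⁅𝕜⁆ L}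
    (h : ∀ l, f (gAlgebra.p r l) = g (gAlgebra.p r l)) : f = g :=
  PresentedLieAlgebra.hom_ext h

lemma HRel.exists_planeProd_hom {r : Fin n → 𝕜} {q₀ q₁ : L} {p : Fin n → L} (h : HRel r q₀ q₁ p) :
    ∃ f : (AbelianPlane 𝕜 × gAlgebra r) →ₗ⁅𝕜⁆ L,
      ∀ s t y, f (AbelianPlane.mk s t, y) = s • q₀ + t • q₁ + gAlgebra.lift r p h.gRel y := by
  -- The preimage in $\mathfrak g(n)$ of the centralizer of `q` is a subalgebra that contains all
  -- generators.
  have hc (q : L) (hq : ∀ l, ⁅q, p l⁆ = 0) (y : gAlgebra r) :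
      ⁅q, gAlgebra.lift r p h.gRel y⁆ = 0 := by
    let S : LieSubalgebra 𝕜 (gAlgebra r) :=
      { carrier := {y | ⁅q, gAlgebra.lift r p h.gRel y⁆ = 0}
        add_mem' := fun {x y} hx hy => by
          change ⁅q, gAlgebra.lift r p h.gRel (x + y)⁆ = 0
          rw [map_add, lie_add, hx, hy, add_zero]
        zero_mem' := by
          change ⁅q, gAlgebra.lift r p h.gRel 0⁆ = 0
          rw [map_zero, lie_zero]
        smul_mem' := fun t x hx => by
          change ⁅q, gAlgebra.lift r p h.gRel (t • x)⁆ = 0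
          rw [map_smul, lie_smul, hx, smul_zero]
        lie_mem' := fun {x y} hx hy => by
          change ⁅q, gAlgebra.lift r p h.gRel ⁅x, y⁆⁆ = 0
          rw [LieHom.map_lie, leibniz_lie, hx, hy, zero_lie, lie_zero, add_zero] }
    refine PresentedLieAlgebra.eq_top_of_gen_mem S (fun l => ?_) y
    change ⁅q, gAlgebra.lift r p h.gRel (gAlgebra.p r l)⁆ = 0
    rw [gAlgebra.lift_p, hq]
  refine ⟨{ toFun := fun z => z.1.1 • q₀ + z.1.2 • q₁ + gAlgebra.lift r p h.gRel z.2
            map_add' := ?_, map_smul' := ?_, map_lie' := ?_ }, fun s t y => rfl⟩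
  · rintro ⟨⟨s, t⟩, y⟩ ⟨⟨s', t'⟩, y'⟩
    change (s + s') • q₀ + (t + t') • q₁ + gAlgebra.lift r p h.gRel (y + y') =
      s • q₀ + t • q₁ + gAlgebra.lift r p h.gRel y +
      (s' • q₀ + t' • q₁ + gAlgebra.lift r p h.gRel y')
    rw [map_add]
    module
  · rintro c ⟨⟨s, t⟩, y⟩
    change (c * s) • q₀ + (c * t) • q₁ + gAlgebra.lift r p h.gRel (c • y) =
      c • (s • q₀ + t • q₁ + gAlgebra.lift r p h.gRel y)
    rw [map_smul]
    module
  · rintro ⟨⟨s, t⟩, y⟩ ⟨⟨s', t'⟩, y'⟩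
    change (0 : 𝕜) • q₀ + (0 : 𝕜) • q₁ + gAlgebra.lift r p h.gRel ⁅y, y'⁆ =
      ⁅s • q₀ + t • q₁ + gAlgebra.lift r p h.gRel y,
        s' • q₀ + t' • q₁ + gAlgebra.lift r p h.gRel y'⁆
    have h1 := hc q₀ h.lie_p₀
    have h2 := hc q₁ h.lie_p₁
    have h3 (y : gAlgebra r) : ⁅gAlgebra.lift r p h.gRel y, q₀⁆ = 0 := by
      rw [← lie_skew, h1, neg_zero]
    have h4 (y : gAlgebra r) : ⁅gAlgebra.lift r p h.gRel y, q₁⁆ = 0 := by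
      rw [← lie_skew, h2, neg_zero]
    have h5 : ⁅q₁, q₀⁆ = 0 := by rw [← lie_skew, h.lie_q, neg_zero]
    simp only [lie_add, add_lie, smul_lie, lie_smul, lie_self, h1, h2, h3, h4, h5, h.lie_q,
      LieHom.map_lie, smul_zero, zero_smul, zero_add, add_zero]

/-- The decomposition of the algebra with generators `p_0, …, p_{n+1}`. -/
lemma exists_hAlgebra_equiv (r : Fin n → 𝕜) :
    ∃ e : (AbelianPlane 𝕜 × gAlgebra r) ≃ₗ⁅𝕜⁆ hAlgebra r,
      (∀ s t, e (AbelianPlane.mk s t, 0) =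
        s • hAlgebra.p r 0 + t • hAlgebra.p r (Fin.last (n + 1))) ∧
      ∀ l : Fin n, e (0, gAlgebra.p r l) = hAlgebra.p r l.succ.castSucc := by
  obtain ⟨f, hf⟩ := (hAlgebra.hRel r).exists_planeProd_hom
  have hf0 (s t : 𝕜) : f (AbelianPlane.mk s t, 0) =
      s • hAlgebra.p r 0 + t • hAlgebra.p r (Fin.last (n + 1)) := by
    rw [hf, map_zero, add_zero]
  have hf1 (y : gAlgebra r) : f (0, y) = gAlgebra.lift r _ (hAlgebra.hRel r).gRel y := by
    have := hf 0 0 y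
    rwa [zero_smul, zero_smul, zero_add, zero_add] at this
  have hf1' (l : Fin n) : f (0, gAlgebra.p r l) = hAlgebra.p r l.succ.castSucc := by
    rw [hf1, gAlgebra.lift_p]
  have hrel : HRel r ((AbelianPlane.mk 1 0, 0) : AbelianPlane 𝕜 × gAlgebra r)
      (AbelianPlane.mk 0 1, 0) (fun l => (0, gAlgebra.p r l)) := by
    refine ⟨⟨fun i j k hij hjk hki => ?_, fun i j k hik hjk => ?_⟩, fun l => ?_, fun l => ?_, ?_⟩
    · exact Prod.ext rfl ((gAlgebra.gRel r).distinct i j k hij hjk hki)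
    · refine Prod.ext ?_ ((gAlgebra.gRel r).double i j k hik hjk)
      change (0 : AbelianPlane 𝕜) + r i • 0 = 0 + r j • 0
      rw [smul_zero, smul_zero]
    · exact Prod.ext rfl (zero_lie _)
    · exact Prod.ext rfl (zero_lie _)
    · exact Prod.ext rfl (zero_lie _)
  obtain ⟨g, hg0, hg1, hg⟩ := hAlgebra.exists_lift hrel
  have hfg : f.comp g = LieHom.id := by
    refine hAlgebra.hom_ext ?_ ?_ fun l => ?_
    · rw [LieHom.comp_apply, hg0, hf0, one_smul, zero_smul, add_zero]
      rfl
    · rw [LieHom.comp_apply, hg1, hf0, one_smul, zero_smul, zero_add]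
      rfl
    · rw [LieHom.comp_apply, hg, hf1']
      rfl
  have hgι : ∀ y, g (f (0, y)) = (0, y) := by
    let ι : gAlgebra r →ₗ⁅𝕜⁆ AbelianPlane 𝕜 × gAlgebra r :=
      { toFun := fun y => (0, y)
        map_add' := fun x y => Prod.ext (add_zero _).symm rfl
        map_smul' := fun t y => Prod.ext (smul_zero _).symm rfl
        map_lie' := fun {x y} => Prod.ext rfl rfl }
    have : (g.comp f).comp ι = ι := by
      refine gAlgebra.hom_ext fun l => ?_
      change g (f (0, gAlgebra.p r l)) = (0, gAlgebra.p r l)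
      rw [hf1', hg]
    exact DFunLike.congr_fun this
  have hgf (z : AbelianPlane 𝕜 × gAlgebra r) : g (f z) = z := by
    obtain ⟨⟨s, t⟩, y⟩ := z
    have h1 : (((s, t), y) : AbelianPlane 𝕜 × gAlgebra r) = (AbelianPlane.mk s t, 0) + (0, y) :=
      Prod.ext (add_zero _).symm (zero_add _).symm
    rw [h1, map_add, map_add, hgι, hf0, map_add, map_smul, map_smul, hg0, hg1]
    congr 1
    refine Prod.ext ?_ ?_
    · change ((s * 1 + t * 0, s * 0 + t * 1) : 𝕜 × 𝕜) = (s, t)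
      simp
    · change s • (0 : gAlgebra r) + t • 0 = 0
      simp
  refine ⟨LieEquiv.ofBijective f ⟨Function.LeftInverse.injective hgf, fun y =>
    ⟨g y, DFunLike.congr_fun hfg y⟩⟩, hf0, hf1'⟩

end HAlgebra

/-! ### Differential calculus in the jet coordinates -/

section JetCalculus

open Finset

variable {𝕜 : Type*} [RCLike 𝕜] {m : ℕ}

/-- The Kronecker symbol as a scalar power series. -/
def kron (i j : Fin m) : MvPowerSeries (JetIdx m 4) 𝕜 := if i = j then 1 else 0

lemma kron_self (i : Fin m) : (kron i i : MvPowerSeries (JetIdx m 4) 𝕜) = 1 := if_pos rfl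

lemma kron_ne {i j : Fin m} (h : i ≠ j) : (kron i j : MvPowerSeries (JetIdx m 4) 𝕜) = 0 := if_neg h

lemma kron_comm (i j : Fin m) : (kron i j : MvPowerSeries (JetIdx m 4) 𝕜) = kron j i := by
  simp only [kron, eq_comm]

lemma derivation_kron (d : Derivation 𝕜 (MvPowerSeries (JetIdx m 4) 𝕜)
    (MvPowerSeries (JetIdx m 4) 𝕜)) (i j : Fin m) : d (kron i j) = 0 := by
  rw [kron]
  split_ifs
  · exact d.map_one_eq_zero
  · exact map_zero d

lemma sum_kron_smul {M : Type*} [AddCommGroup M] [Module (MvPowerSeries (JetIdx m 4) 𝕜) M]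
    (i : Fin m) (f : Fin m → M) :
    ∑ j, (kron i j : MvPowerSeries (JetIdx m 4) 𝕜) • f j = f i := by
  simp [kron]

lemma sum_kron_mul (i : Fin m) (f : Fin m → MvPowerSeries (JetIdx m 4) 𝕜) :
    ∑ j, kron i j * f j = f i := by
  simp [kron]

lemma derivation_C {σ : Type*} (d : Derivation 𝕜 (MvPowerSeries σ 𝕜) (MvPowerSeries σ 𝕜)) (t : 𝕜) :
    d (MvPowerSeries.C t) = 0 :=
  d.map_algebraMap t

lemma derivation_two {σ : Type*} (d : Derivation 𝕜 (MvPowerSeries σ 𝕜) (MvPowerSeries σ 𝕜)) :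
    d 2 = 0 := mod_cast d.map_natCast 2

lemma derivation_four {σ : Type*} (d : Derivation 𝕜 (MvPowerSeries σ 𝕜) (MvPowerSeries σ 𝕜)) :
    d 4 = 0 := mod_cast d.map_natCast 4

lemma derivation_six {σ : Type*} (d : Derivation 𝕜 (MvPowerSeries σ 𝕜) (MvPowerSeries σ 𝕜)) :
    d 6 = 0 := mod_cast d.map_natCast 6

lemma derivation_eight {σ : Type*} (d : Derivation 𝕜 (MvPowerSeries σ 𝕜) (MvPowerSeries σ 𝕜)) :
    d 8 = 0 := mod_cast d.map_natCast 8

lemma derivation_sixteen {σ : Type*}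
    (d : Derivation 𝕜 (MvPowerSeries σ 𝕜) (MvPowerSeries σ 𝕜)) :
    d 16 = 0 := mod_cast d.map_natCast 16

lemma derivation_dotProduct {σ ι : Type*} [Fintype ι]
    (d : Derivation 𝕜 (MvPowerSeries σ 𝕜) (MvPowerSeries σ 𝕜)) (f g : ι → MvPowerSeries σ 𝕜) :
    d (f ⬝ᵥ g) = (fun i => d (f i)) ⬝ᵥ g + f ⬝ᵥ (fun i => d (g i)) := by
  simp only [dotProduct, map_sum, Derivation.leibniz, smul_eq_mul, ← sum_add_distrib]
  refine sum_congr rfl fun i _ => ?_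
  ring

lemma pderiv_jetU' (a : Fin m × ℕ → 𝕜) (i : Fin m) (k : Fin 4) (j : Fin m) :
    MvPowerSeries.pderiv 𝕜 (i, k) (jetU a k j) = kron i j := by
  rw [pderiv_jetU, kron]
  simp

lemma pderiv_jetU_ne (a : Fin m × ℕ → 𝕜) (i : Fin m) {k l : Fin 4} (hkl : k ≠ l) (j : Fin m) :
    MvPowerSeries.pderiv 𝕜 (i, k) (jetU a l j) = 0 := by
  rw [pderiv_jetU, if_neg]
  exact fun h => hkl (Prod.ext_iff.1 h).2

lemma pderiv_dot_self (a : Fin m × ℕ → 𝕜) (i : Fin m) (k : Fin 4) :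
    MvPowerSeries.pderiv 𝕜 (i, k) (jetU a k ⬝ᵥ jetU a k) = 2 * jetU a k i := by
  rw [derivation_dotProduct]
  simp only [pderiv_jetU', dotProduct, mul_comm _ (kron i _), sum_kron_mul]
  ring

lemma pderiv_dot_left (a : Fin m × ℕ → 𝕜) (i : Fin m) {k l : Fin 4} (hkl : k ≠ l) :
    MvPowerSeries.pderiv 𝕜 (i, k) (jetU a k ⬝ᵥ jetU a l) = jetU a l i := by
  rw [derivation_dotProduct]
  simp only [pderiv_jetU', pderiv_jetU_ne a i hkl, dotProduct, sum_kron_mul, mul_zero,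
    sum_const_zero, add_zero]

lemma pderiv_dot_right (a : Fin m × ℕ → 𝕜) (i : Fin m) {k l : Fin 4} (hkl : k ≠ l) :
    MvPowerSeries.pderiv 𝕜 (i, k) (jetU a l ⬝ᵥ jetU a k) = jetU a l i := by
  rw [dotProduct_comm, pderiv_dot_left a i hkl]

lemma pderiv_dot_ne (a : Fin m × ℕ → 𝕜) (i : Fin m) {k l l' : Fin 4} (hl : k ≠ l) (hl' : k ≠ l') :
    MvPowerSeries.pderiv 𝕜 (i, k) (jetU a l ⬝ᵥ jetU a l') = 0 := by
  rw [derivation_dotProduct]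
  simp only [pderiv_jetU_ne a i hl, pderiv_jetU_ne a i hl', dotProduct, zero_mul, mul_zero,
    sum_const_zero, add_zero]

/-- The power series of `1 + ⟨u, u⟩`. -/
def jetDen (a : Fin m × ℕ → 𝕜) : MvPowerSeries (JetIdx m 4) 𝕜 := 1 + jetU a 0 ⬝ᵥ jetU a 0

variable {a : Fin m × ℕ → 𝕜}

lemma jetDen_mul_jetInv (ha : a ∈ jetDomain 𝕜 m) : jetDen a * jetInv a = 1 := jetInv_mul a ha

/-- Obtained by differentiating $\Delta\cdot\Delta^{-1}=1$; stated for all derivations so that it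
covers $\partial/\partial u^i_k$, $D_x$ and $D_t$ at once. -/
lemma derivation_jetInv (ha : a ∈ jetDomain 𝕜 m)
    (d : Derivation 𝕜 (MvPowerSeries (JetIdx m 4) 𝕜) (MvPowerSeries (JetIdx m 4) 𝕜)) :
    d (jetInv a) = -2 * (jetU a 0 ⬝ᵥ fun i => d (jetU a 0 i)) * jetInv a ^ 2 := by
  rw [Derivation.leibniz_of_mul_eq_one d ((mul_comm _ _).trans (jetDen_mul_jetInv ha)), jetDen,
    map_add, d.map_one_eq_zero, derivation_dotProduct, dotProduct_comm (fun i => d (jetU a 0 i)),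
    smul_eq_mul]
  ring

lemma pderiv_jetInv (ha : a ∈ jetDomain 𝕜 m) (i : Fin m) :
    MvPowerSeries.pderiv 𝕜 (i, 0) (jetInv a) = -2 * jetU a 0 i * jetInv a ^ 2 := by
  rw [derivation_jetInv ha]
  simp only [pderiv_jetU', dotProduct, mul_comm _ (kron i _), sum_kron_mul]

lemma pderiv_jetInv_ne (ha : a ∈ jetDomain 𝕜 m) (i : Fin m) {k : Fin 4} (hk : k ≠ 0) :
    MvPowerSeries.pderiv 𝕜 (i, k) (jetInv a) = 0 := by
  rw [derivation_jetInv ha]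
  simp only [pderiv_jetU_ne a i hk, dotProduct, mul_zero, sum_const_zero, zero_mul]

lemma pderiv_jetDen (i : Fin m) :
    MvPowerSeries.pderiv 𝕜 (i, 0) (jetDen a) = 2 * jetU a 0 i := by
  rw [jetDen, map_add, Derivation.map_one_eq_zero, zero_add, pderiv_dot_self]

lemma pderiv_jetDen_ne (i : Fin m) {k : Fin 4} (hk : k ≠ 0) :
    MvPowerSeries.pderiv 𝕜 (i, k) (jetDen a) = 0 := by
  rw [jetDen, map_add, Derivation.map_one_eq_zero, zero_add, pderiv_dot_ne a i hk hk]

lemma scalarDx_jetU (a : Fin m × ℕ → 𝕜) (k : Fin 3) (i : Fin m) :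
    scalarDx a (jetU a k.castSucc i) = jetU a k.succ i := by
  rw [scalarDx, scalarField_apply, sum_eq_single (i, k)]
  · rw [pderiv_jetU', kron_self, mul_one]
  · rintro ⟨j, l⟩ _ h
    rw [pderiv_jetU, if_neg, mul_zero]
    intro h'
    apply h
    rw [Prod.ext_iff] at h' ⊢
    exact ⟨h'.1, Fin.castSucc_injective _ h'.2⟩
  · simp

lemma scalarDx_jetU₀ (a : Fin m × ℕ → 𝕜) (i : Fin m) : scalarDx a (jetU a 0 i) = jetU a 1 i :=
  scalarDx_jetU a 0 i

lemma scalarDx_jetU₁ (a : Fin m × ℕ → 𝕜) (i : Fin m) : scalarDx a (jetU a 1 i) = jetU a 2 i :=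
  scalarDx_jetU a 1 i

lemma scalarDx_jetU₂ (a : Fin m × ℕ → 𝕜) (i : Fin m) : scalarDx a (jetU a 2 i) = jetU a 3 i :=
  scalarDx_jetU a 2 i

lemma scalarDt_jetU (r : Fin (m + 1) → 𝕜) (a : Fin m × ℕ → 𝕜) (i : Fin m) :
    scalarDt r a (jetU a 0 i) = jetF r a i := by
  rw [scalarDt, scalarField_apply]
  simp only [pderiv_jetU', mul_comm _ (kron _ _), kron_comm _ i, sum_kron_mul]

lemma scalarField_comm {σ ι : Type*} [Fintype ι] (f : ι → MvPowerSeries σ 𝕜) (v : ι → σ) (s : σ)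
    (g : MvPowerSeries σ 𝕜) :
    MvPowerSeries.pderiv 𝕜 s (scalarField f v g) =
      scalarField (fun j => MvPowerSeries.pderiv 𝕜 s (f j)) v g +
        scalarField f v (MvPowerSeries.pderiv 𝕜 s g) := by
  have hcomm (t : σ) : MvPowerSeries.pderiv 𝕜 s (MvPowerSeries.pderiv 𝕜 t g) =
      MvPowerSeries.pderiv 𝕜 t (MvPowerSeries.pderiv 𝕜 s g) := by
    classical
    ext γ
    simp only [MvPowerSeries.coeff_pderiv, Finsupp.add_apply]
    rw [add_right_comm]
    by_cases h : s = t
    · subst h; rfl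
    · simp [h, Ne.symm h]
      ring
  simp only [scalarField_apply, map_sum, Derivation.leibniz, sum_add_distrib, smul_eq_mul, hcomm]
  rw [add_comm]
  simp only [mul_comm]

/-- The coefficients of `∂/∂u^i_k` of the coefficients of `D_x`. -/
lemma pderiv_Dx_coeff (a : Fin m × ℕ → 𝕜) (i : Fin m) (k : Fin 4) (s : JetIdx m 3) :
    MvPowerSeries.pderiv 𝕜 (i, k) (jetU a s.2.succ s.1) = if (i, k) = (s.1, s.2.succ) then 1 else 0 :=
  pderiv_jetU a (i, k) s.2.succ s.1

lemma pderiv_scalarDx_zero (a : Fin m × ℕ → 𝕜) (i : Fin m) (g : MvPowerSeries (JetIdx m 4) 𝕜) :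
    MvPowerSeries.pderiv 𝕜 (i, 0) (scalarDx a g) =
      scalarDx a (MvPowerSeries.pderiv 𝕜 (i, 0) g) := by
  rw [scalarDx, scalarField_comm, scalarField_apply, sum_eq_zero, zero_add]
  rintro ⟨j, l⟩ _
  rw [pderiv_Dx_coeff, if_neg, zero_mul]
  intro h
  exact Fin.succ_ne_zero l (Prod.ext_iff.1 h).2.symm

/-- The commutator rule $[\partial/\partial u^i_{k+1},D_x]=\partial/\partial u^i_k$, which drives
the elimination of the higher jet coordinates. -/
lemma pderiv_scalarDx_succ (a : Fin m × ℕ → 𝕜) (i : Fin m) (k : Fin 3)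
    (g : MvPowerSeries (JetIdx m 4) 𝕜) :
    MvPowerSeries.pderiv 𝕜 (i, k.succ) (scalarDx a g) =
      MvPowerSeries.pderiv 𝕜 (i, k.castSucc) g +
        scalarDx a (MvPowerSeries.pderiv 𝕜 (i, k.succ) g) := by
  rw [scalarDx, scalarField_comm, scalarField_apply, sum_eq_single (i, k)]
  · rw [pderiv_Dx_coeff, if_pos rfl, one_mul]
  · rintro ⟨j, l⟩ _ h
    rw [pderiv_Dx_coeff, if_neg, zero_mul]
    intro h'
    apply h
    rw [Prod.ext_iff] at h' ⊢
    exact ⟨h'.1.symm, (Fin.succ_injective _ h'.2).symm⟩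
  · simp

end JetCalculus

/-! ### The total derivatives on series with coefficients in a Lie algebra. -/

namespace LieSeries

open Finset

variable {𝕜 : Type*} [RCLike 𝕜] {m : ℕ} {L : Type*} [LieRing L] [LieAlgebra 𝕜 L]

lemma pd_Dx_succ (a : Fin m × ℕ → 𝕜) (i : Fin m) (k : Fin 3) (c : LieSeries (JetIdx m 4) L) :
    pd L (i, k.succ) (Dx L a c) = pd L (i, k.castSucc) c + Dx L a (pd L (i, k.succ) c) := by
  rw [Dx, pd_field, field_apply, sum_eq_single (i, k)]
  · rw [pderiv_Dx_coeff, if_pos rfl, one_smul]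
  · rintro ⟨j, l⟩ _ h
    rw [pderiv_Dx_coeff, if_neg, zero_smul]
    intro h'
    apply h
    rw [Prod.ext_iff] at h' ⊢
    exact ⟨h'.1.symm, (Fin.succ_injective _ h'.2).symm⟩
  · simp

lemma pd_Dx_one (a : Fin m × ℕ → 𝕜) (i : Fin m) (c : LieSeries (JetIdx m 4) L) :
    pd L (i, 1) (Dx L a c) = pd L (i, 0) c + Dx L a (pd L (i, 1) c) := pd_Dx_succ a i 0 c

lemma pd_Dx_two (a : Fin m × ℕ → 𝕜) (i : Fin m) (c : LieSeries (JetIdx m 4) L) :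
    pd L (i, 2) (Dx L a c) = pd L (i, 1) c + Dx L a (pd L (i, 2) c) := pd_Dx_succ a i 1 c

lemma pd_Dx_three (a : Fin m × ℕ → 𝕜) (i : Fin m) (c : LieSeries (JetIdx m 4) L) :
    pd L (i, 3) (Dx L a c) = pd L (i, 2) c + Dx L a (pd L (i, 3) c) := pd_Dx_succ a i 2 c

lemma Dx_smul (a : Fin m × ℕ → 𝕜) (f : MvPowerSeries (JetIdx m 4) 𝕜)
    (c : LieSeries (JetIdx m 4) L) : Dx L a (f • c) = scalarDx a f • c + f • Dx L a c :=
  field_smul _ _ f c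

lemma Dx_lie (a : Fin m × ℕ → 𝕜) (c d : LieSeries (JetIdx m 4) L) :
    Dx L a ⁅c, d⁆ = ⁅Dx L a c, d⁆ + ⁅c, Dx L a d⁆ := field_lie _ _ c d

lemma Dx_const (a : Fin m × ℕ → 𝕜) (x : L) : Dx L a (const (JetIdx m 4) L x) = 0 :=
  field_const _ _ x

lemma Dt_smul (r : Fin (m + 1) → 𝕜) (a : Fin m × ℕ → 𝕜) (f : MvPowerSeries (JetIdx m 4) 𝕜)
    (c : LieSeries (JetIdx m 4) L) : Dt L r a (f • c) = scalarDt r a f • c + f • Dt L r a c :=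
  field_smul _ _ f c

lemma Dt_const (r : Fin (m + 1) → 𝕜) (a : Fin m × ℕ → 𝕜) (x : L) :
    Dt L r a (const (JetIdx m 4) L x) = 0 :=
  field_const _ _ x

section Comb

variable {σ ι : Type*} [DecidableEq σ] [Fintype ι]

/-- The linear combination `∑ f_a p_a` of constants with scalar power series as coefficients. -/
def comb (f : ι → MvPowerSeries σ 𝕜) (p : ι → L) : LieSeries σ L := ∑ b, f b • const σ L (p b)

lemma comb_def (f : ι → MvPowerSeries σ 𝕜) (p : ι → L) :
    comb f p = ∑ b, f b • const σ L (p b) := rfl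

lemma comb_add (f g : ι → MvPowerSeries σ 𝕜) (p : ι → L) :
    comb (fun b => f b + g b) p = comb f p + comb g p := by
  simp only [comb, add_smul, sum_add_distrib]

lemma comb_mul (c : MvPowerSeries σ 𝕜) (f : ι → MvPowerSeries σ 𝕜) (p : ι → L) :
    comb (fun b => c * f b) p = c • comb f p := by
  simp only [comb, mul_smul, smul_sum]

lemma comb_zero (p : ι → L) : comb (fun _ => (0 : MvPowerSeries σ 𝕜)) p = 0 := by
  simp [comb]

lemma pd_comb (s : σ) (f : ι → MvPowerSeries σ 𝕜) (p : ι → L) :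
    pd L s (comb f p) = comb (fun b => MvPowerSeries.pderiv 𝕜 s (f b)) p := by
  simp only [comb, map_sum, pd_smul, pd_const, smul_zero, add_zero]

lemma map_comb {L' : Type*} [LieRing L'] [LieAlgebra 𝕜 L'] (φ : L →ₗ⁅𝕜⁆ L')
    (f : ι → MvPowerSeries σ 𝕜) (p : ι → L) : map φ (comb f p) = comb f (fun b => φ (p b)) := by
  simp only [comb, map_sum]
  refine sum_congr rfl fun b _ => ?_
  rw [_root_.map_smul, map_const]

lemma lie_comb (f g : ι → MvPowerSeries σ 𝕜) (p q : ι → L) :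
    ⁅comb f p, comb g q⁆ = ∑ b, ∑ c, (f b * g c) • const σ L ⁅p b, q c⁆ := by
  rw [comb, comb, _root_.sum_lie]
  refine sum_congr rfl fun b _ => ?_
  rw [lie_sum]
  refine sum_congr rfl fun c _ => ?_
  rw [smul_lie, lie_smul, const_lie, smul_smul]

end Comb

lemma Dx_comb {ι : Type*} [Fintype ι] (a : Fin m × ℕ → 𝕜)
    (f : ι → MvPowerSeries (JetIdx m 4) 𝕜) (p : ι → L) :
    Dx L a (comb f p) = comb (fun b => scalarDx a (f b)) p := by
  simp only [comb, map_sum, Dx_smul, Dx_const, smul_zero, add_zero]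

lemma Dt_comb {ι : Type*} [Fintype ι] (r : Fin (m + 1) → 𝕜) (a : Fin m × ℕ → 𝕜)
    (f : ι → MvPowerSeries (JetIdx m 4) 𝕜) (p : ι → L) :
    Dt L r a (comb f p) = comb (fun b => scalarDt r a (f b)) p := by
  simp only [comb, map_sum, Dt_smul, Dt_const, smul_zero, add_zero]

end LieSeries

/-! ### The stereographic projection -/

section Sphere

open Finset MvPowerSeries

variable {𝕜 : Type*} [RCLike 𝕜] {m : ℕ}

/-- The inverse stereographic projection `S^i = 2 u^i / Δ`, `S^n = 2 / Δ - 1`. -/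
def sphere (a : Fin m × ℕ → 𝕜) : Fin (m + 1) → MvPowerSeries (JetIdx m 4) 𝕜 :=
  Fin.snoc (α := fun _ => MvPowerSeries (JetIdx m 4) 𝕜)
    (fun i => 2 * jetU a 0 i * jetInv a) (2 * jetInv a - 1)

lemma sphere_castSucc (a : Fin m × ℕ → 𝕜) (i : Fin m) :
    sphere a i.castSucc = 2 * jetU a 0 i * jetInv a := by
  simp [sphere]

lemma sphere_last (a : Fin m × ℕ → 𝕜) : sphere a (Fin.last m) = 2 * jetInv a - 1 := by
  simp [sphere]

/-- The first total derivative of `sphere`. -/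
def sphere₁ (a : Fin m × ℕ → 𝕜) (b : Fin (m + 1)) : MvPowerSeries (JetIdx m 4) 𝕜 :=
  scalarDx a (sphere a b)

/-- The second total derivative of `sphere`. -/
def sphere₂ (a : Fin m × ℕ → 𝕜) (b : Fin (m + 1)) : MvPowerSeries (JetIdx m 4) 𝕜 :=
  scalarDx a (sphere₁ a b)

/-- The quadratic form `⟨S, R S⟩` with `R = diag (r_1, …, r_n)`. -/
def sphereQuad (r : Fin (m + 1) → 𝕜) (a : Fin m × ℕ → 𝕜) : MvPowerSeries (JetIdx m 4) 𝕜 :=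
  C (r (Fin.last m)) + 4 * (jetInv a) ^ 2 *
        ∑ i : Fin m, C (r i.castSucc - r (Fin.last m)) * jetU a 0 i ^ 2

/-- The linear part `S_xx + (3/2) ⟨S_x, S_x⟩ S` of the flux. -/
def sphereFlux (a : Fin m × ℕ → 𝕜) (b : Fin (m + 1)) : MvPowerSeries (JetIdx m 4) 𝕜 :=
  sphere₂ a b + C (3 / 2) * (sphere₁ a ⬝ᵥ sphere₁ a) * sphere a b

lemma two_mul_C : (2 : MvPowerSeries (JetIdx m 4) 𝕜) * C (3 / 2) = 3 := by
  rw [← map_ofNat (C (σ := JetIdx m 4) (R := 𝕜)), ← map_mul,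
    ← map_ofNat (C (σ := JetIdx m 4) (R := 𝕜))]
  congr 1
  norm_num

variable {a : Fin m × ℕ → 𝕜} (r : Fin (m + 1) → 𝕜)

lemma scalarDx_dot (a : Fin m × ℕ → 𝕜) (k l : Fin 3) :
    scalarDx a (jetU a k.castSucc ⬝ᵥ jetU a l.castSucc) =
      jetU a k.succ ⬝ᵥ jetU a l.castSucc + jetU a k.castSucc ⬝ᵥ jetU a l.succ := by
  rw [derivation_dotProduct]
  simp only [scalarDx_jetU]

lemma scalarDx_dot₀₁ (a : Fin m × ℕ → 𝕜) :
    scalarDx a (jetU a 0 ⬝ᵥ jetU a 1) = jetU a 1 ⬝ᵥ jetU a 1 + jetU a 0 ⬝ᵥ jetU a 2 :=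
  scalarDx_dot a 0 1

lemma scalarDx_dot₁₁ (a : Fin m × ℕ → 𝕜) :
    scalarDx a (jetU a 1 ⬝ᵥ jetU a 1) = 2 * (jetU a 1 ⬝ᵥ jetU a 2) := by
  refine (scalarDx_dot a 1 1).trans ?_
  rw [dotProduct_comm, two_mul]
  rfl

lemma scalarDx_dot₀₂ (a : Fin m × ℕ → 𝕜) :
    scalarDx a (jetU a 0 ⬝ᵥ jetU a 2) = jetU a 1 ⬝ᵥ jetU a 2 + jetU a 0 ⬝ᵥ jetU a 3 :=
  scalarDx_dot a 0 2

lemma scalarDx_jetInv (ha : a ∈ jetDomain 𝕜 m) :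
    scalarDx a (jetInv a) = -2 * (jetU a 0 ⬝ᵥ jetU a 1) * jetInv a ^ 2 := by
  rw [derivation_jetInv ha]
  simp only [scalarDx_jetU₀]

lemma sphere₁_castSucc (ha : a ∈ jetDomain 𝕜 m) (i : Fin m) : sphere₁ a i.castSucc =
    2 * jetInv a * jetU a 1 i - 4 * (jetU a 0 ⬝ᵥ jetU a 1) * jetInv a ^ 2 * jetU a 0 i := by
  rw [sphere₁, sphere_castSucc]
  simp only [Derivation.leibniz, smul_eq_mul, scalarDx_jetU₀, scalarDx_jetInv ha, derivation_two]
  ring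

lemma sphere₁_last (ha : a ∈ jetDomain 𝕜 m) : sphere₁ a (Fin.last m) =
    -4 * (jetU a 0 ⬝ᵥ jetU a 1) * jetInv a ^ 2 := by
  rw [sphere₁, sphere_last]
  simp only [map_sub, Derivation.map_one_eq_zero, Derivation.leibniz, smul_eq_mul,
    scalarDx_jetInv ha, derivation_two]
  ring

lemma sphere₂_castSucc (ha : a ∈ jetDomain 𝕜 m) (i : Fin m) : sphere₂ a i.castSucc =
    2 * jetInv a * jetU a 2 i - 8 * (jetU a 0 ⬝ᵥ jetU a 1) * jetInv a ^ 2 * jetU a 1 i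
      - 4 * (jetU a 1 ⬝ᵥ jetU a 1 + jetU a 0 ⬝ᵥ jetU a 2) * jetInv a ^ 2 * jetU a 0 i
      + 16 * (jetU a 0 ⬝ᵥ jetU a 1) ^ 2 * jetInv a ^ 3 * jetU a 0 i := by
  rw [sphere₂, sphere₁_castSucc ha]
  simp only [map_sub, Derivation.leibniz, Derivation.leibniz_pow, smul_eq_mul, nsmul_eq_mul,
    scalarDx_jetU₀, scalarDx_jetU₁, scalarDx_jetInv ha, derivation_two, derivation_four,
      scalarDx_dot₀₁]
  push_cast
  ring

lemma sphere₂_last (ha : a ∈ jetDomain 𝕜 m) : sphere₂ a (Fin.last m) =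
    -4 * (jetU a 1 ⬝ᵥ jetU a 1 + jetU a 0 ⬝ᵥ jetU a 2) * jetInv a ^ 2
      + 16 * (jetU a 0 ⬝ᵥ jetU a 1) ^ 2 * jetInv a ^ 3 := by
  rw [sphere₂, sphere₁_last ha]
  simp only [map_neg, Derivation.leibniz, Derivation.leibniz_pow, smul_eq_mul, nsmul_eq_mul,
    scalarDx_jetInv ha, derivation_four,
      scalarDx_dot₀₁]
  push_cast
  ring

lemma sphere_dot_sphere (ha : a ∈ jetDomain 𝕜 m) : sphere a ⬝ᵥ sphere a = 1 := by
  have h := jetDen_mul_jetInv ha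
  have h1 : ∑ i, sphere a (Fin.castSucc i) * sphere a (Fin.castSucc i) =
      4 * jetInv a ^ 2 * (jetU a 0 ⬝ᵥ jetU a 0) := by
    simp only [sphere_castSucc, dotProduct, mul_sum]
    exact sum_congr rfl fun i _ => by ring
  rw [dotProduct, Fin.sum_univ_castSucc, h1, sphere_last]
  rw [jetDen] at h
  linear_combination 4 * jetInv a * h

/-- Every derivation of $S$ is tangent to the sphere: differentiate $\langle S,S\rangle=1$. -/
lemma sphere_dot_derivation (ha : a ∈ jetDomain 𝕜 m)
    (d : Derivation 𝕜 (MvPowerSeries (JetIdx m 4) 𝕜) (MvPowerSeries (JetIdx m 4) 𝕜)) :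
    (sphere a ⬝ᵥ fun b => d (sphere a b)) = 0 := by
  have h := congrArg d (sphere_dot_sphere ha)
  rw [derivation_dotProduct, dotProduct_comm, Derivation.map_one_eq_zero, ← two_mul] at h
  refine (mul_eq_zero.1 h).resolve_left fun h2 => two_ne_zero (α := 𝕜) ?_
  rw [← map_ofNat (constantCoeff (σ := JetIdx m 4) (R := 𝕜)) 2]
  exact (congrArg constantCoeff h2).trans (map_zero _)

lemma sphere_dot_sphere₁ (ha : a ∈ jetDomain 𝕜 m) : sphere a ⬝ᵥ sphere₁ a = 0 :=
  sphere_dot_derivation ha _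

lemma sphere₁_dot_sphere₁ (ha : a ∈ jetDomain 𝕜 m) :
    sphere₁ a ⬝ᵥ sphere₁ a = 4 * jetInv a ^ 2 * (jetU a 1 ⬝ᵥ jetU a 1) := by
  have h := jetDen_mul_jetInv ha
  have h1 : ∑ i, sphere₁ a (Fin.castSucc i) * sphere₁ a (Fin.castSucc i) =
      4 * jetInv a ^ 2 * (jetU a 1 ⬝ᵥ jetU a 1)
      - 16 * (jetU a 0 ⬝ᵥ jetU a 1) * jetInv a ^ 3 * (jetU a 0 ⬝ᵥ jetU a 1)
      + 16 * (jetU a 0 ⬝ᵥ jetU a 1) ^ 2 * jetInv a ^ 4 * (jetU a 0 ⬝ᵥ jetU a 0) := by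
    generalize hρ : jetU a 0 ⬝ᵥ jetU a 1 = ρ
    simp only [sphere₁_castSucc ha, hρ]
    conv_rhs => enter [1, 2, 2]; rw [← hρ]
    simp only [dotProduct, mul_sum, ← sum_add_distrib, ← sum_sub_distrib]
    exact sum_congr rfl fun i _ => by ring
  rw [dotProduct, Fin.sum_univ_castSucc, h1, sphere₁_last ha]
  rw [jetDen] at h
  linear_combination 16 * (jetU a 0 ⬝ᵥ jetU a 1) ^ 2 * jetInv a ^ 3 * h

lemma sum_sphere_sq (ha : a ∈ jetDomain 𝕜 m) :
    ∑ b, C (r b) * sphere a b ^ 2 = sphereQuad r a := by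
  have h := jetDen_mul_jetInv ha
  rw [jetDen, dotProduct] at h
  have h1 : ∑ i, C (r (Fin.castSucc i)) * sphere a (Fin.castSucc i) ^ 2 =
      4 * (jetInv a) ^ 2 *
        ∑ i : Fin m, C (r i.castSucc - r (Fin.last m)) * jetU a 0 i ^ 2 +
      4 * (jetInv a) ^ 2 * C (r (Fin.last m)) * ∑ i, jetU a 0 i * jetU a 0 i := by
    simp only [sphere_castSucc, mul_sum, ← sum_add_distrib, map_sub]
    exact sum_congr rfl fun i _ => by ring
  rw [Fin.sum_univ_castSucc, h1, sphere_last, sphereQuad]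
  linear_combination 4 * jetInv a * C (r (Fin.last m)) * h

lemma derivation_sphereQuad (ha : a ∈ jetDomain 𝕜 m)
    (d : Derivation 𝕜 (MvPowerSeries (JetIdx m 4) 𝕜) (MvPowerSeries (JetIdx m 4) 𝕜)) :
    d (sphereQuad r a) = 2 * ∑ b, C (r b) * sphere a b * d (sphere a b) := by
  rw [← sum_sphere_sq r ha, map_sum, mul_sum]
  refine sum_congr rfl fun b _ => ?_
  simp only [Derivation.leibniz, Derivation.leibniz_pow, derivation_C, smul_eq_mul, nsmul_eq_mul]
  push_cast
  ring

lemma jetU_dot_jetF (a : Fin m × ℕ → 𝕜) : jetU a 0 ⬝ᵥ jetF r a =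
    jetU a 0 ⬝ᵥ jetU a 3 - 6 * (jetU a 0 ⬝ᵥ jetU a 1) * jetInv a * (jetU a 0 ⬝ᵥ jetU a 2)
    + (-6 * (jetU a 0 ⬝ᵥ jetU a 2) * jetInv a
        + 24 * (jetU a 0 ⬝ᵥ jetU a 1) ^ 2 * (jetInv a) ^ 2
        - 6 * (jetU a 0 ⬝ᵥ jetU a 0) * (jetU a 1 ⬝ᵥ jetU a 1) * (jetInv a) ^ 2)
      * (jetU a 0 ⬝ᵥ jetU a 1)
    + (6 * (jetU a 1 ⬝ᵥ jetU a 2) * jetInv a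
        - 12 * (jetU a 0 ⬝ᵥ jetU a 1) * (jetU a 1 ⬝ᵥ jetU a 1) * (jetInv a) ^ 2)
      * (jetU a 0 ⬝ᵥ jetU a 0)
    + C (3 / 2) * sphereQuad r a * (jetU a 0 ⬝ᵥ jetU a 1) := by
  have h : jetF r a = jetU a 3 - (6 * (jetU a 0 ⬝ᵥ jetU a 1) * jetInv a) • jetU a 2
    + (-6 * (jetU a 0 ⬝ᵥ jetU a 2) * jetInv a
        + 24 * (jetU a 0 ⬝ᵥ jetU a 1) ^ 2 * (jetInv a) ^ 2
        - 6 * (jetU a 0 ⬝ᵥ jetU a 0) * (jetU a 1 ⬝ᵥ jetU a 1) * (jetInv a) ^ 2)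
      • (jetU a 1)
    + (6 * (jetU a 1 ⬝ᵥ jetU a 2) * jetInv a
        - 12 * (jetU a 0 ⬝ᵥ jetU a 1) * (jetU a 1 ⬝ᵥ jetU a 1) * (jetInv a) ^ 2)
      • (jetU a 0)
    + (C (3 / 2) * sphereQuad r a) • jetU a 1 := rfl
  rw [h]
  simp only [dotProduct_add, dotProduct_sub, dotProduct_smul, smul_eq_mul]

/-- The system in its original form on the sphere: $S_t$ is the total derivative of the flux plus
$\tfrac32\langle S,RS\rangle S_x$. This is the only place where the stereographic expression of the
whole right-hand side is converted. -/
lemma scalarDt_sphere (ha : a ∈ jetDomain 𝕜 m) (b : Fin (m + 1)) :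
    scalarDt r a (sphere a b) =
      scalarDx a (sphereFlux a b) + C (3 / 2) * sphereQuad r a * sphere₁ a b := by
  have h := jetDen_mul_jetInv ha
  rw [jetDen] at h
  have h2 := two_mul_C (𝕜 := 𝕜) (m := m)
  have hF := jetU_dot_jetF r a
  have hδ : scalarDt r a (jetInv a) = -2 * (jetU a 0 ⬝ᵥ jetF r a) * jetInv a ^ 2 := by
    rw [derivation_jetInv ha]
    simp only [scalarDt_jetU]
  simp only [sphereFlux, sphere₁_dot_sphere₁ ha]
  induction b using Fin.lastCases with
  | last =>
    rw [sphere₂_last ha, sphere₁_last ha, sphere_last]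
    simp only [map_sub, map_add, map_neg, Derivation.map_one_eq_zero, Derivation.leibniz,
      Derivation.leibniz_pow, smul_eq_mul, nsmul_eq_mul, scalarDx_jetInv ha, derivation_two, derivation_four,
      derivation_sixteen,
      scalarDx_dot₀₁, scalarDx_dot₀₂, scalarDx_dot₁₁, derivation_C, hδ, hF]
    -- With the scalar products replaced by independent symbols, a polynomial identity modulo
    -- $(1+\sigma)\delta=1$ and $2c=3$ is left.
    generalize sphereQuad r a = q at *
    generalize (C (3 / 2) : MvPowerSeries (JetIdx m 4) 𝕜) = c at *
    generalize jetInv a = δ at *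
    generalize jetU a 0 ⬝ᵥ jetU a 0 = σ at *
    generalize jetU a 0 ⬝ᵥ jetU a 1 = ρ at *
    generalize jetU a 0 ⬝ᵥ jetU a 2 = κ at *
    generalize jetU a 0 ⬝ᵥ jetU a 3 = ν at *
    generalize jetU a 1 ⬝ᵥ jetU a 1 = τ at *
    generalize jetU a 1 ⬝ᵥ jetU a 2 = ω at *
    clear hF hδ
    push_cast
    grind
  | cast i =>
    have hFi : jetF r a i = jetU a 3 i - 6 * (jetU a 0 ⬝ᵥ jetU a 1) * jetInv a * jetU a 2 i
      + (-6 * (jetU a 0 ⬝ᵥ jetU a 2) * jetInv a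
        + 24 * (jetU a 0 ⬝ᵥ jetU a 1) ^ 2 * (jetInv a) ^ 2
        - 6 * (jetU a 0 ⬝ᵥ jetU a 0) * (jetU a 1 ⬝ᵥ jetU a 1) * (jetInv a) ^ 2) * jetU a 1 i
      + (6 * (jetU a 1 ⬝ᵥ jetU a 2) * jetInv a
        - 12 * (jetU a 0 ⬝ᵥ jetU a 1) * (jetU a 1 ⬝ᵥ jetU a 1) * (jetInv a) ^ 2) * jetU a 0 i
      + C (3 / 2) * sphereQuad r a * jetU a 1 i := rfl
    rw [sphere₂_castSucc ha, sphere₁_castSucc ha, sphere_castSucc]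
    simp only [map_sub, map_add, Derivation.leibniz,
      Derivation.leibniz_pow, smul_eq_mul, nsmul_eq_mul, scalarDx_jetInv ha, derivation_two, derivation_four,
      derivation_eight, derivation_sixteen,
      scalarDx_dot₀₁, scalarDx_dot₀₂, scalarDx_dot₁₁, derivation_C, hδ, hF, scalarDt_jetU, hFi,
      scalarDx_jetU₀, scalarDx_jetU₁, scalarDx_jetU₂]
    generalize sphereQuad r a = q at *
    generalize (C (3 / 2) : MvPowerSeries (JetIdx m 4) 𝕜) = c at *
    generalize jetInv a = δ at *
    generalize jetU a 0 ⬝ᵥ jetU a 0 = σ at *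
    generalize jetU a 0 ⬝ᵥ jetU a 1 = ρ at *
    generalize jetU a 0 ⬝ᵥ jetU a 2 = κ at *
    generalize jetU a 0 ⬝ᵥ jetU a 3 = ν at *
    generalize jetU a 1 ⬝ᵥ jetU a 1 = τ at *
    generalize jetU a 1 ⬝ᵥ jetU a 2 = ω at *
    clear hF hδ hFi
    push_cast
    grind

end Sphere

/-! ### The zero-curvature representation with values in `hAlgebra r` -/

section Existence

open Finset MvPowerSeries LieSeries

variable {𝕜 : Type*} [RCLike 𝕜] {L : Type*} [LieRing L] [LieAlgebra 𝕜 L]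

/-- All relations of $\mathfrak g(n)$ in one formula, including coinciding indices, with the
elements $p_k\lambda$ as new quantities. This is the form that extends trilinearly to combinations
with power series coefficients. -/
lemma GRel.lie_lie_eq {n : ℕ} {r : Fin n → 𝕜} {p : Fin n → L} (h : GRel r p) (hn : 3 ≤ n)
    {o : Fin n → Fin n} (ho : ∀ k, o k ≠ k) (b c d : Fin n) :
    ⁅p b, ⁅p c, p d⁆⁆ = (if b = c then gTower o r p 1 d - r b • p d else 0) -
      (if b = d then gTower o r p 1 c - r b • p c else 0) := by
  have hn' := fun i j => Fin.exists_ne_and_ne hn i j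
  have H := h.towerRel ho hn' 0
  have key (i k : Fin n) (hik : i ≠ k) : ⁅p i, ⁅p i, p k⁆⁆ = gTower o r p 1 k - r i • p k := by
    exact H.lie_lie 0 0 le_rfl i k hik
  by_cases hcd : c = d
  · subst hcd
    simp
  by_cases hbc : b = c
  · subst hbc
    simp [hcd, key b d hcd]
  by_cases hbd : b = d
  · subst hbd
    rw [if_neg hbc, if_pos rfl, zero_sub, ← key b c hbc, ← lie_skew (p c) (p b), lie_neg]
  · rw [if_neg hbc, if_neg hbd, h.distinct b c d hbc hcd (Ne.symm hbd), sub_zero]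

lemma LieSeries.comb_lie_comb_lie_comb {σ : Type*} [DecidableEq σ] {n : ℕ} {r : Fin n → 𝕜}
    {p p' : Fin n → L}
    (h : ∀ b c d, ⁅p b, ⁅p c, p d⁆⁆ = (if b = c then p' d - r b • p d else 0) -
      (if b = d then p' c - r b • p c else 0)) (f g k : Fin n → MvPowerSeries σ 𝕜) :
    ⁅comb f p, ⁅comb g p, comb k p⁆⁆ =
      (∑ b, f b * g b) • comb k p' - (∑ b, C (r b) * f b * g b) • comb k p -
      ((∑ b, f b * k b) • comb g p' - (∑ b, C (r b) * f b * k b) • comb g p) := by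
  have h1 (b c : Fin n) : ⁅const σ L (p b), ⁅const σ L (p c), comb k p⁆⁆ =
      (if b = c then comb k p' - (C (r b) : MvPowerSeries σ 𝕜) • comb k p else 0) -
        k b • (const σ L (p' c) - (C (r b) : MvPowerSeries σ 𝕜) • const σ L (p c)) := by
    have h2 (d : Fin n) : ⁅const σ L (p b), ⁅const σ L (p c), k d • const σ L (p d)⁆⁆ =
        (if b = c then k d • const σ L (p' d) -
          (C (r b) : MvPowerSeries σ 𝕜) • k d • const σ L (p d) else 0) -
        (if b = d then k d • (const σ L (p' c) - (C (r b) : MvPowerSeries σ 𝕜) • const σ L (p c))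
          else 0) := by
      rw [lie_smul, lie_smul, ← const_lie, ← const_lie, h]
      split_ifs <;> simp only [map_sub, map_zero, sub_zero, zero_sub, const_smul, smul_sub, smul_neg,
        smul_zero, smul_comm (k d), map_neg]
    simp only [comb, lie_sum, h2, sum_sub_distrib, sum_ite_eq, mem_univ, if_true, smul_sum]
    split_ifs <;> simp only [sum_sub_distrib, sum_const_zero]
  rw [comb_def f, sum_lie]
  simp only [comb_def g, sum_lie, smul_lie, lie_sum, lie_smul, h1]
  simp only [smul_sub, sum_sub_distrib, smul_ite, smul_zero, sum_ite_eq, mem_univ, if_true]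
  simp only [smul_sum, comb, smul_smul, sum_mul, sum_smul]
  refine congrArg₂ (· - ·) (congrArg₂ (· - ·) ?_ ?_) (congrArg₂ (· - ·) ?_ ?_) <;>
  · rw [sum_comm]
    exact sum_congr rfl fun x _ => sum_congr rfl fun y _ => congrArg (· • _) (by ring)

variable {m : ℕ} {r : Fin (m + 1) → 𝕜} {a : Fin m × ℕ → 𝕜} {q₀ q₁ : L} {p : Fin (m + 1) → L}

/-- The `x`-part `p_0 + ∑ S^i p_i` of the zero-curvature representation. -/
def zcrA (a : Fin m × ℕ → 𝕜) (q₀ : L) (p : Fin (m + 1) → L) : LieSeries (JetIdx m 4) L :=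
  const _ L q₀ + comb (sphere a) p

/-- The `t`-part of the zero-curvature representation. -/
def zcrB (r : Fin (m + 1) → 𝕜) (a : Fin m × ℕ → 𝕜) (q₁ : L) (p p' : Fin (m + 1) → L) :
    LieSeries (JetIdx m 4) L :=
  comb (sphereFlux a) p - ⁅comb (sphere a) p, comb (sphere₁ a) p⁆ + comb (sphere a) p' +
    (C (1 / 2) * sphereQuad r a) • comb (sphere a) p + const _ L q₁

lemma LieSeries.const_lie_comb {σ ι : Type*} [DecidableEq σ] [Fintype ι] (q : L)
    (f : ι → MvPowerSeries σ 𝕜) (p : ι → L) :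
    ⁅const σ L q, comb f p⁆ = comb f fun b => ⁅q, p b⁆ := by
  simp only [comb, lie_sum, lie_smul, const_lie]

lemma LieSeries.const_lie_comb_eq_zero {σ ι : Type*} [DecidableEq σ] [Fintype ι] {q : L}
    {p : ι → L} (h : ∀ b, ⁅q, p b⁆ = 0) (f : ι → MvPowerSeries σ 𝕜) :
    ⁅const σ L q, comb f p⁆ = 0 := by
  rw [const_lie_comb]
  simp only [h, comb, map_zero, smul_zero, sum_const_zero]

/-- The symmetric coefficients $f_bf_c$ are contracted with brackets that are skew in $b,c$. It is
applied to $p'_b=p_b\lambda$. -/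
lemma LieSeries.comb_lie_comb_eq_zero {σ : Type*} [DecidableEq σ] {n : ℕ} {p p' : Fin n → L}
    (hs : ∀ b c, b ≠ c → ⁅p b, p' c⁆ + ⁅p c, p' b⁆ = 0) (h0 : ∀ b, ⁅p b, p' b⁆ = 0)
    (f : Fin n → MvPowerSeries σ 𝕜) : ⁅comb f p, comb f p'⁆ = 0 := by
  have h (b c : Fin n) : ⁅p b, p' c⁆ + ⁅p c, p' b⁆ = 0 := by
    by_cases hbc : b = c
    · subst hbc
      rw [h0, add_zero]
    · exact hs b c hbc
  have h2 : ⁅comb f p, comb f p'⁆ + ⁅comb f p, comb f p'⁆ = 0 := by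
    rw [lie_comb]
    conv_lhs => enter [2]; rw [sum_comm]
    rw [← sum_add_distrib, sum_eq_zero]
    intro b _
    rw [← sum_add_distrib, sum_eq_zero]
    intro c _
    rw [mul_comm (f c), ← smul_add, ← map_add, h, map_zero, smul_zero]
  funext γ
  have h3 := congrFun h2 γ
  change (⁅comb f p, comb f p'⁆ : LieSeries σ L) γ + (⁅comb f p, comb f p'⁆ : LieSeries σ L) γ = 0 at h3
  change (⁅comb f p, comb f p'⁆ : LieSeries σ L) γ = 0
  rw [← two_smul 𝕜] at h3
  exact (smul_eq_zero.1 h3).resolve_left two_ne_zero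

lemma C_half_mul_two {σ : Type*} : (C (1 / 2) : MvPowerSeries σ 𝕜) * 2 = 1 := by
  rw [← map_ofNat (C (σ := σ) (R := 𝕜)) 2, ← map_mul, ← map_one (C (σ := σ) (R := 𝕜))]
  congr 1
  norm_num

lemma pderiv_sphere (s : JetIdx m 4) (hs : s.2 ≠ 0) (ha : a ∈ jetDomain 𝕜 m) (b : Fin (m + 1)) :
    MvPowerSeries.pderiv 𝕜 s (sphere a b) = 0 := by
  obtain ⟨i, k⟩ := s
  induction b using Fin.lastCases with
  | last =>
    rw [sphere_last, map_sub, Derivation.leibniz, pderiv_jetInv_ne ha i hs,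
      Derivation.map_one_eq_zero, derivation_two]
    simp
  | cast j =>
    rw [sphere_castSucc]
    simp only [Derivation.leibniz, pderiv_jetInv_ne ha i hs, derivation_two, smul_zero,
      pderiv_jetU_ne a i hs, add_zero]

lemma pderiv_sphere₁_succ (ha : a ∈ jetDomain 𝕜 m) (i : Fin m) (k : Fin 3) (b : Fin (m + 1)) :
    MvPowerSeries.pderiv 𝕜 (i, k.succ) (sphere₁ a b) =
      MvPowerSeries.pderiv 𝕜 (i, k.castSucc) (sphere a b) := by
  rw [sphere₁, pderiv_scalarDx_succ, pderiv_sphere (i, k.succ) (Fin.succ_ne_zero k) ha, map_zero,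
    add_zero]

lemma pderiv_sphere₁_one (ha : a ∈ jetDomain 𝕜 m) (i : Fin m) (b : Fin (m + 1)) :
    MvPowerSeries.pderiv 𝕜 (i, 1) (sphere₁ a b) = MvPowerSeries.pderiv 𝕜 (i, 0) (sphere a b) :=
  pderiv_sphere₁_succ ha i 0 b

lemma pderiv_sphere₁_two (ha : a ∈ jetDomain 𝕜 m) (i : Fin m) (b : Fin (m + 1)) :
    MvPowerSeries.pderiv 𝕜 (i, 2) (sphere₁ a b) = 0 :=
  (pderiv_sphere₁_succ ha i 1 b).trans (pderiv_sphere _ (by simp) ha b)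

lemma pderiv_sphere₁_three (ha : a ∈ jetDomain 𝕜 m) (i : Fin m) (b : Fin (m + 1)) :
    MvPowerSeries.pderiv 𝕜 (i, 3) (sphere₁ a b) = 0 :=
  (pderiv_sphere₁_succ ha i 2 b).trans (pderiv_sphere _ (by simp) ha b)

lemma pderiv_sphere₂_two (ha : a ∈ jetDomain 𝕜 m) (i : Fin m) (b : Fin (m + 1)) :
    MvPowerSeries.pderiv 𝕜 (i, 2) (sphere₂ a b) = MvPowerSeries.pderiv 𝕜 (i, 0) (sphere a b) := by
  rw [sphere₂]
  refine (pderiv_scalarDx_succ a i 1 _).trans ?_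
  change MvPowerSeries.pderiv 𝕜 (i, 1) _ + scalarDx a (MvPowerSeries.pderiv 𝕜 (i, 2) _) = _
  rw [pderiv_sphere₁_two ha, map_zero, add_zero, pderiv_sphere₁_one ha]

lemma pderiv_sphere₂_one (ha : a ∈ jetDomain 𝕜 m) (i : Fin m) (b : Fin (m + 1)) :
    MvPowerSeries.pderiv 𝕜 (i, 1) (sphere₂ a b) =
      2 * scalarDx a (MvPowerSeries.pderiv 𝕜 (i, 0) (sphere a b)) := by
  rw [sphere₂]
  refine (pderiv_scalarDx_succ a i 0 _).trans ?_
  change MvPowerSeries.pderiv 𝕜 (i, 0) _ + scalarDx a (MvPowerSeries.pderiv 𝕜 (i, 1) _) = _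
  rw [pderiv_sphere₁_one ha, sphere₁, pderiv_scalarDx_zero, two_mul]

lemma pderiv_sphere₂_three (ha : a ∈ jetDomain 𝕜 m) (i : Fin m) (b : Fin (m + 1)) :
    MvPowerSeries.pderiv 𝕜 (i, 3) (sphere₂ a b) = 0 := by
  rw [sphere₂]
  refine (pderiv_scalarDx_succ a i 2 _).trans ?_
  change MvPowerSeries.pderiv 𝕜 (i, 2) _ + scalarDx a (MvPowerSeries.pderiv 𝕜 (i, 3) _) = _
  rw [pderiv_sphere₁_two ha, pderiv_sphere₁_three ha, map_zero, add_zero]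

lemma pderiv_sphere₁_dot_ne (ha : a ∈ jetDomain 𝕜 m) (i : Fin m) {k : Fin 4} (h0 : k ≠ 0)
    (h1 : k ≠ 1) : MvPowerSeries.pderiv 𝕜 (i, k) (sphere₁ a ⬝ᵥ sphere₁ a) = 0 := by
  rw [sphere₁_dot_sphere₁ ha]
  simp only [Derivation.leibniz, Derivation.leibniz_pow, derivation_four, pderiv_jetInv_ne ha i h0,
    pderiv_dot_ne a i h1 h1, smul_zero, add_zero]

lemma pderiv_sphereQuad_ne (ha : a ∈ jetDomain 𝕜 m) (i : Fin m) {k : Fin 4} (h0 : k ≠ 0) :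
    MvPowerSeries.pderiv 𝕜 (i, k) (sphereQuad r a) = 0 := by
  rw [derivation_sphereQuad r ha]
  simp only [pderiv_sphere (i, k) h0 ha, mul_zero, sum_const_zero]

/-- The zero-curvature representation defined by elements with the relations of `hAlgebra r`. -/
theorem HRel.isZCR (h : HRel r q₀ q₁ p) (hm : 3 ≤ m + 1) {o : Fin (m + 1) → Fin (m + 1)}
    (ho : ∀ k, o k ≠ k) (ha : a ∈ jetDomain 𝕜 m) :
    IsZCR r a (zcrA a q₀ p) (zcrB r a q₁ p (gTower o r p 1)) := by
  have hn' := fun i j => Fin.exists_ne_and_ne hm i j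
  have H := h.gRel.towerRel ho hn' 1
  have hs : ⁅comb (sphere a) p, comb (sphere a) (gTower o r p 1)⁆ = 0 := by
    refine comb_lie_comb_eq_zero (fun b c hbc => ?_) (fun b => ?_) _
    · have h1 := H.skew' (s := 1) le_rfl hbc
      change ⁅p c, _⁆ = -⁅p b, _⁆ at h1
      rw [h1, add_neg_cancel]
    · exact H.lie_same 0 1 le_rfl b
  have hA {k : Fin 4} (hk : k ≠ 0) (i : Fin m) (v : Fin (m + 1) → L) :
      pd L (i, k) (comb (sphere a) v) = 0 := by
    simp only [pd_comb, pderiv_sphere (i, k) hk ha, comb_zero]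
  -- The element `q₀` commutes with the $p_b$, hence with the $p_b\lambda$ built from them by
  -- brackets, and with `q₁`.
  have hcomm : ⁅const (JetIdx m 4) L q₀, zcrB r a q₁ p (gTower o r p 1)⁆ = 0 := by
    have h1 (f : Fin (m + 1) → MvPowerSeries (JetIdx m 4) 𝕜) :
        ⁅const (JetIdx m 4) L q₀, comb f p⁆ = 0 :=
      const_lie_comb_eq_zero h.lie_p₀ f
    have h2 : ∀ b, ⁅q₀, gTower o r p 1 b⁆ = 0 := by
      intro b
      change ⁅q₀, ⁅p (o b), ⁅p (o b), p b⁆⁆ + r (o b) • p b⁆ = 0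
      simp only [lie_add, lie_smul, leibniz_lie q₀, h.lie_p₀, zero_lie, lie_zero, smul_zero,
        add_zero]
    simp only [zcrB, lie_add, lie_sub, lie_smul, leibniz_lie (const (JetIdx m 4) L q₀), h1, zero_lie, lie_zero,
      const_lie_comb_eq_zero h2, ← const_lie, h.lie_q, map_zero, smul_zero, add_zero, sub_zero]
  constructor
  · intro k hk i
    rw [zcrA, map_add, pd_const, hA hk, add_zero]
  · intro i
    have hk : (3 : Fin 4) ≠ 0 := by decide
    have h1 (b) : MvPowerSeries.pderiv 𝕜 (i, 3) (sphereFlux a b) = 0 := by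
      rw [sphereFlux, map_add, pderiv_sphere₂_three ha, Derivation.leibniz, Derivation.leibniz,
        pderiv_sphere₁_dot_ne ha i hk (by decide), pderiv_sphere (i, 3) hk ha, derivation_C]
      simp
    simp only [zcrB, map_add, map_sub, pd_lie, pd_smul, hA hk, pd_const]
    simp only [pd_comb, h1, pderiv_sphere₁_three ha, comb_zero, Derivation.leibniz,
      pderiv_sphereQuad_ne ha i hk, derivation_C]
    simp
  · have hq₁ : ⁅comb (sphere a) p, const (JetIdx m 4) L q₁⁆ = 0 := by
      rw [← lie_skew, const_lie_comb_eq_zero h.lie_p₁, neg_zero]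
    have hDxB : Dx L a (zcrB r a q₁ p (gTower o r p 1)) =
        comb (fun b => scalarDx a (sphereFlux a b)) p -
          ⁅comb (sphere a) p, comb (sphere₂ a) p⁆ + comb (sphere₁ a) (gTower o r p 1) +
          ((C (1 / 2) * scalarDx a (sphereQuad r a)) • comb (sphere a) p +
          (C (1 / 2) * sphereQuad r a) • comb (sphere₁ a) p) := by
      simp only [zcrB, map_add, map_sub, Dx_lie, Dx_smul, Dx_comb, Dx_const, Derivation.leibniz,
        derivation_C, mul_zero, add_zero, smul_eq_mul]
      change _ - (⁅comb (sphere₁ a) p, comb (sphere₁ a) p⁆ + ⁅comb (sphere a) p, comb (sphere₂ a) p⁆)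
        + comb (sphere₁ a) (gTower o r p 1) + (_ + _ • comb (sphere₁ a) p) = _
      rw [lie_self, zero_add]
    have hDtA : Dt L r a (zcrA a q₀ p) = comb (fun b => scalarDx a (sphereFlux a b)) p +
        (C (3 / 2) * sphereQuad r a) • comb (sphere₁ a) p := by
      simp only [zcrA, map_add, Dt_const, Dt_comb, scalarDt_sphere r ha, comb_add, comb_mul, zero_add]
    have hflux : comb (sphereFlux a) p = comb (sphere₂ a) p +
        (C (3 / 2) * (sphere₁ a ⬝ᵥ sphere₁ a)) • comb (sphere a) p := by
      rw [← comb_mul, ← comb_add]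
      rfl
    have hlie : ⁅zcrA a q₀ p, zcrB r a q₁ p (gTower o r p 1)⁆ =
        ⁅comb (sphere a) p, comb (sphere₂ a) p⁆ -
          ⁅comb (sphere a) p, ⁅comb (sphere a) p, comb (sphere₁ a) p⁆⁆ := by
      rw [zcrA, add_lie, hcomm, zero_add]
      simp only [zcrB, lie_add, lie_sub, lie_smul, hq₁, hs, lie_self, smul_zero, add_zero, hflux]
    -- For $S=\sum S^bp_b$ and $S_x=\sum S^b_xp_b$, the relations $\langle S,S\rangle=1$ and
    -- $\langle S,S_x\rangle=0$ give $[S,[S,S_x]]=\sum S^b_xp_b\lambda-\langle S,RS\rangle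
    -- S_x+\langle RS,S_x\rangle S$. This cancels the remaining terms of $D_xB-D_tA$, since
    -- $\tfrac32=\tfrac12+1$.
    have hT := comb_lie_comb_lie_comb (h.gRel.lie_lie_eq hm ho) (sphere a) (sphere a) (sphere₁ a)
    have e1 : ∑ b, sphere a b * sphere a b = 1 := sphere_dot_sphere ha
    have e2 : ∑ b, C (r b) * sphere a b * sphere a b = sphereQuad r a := by
      rw [← sum_sphere_sq r ha]
      exact sum_congr rfl fun b _ => by ring
    have e3 : ∑ b, sphere a b * sphere₁ a b = 0 := sphere_dot_sphere₁ ha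
    have e4 : C (1 / 2) * scalarDx a (sphereQuad r a) = ∑ b, C (r b) * sphere a b * sphere₁ a b := by
      rw [derivation_sphereQuad r ha, ← mul_assoc, C_half_mul_two, one_mul]
      rfl
    rw [hDxB, hDtA, hlie, hT, e1, e2, e3, e4]
    have e5 : (C (3 / 2) : MvPowerSeries (JetIdx m 4) 𝕜) = C (1 / 2) + 1 := by
      rw [← map_one (C (σ := JetIdx m 4) (R := 𝕜)), ← map_add]
      congr 1
      norm_num
    rw [e5]
    simp only [add_mul, add_smul, one_mul, one_smul, zero_smul]
    abel

end Existence

/-! ### Evaluation of polynomial identities and linear independence -/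

section Evaluation

open Finset MvPowerSeries LieSeries

variable {𝕜 : Type*} [RCLike 𝕜] {m : ℕ} {L : Type*} [LieRing L] [LieAlgebra 𝕜 L]

lemma isUnit_C_of_ne_zero {σ : Type*} {t : 𝕜} (ht : t ≠ 0) :
    IsUnit (C t : MvPowerSeries σ 𝕜) := (IsUnit.mk0 t ht).map C

lemma isUnit_ofNat_series {σ : Type*} (n : ℕ) [n.AtLeastTwo] :
    IsUnit (OfNat.ofNat n : MvPowerSeries σ 𝕜) := by
  rw [← map_ofNat (C (σ := σ) (R := 𝕜)) n]
  exact isUnit_C_of_ne_zero (OfNat.ofNat_ne_zero n)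

variable {a : Fin m × ℕ → 𝕜}

lemma isUnit_jetInv (ha : a ∈ jetDomain 𝕜 m) : IsUnit (jetInv a) :=
  IsUnit.of_mul_eq_one _ ((mul_comm _ _).trans (jetDen_mul_jetInv ha))

lemma LieSeries.exists_eq_const (𝕜 : Type*) [RCLike 𝕜] {L : Type*} [LieRing L] [LieAlgebra 𝕜 L]
    {m : ℕ} {c : LieSeries (JetIdx m 4) L} (h0 : ∀ i, pd L (i, 0) c = 0)
    (hk : ∀ k ≠ 0, ∀ i, pd L (i, k) c = 0) : ∃ x, c = const _ L x := by
  refine ⟨c 0, eq_const_of_pd_eq_zero (𝕜 := 𝕜) c fun s => ?_⟩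
  obtain ⟨i, k⟩ := s
  by_cases h : k = 0
  · rw [h, h0]
  · exact hk k h i

/-- Polynomials in the coordinates `u^i` as power series. -/
def polyJet (a : Fin m × ℕ → 𝕜) : MvPolynomial (Fin m) 𝕜 →ₐ[𝕜] MvPowerSeries (JetIdx m 4) 𝕜 :=
  MvPolynomial.aeval (jetU a 0)

lemma polyJet_X (a : Fin m × ℕ → 𝕜) (i : Fin m) : polyJet a (MvPolynomial.X i) = jetU a 0 i :=
  MvPolynomial.aeval_X _ _

/-- The substitution $u=a+X$ has a left inverse on polynomials, and polynomials embed into power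
series. -/
lemma polyJet_injective (a : Fin m × ℕ → 𝕜) : Function.Injective (polyJet a) := by
  let g : MvPolynomial (Fin m) 𝕜 →ₐ[𝕜] MvPolynomial (JetIdx m 4) 𝕜 :=
    MvPolynomial.aeval fun i => MvPolynomial.C (a (i, 0)) + MvPolynomial.X (i, 0)
  let g' : MvPolynomial (JetIdx m 4) 𝕜 →ₐ[𝕜] MvPolynomial (Fin m) 𝕜 :=
    MvPolynomial.aeval fun s => MvPolynomial.X s.1 - MvPolynomial.C (a (s.1, 0))
  have h1 : g'.comp g = AlgHom.id 𝕜 _ := by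
    ext1 i
    simp [g, g']
  have h2 : polyJet a = (MvPolynomial.coeToMvPowerSeries.algHom 𝕜).comp g := by
    ext1 i
    rw [polyJet_X, AlgHom.comp_apply]
    simp [g, jetU]
  have h3 : Function.Injective g := fun x y h => by
    rw [← AlgHom.id_apply (R := 𝕜) x, ← h1, AlgHom.comp_apply, h, ← AlgHom.comp_apply, h1,
      AlgHom.id_apply]
  rw [h2]
  intro x y h
  apply h3
  simpa using h

lemma LieSeries.smul_const_apply {σ : Type*} [DecidableEq σ] (f : MvPowerSeries σ 𝕜) (x : L)
    (γ : σ →₀ ℕ) : (f • const σ L x) γ = MvPowerSeries.coeff γ f • x := by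
  change ∑ p ∈ HasAntidiagonal.antidiagonal γ,
    MvPowerSeries.coeff p.1 f • (if p.2 = 0 then x else 0) = _
  rw [sum_eq_single (γ, 0)]
  · simp
  · rintro ⟨α, β⟩ h hne
    rw [HasAntidiagonal.mem_antidiagonal] at h
    rw [if_neg, smul_zero]
    rintro rfl
    exact hne (Prod.ext (by simpa using h) rfl)
  · simp

/-- An identity of power series at `a` with polynomial coefficients may be evaluated at any point
`y`, near `a` or not. Linear functionals on `L` reduce this to the scalar case. -/
lemma LieSeries.sum_eval_smul_eq_zero {ι : Type*} [Fintype ι] {P : ι → MvPolynomial (Fin m) 𝕜}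
    {x : ι → L} (h : comb (fun b => polyJet a (P b)) x = 0) (y : Fin m → 𝕜) :
    ∑ b, MvPolynomial.eval y (P b) • x b = 0 := by
  rw [← Module.forall_dual_apply_eq_zero_iff 𝕜]
  intro φ
  have h1 : polyJet a (∑ b, MvPolynomial.C (φ (x b)) * P b) = 0 := by
    ext γ
    have h2 := congrArg φ (congrFun h γ)
    have h3 : (comb (fun b => polyJet a (P b)) x) γ =
        ∑ b, MvPowerSeries.coeff γ (polyJet a (P b)) • x b := by
      let ev : LieSeries (JetIdx m 4) L →+ L := ⟨⟨fun c => c γ, rfl⟩, fun _ _ => rfl⟩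
      exact (map_sum ev _ _).trans (sum_congr rfl fun b _ => smul_const_apply _ _ _)
    rw [h3, map_sum] at h2
    rw [map_sum, map_sum, map_zero]
    refine Eq.trans (sum_congr rfl fun b _ => ?_) (h2.trans (map_zero φ))
    rw [map_mul, ← MvPolynomial.algebraMap_eq, AlgHom.commutes, _root_.map_smul, smul_eq_mul,
      mul_comm]
    exact coeff_mul_C _ _ _
  have h4 := (map_eq_zero_iff _ (polyJet_injective a)).1 h1
  have h5 := congrArg (MvPolynomial.eval y) h4
  simpa [mul_comm] using h5

/-- The polynomials `Δ S`. -/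
def spherePoly : Fin (m + 1) → MvPolynomial (Fin m) 𝕜 :=
  Fin.snoc (α := fun _ => MvPolynomial (Fin m) 𝕜)
    (fun i => 2 * MvPolynomial.X i) (1 - MvPolynomial.X ⬝ᵥ MvPolynomial.X)

lemma polyJet_dot (a : Fin m × ℕ → 𝕜) :
    polyJet a (MvPolynomial.X ⬝ᵥ MvPolynomial.X) = jetU a 0 ⬝ᵥ jetU a 0 := by
  simp only [dotProduct, map_sum, map_mul, polyJet_X]

lemma polyJet_spherePoly (ha : a ∈ jetDomain 𝕜 m) (b : Fin (m + 1)) :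
    polyJet a (spherePoly b) = jetDen a * sphere a b := by
  have h := jetDen_mul_jetInv ha
  induction b using Fin.lastCases with
  | last =>
    rw [spherePoly, Fin.snoc_last, map_sub, map_one, polyJet_dot, sphere_last]
    rw [jetDen] at h ⊢
    linear_combination -2 * h
  | cast i =>
    rw [spherePoly, Fin.snoc_castSucc, map_mul, polyJet_X, sphere_castSucc, map_ofNat]
    linear_combination -2 * jetU a 0 i * h

/-- Linear independence of $1,S^1,\dots,S^n$: multiplication by $\Delta$ makes the coefficients
polynomial, and the points $0$ and $\pm e_i$ suffice. -/
lemma LieSeries.const_add_comb_sphere_eq_zero (hm : 1 ≤ m) (ha : a ∈ jetDomain 𝕜 m) {x₀ : L}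
    {x : Fin (m + 1) → L} (h : const _ L x₀ + comb (sphere a) x = 0) : x₀ = 0 ∧ ∀ b, x b = 0 := by
  let P : Option (Fin (m + 1)) → MvPolynomial (Fin m) 𝕜 :=
    fun o => o.elim (1 + MvPolynomial.X ⬝ᵥ MvPolynomial.X) spherePoly
  let x' : Option (Fin (m + 1)) → L := fun o => o.elim x₀ x
  have h1 : comb (fun b => polyJet a (P b)) x' = 0 := by
    rw [comb, Fintype.sum_option]
    have h2 := congrArg (jetDen a • ·) h
    simp only [smul_zero, smul_add, ← comb_mul, ← polyJet_spherePoly ha] at h2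
    simp only [P, x', Option.elim, map_add, map_one, polyJet_dot]
    exact h2
  have h2 (y : Fin m → 𝕜) : (1 + y ⬝ᵥ y) • x₀ + (∑ i, (2 * y i) • x (Fin.castSucc i) +
      (1 - y ⬝ᵥ y) • x (Fin.last m)) = 0 := by
    have h3 := sum_eval_smul_eq_zero h1 y
    rw [Fintype.sum_option, Fin.sum_univ_castSucc] at h3
    simpa [P, x', spherePoly, dotProduct] using h3
  have e0 : x₀ + x (Fin.last m) = 0 := by simpa using h2 0
  have e1 (i : Fin m) : (2 : 𝕜) • x₀ + (2 : 𝕜) • x i.castSucc = 0 := by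
    have := h2 (Pi.single i 1)
    simp [Pi.single_apply, ite_smul] at this
    convert this using 2
    norm_num
  have e2 (i : Fin m) : (2 : 𝕜) • x₀ - (2 : 𝕜) • x i.castSucc = 0 := by
    have := h2 (Pi.single i (-1))
    simp [Pi.single_apply, ite_smul] at this
    rw [sub_eq_add_neg]
    convert this using 2
    norm_num
  have f0 : x₀ = 0 := by
    have h4 : (4 : 𝕜) • x₀ = 0 := by
      have h5 := congrArg₂ (· + ·) (e1 ⟨0, hm⟩) (e2 ⟨0, hm⟩)
      simp only [add_zero, add_add_sub_cancel, ← add_smul] at h5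
      convert h5 using 2
      norm_num
    exact (smul_eq_zero.1 h4).resolve_left (by norm_num)
  refine ⟨f0, fun b => ?_⟩
  induction b using Fin.lastCases with
  | last => rwa [f0, zero_add] at e0
  | cast i =>
    have := e1 i
    rw [f0, smul_zero, zero_add] at this
    exact (smul_eq_zero.1 this).resolve_left two_ne_zero

end Evaluation

/-! ### Consequences of the zero-curvature equation: the highest derivatives -/

section JetFDerivatives

open Finset MvPowerSeries LieSeries

variable {𝕜 : Type*} [RCLike 𝕜] {m : ℕ} {a : Fin m × ℕ → 𝕜} (r : Fin (m + 1) → 𝕜)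

lemma jetF_eq (a : Fin m × ℕ → 𝕜) (l : Fin m) : jetF r a l =
    jetU a 3 l - 6 * (jetU a 0 ⬝ᵥ jetU a 1) * jetInv a * jetU a 2 l
      + (-6 * (jetU a 0 ⬝ᵥ jetU a 2) * jetInv a
        + 24 * (jetU a 0 ⬝ᵥ jetU a 1) ^ 2 * (jetInv a) ^ 2
        - 6 * (jetU a 0 ⬝ᵥ jetU a 0) * (jetU a 1 ⬝ᵥ jetU a 1) * (jetInv a) ^ 2) * jetU a 1 l
      + (6 * (jetU a 1 ⬝ᵥ jetU a 2) * jetInv a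
        - 12 * (jetU a 0 ⬝ᵥ jetU a 1) * (jetU a 1 ⬝ᵥ jetU a 1) * (jetInv a) ^ 2) * jetU a 0 l
      + C (3 / 2) * sphereQuad r a * jetU a 1 l := rfl

lemma derivation_twentyFour {σ : Type*}
    (d : Derivation 𝕜 (MvPowerSeries σ 𝕜) (MvPowerSeries σ 𝕜)) :
    d 24 = 0 := mod_cast d.map_natCast 24

lemma derivation_twelve {σ : Type*}
    (d : Derivation 𝕜 (MvPowerSeries σ 𝕜) (MvPowerSeries σ 𝕜)) :
    d 12 = 0 := mod_cast d.map_natCast 12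

lemma derivation_fortyEight {σ : Type*}
    (d : Derivation 𝕜 (MvPowerSeries σ 𝕜) (MvPowerSeries σ 𝕜)) :
    d 48 = 0 := mod_cast d.map_natCast 48

lemma pderiv_jetF_three (ha : a ∈ jetDomain 𝕜 m) (i l : Fin m) :
    MvPowerSeries.pderiv 𝕜 (i, 3) (jetF r a l) = kron i l := by
  have h0 : (3 : Fin 4) ≠ 0 := by decide
  have h1 : (3 : Fin 4) ≠ 1 := by decide
  have h2 : (3 : Fin 4) ≠ 2 := by decide
  simp only [jetF_eq, map_add, map_sub, map_neg, Derivation.leibniz, Derivation.leibniz_pow,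
    smul_eq_mul, nsmul_eq_mul, derivation_C, derivation_six, derivation_twentyFour,
    derivation_twelve, pderiv_jetU', pderiv_jetU_ne a i h0, pderiv_jetU_ne a i h1,
    pderiv_jetU_ne a i h2, pderiv_dot_ne a i h0 h0, pderiv_dot_ne a i h0 h1,
    pderiv_dot_ne a i h0 h2, pderiv_dot_ne a i h1 h1, pderiv_dot_ne a i h1 h2,
    pderiv_jetInv_ne ha i h0, pderiv_sphereQuad_ne ha i h0]
  ring

lemma pderiv_jetF_two (ha : a ∈ jetDomain 𝕜 m) (i l : Fin m) :
    MvPowerSeries.pderiv 𝕜 (i, 2) (jetF r a l) =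
      -6 * (jetU a 0 ⬝ᵥ jetU a 1) * jetInv a * kron i l - 6 * jetU a 0 i * jetInv a * jetU a 1 l
        + 6 * jetU a 1 i * jetInv a * jetU a 0 l := by
  have h0 : (2 : Fin 4) ≠ 0 := by decide
  have h1 : (2 : Fin 4) ≠ 1 := by decide
  have h2 : (2 : Fin 4) ≠ 3 := by decide
  simp only [jetF_eq, map_add, map_sub, map_neg, Derivation.leibniz, Derivation.leibniz_pow,
    smul_eq_mul, nsmul_eq_mul, derivation_C, derivation_six, derivation_twentyFour,
    derivation_twelve, pderiv_jetU', pderiv_jetU_ne a i h0, pderiv_jetU_ne a i h1,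
    pderiv_jetU_ne a i h2, pderiv_dot_ne a i h0 h0, pderiv_dot_ne a i h0 h1,
    pderiv_dot_right a i h0, pderiv_dot_ne a i h1 h1, pderiv_dot_right a i h1,
    pderiv_jetInv_ne ha i h0, pderiv_sphereQuad_ne ha i h0]
  ring

lemma pderiv_jetF_two_one (ha : a ∈ jetDomain 𝕜 m) (i j l : Fin m) :
    MvPowerSeries.pderiv 𝕜 (j, 1) (MvPowerSeries.pderiv 𝕜 (i, 2) (jetF r a l)) =
      -6 * jetU a 0 j * jetInv a * kron i l - 6 * jetU a 0 i * jetInv a * kron j l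
        + 6 * kron i j * jetInv a * jetU a 0 l := by
  have h0 : (1 : Fin 4) ≠ 0 := by decide
  rw [pderiv_jetF_two r ha]
  simp only [map_add, map_sub, map_neg, Derivation.leibniz,
    smul_eq_mul, derivation_six, derivation_kron, pderiv_jetU',
    pderiv_jetU_ne a j h0, pderiv_dot_right a j h0, pderiv_jetInv_ne ha j h0, kron_comm j i]
  ring

lemma pderiv_jetF_one (ha : a ∈ jetDomain 𝕜 m) (i l : Fin m) :
    MvPowerSeries.pderiv 𝕜 (i, 1) (jetF r a l) =
      -6 * jetU a 0 i * jetInv a * jetU a 2 l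
        + (-6 * (jetU a 0 ⬝ᵥ jetU a 2) * jetInv a
          + 24 * (jetU a 0 ⬝ᵥ jetU a 1) ^ 2 * (jetInv a) ^ 2
          - 6 * (jetU a 0 ⬝ᵥ jetU a 0) * (jetU a 1 ⬝ᵥ jetU a 1) * (jetInv a) ^ 2) * kron i l
        + (48 * (jetU a 0 ⬝ᵥ jetU a 1) * jetU a 0 i * jetInv a ^ 2
          - 12 * (jetU a 0 ⬝ᵥ jetU a 0) * jetInv a ^ 2 * jetU a 1 i) * jetU a 1 l
        + (6 * jetU a 2 i * jetInv a - 12 * jetInv a ^ 2 * (jetU a 0 i * (jetU a 1 ⬝ᵥ jetU a 1)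
          + 2 * (jetU a 0 ⬝ᵥ jetU a 1) * jetU a 1 i)) * jetU a 0 l
        + C (3 / 2) * sphereQuad r a * kron i l := by
  have h0 : (1 : Fin 4) ≠ 0 := by decide
  have h2 : (1 : Fin 4) ≠ 2 := by decide
  have h3 : (1 : Fin 4) ≠ 3 := by decide
  simp only [jetF_eq, map_add, map_sub, map_neg, Derivation.leibniz, Derivation.leibniz_pow,
    smul_eq_mul, nsmul_eq_mul, derivation_C, derivation_six, derivation_twentyFour,
    derivation_twelve, pderiv_jetU', pderiv_jetU_ne a i h0, pderiv_jetU_ne a i h2,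
    pderiv_jetU_ne a i h3, pderiv_dot_ne a i h0 h0, pderiv_dot_right a i h0,
    pderiv_dot_ne a i h0 h2, pderiv_dot_self, pderiv_dot_left a i h2,
    pderiv_jetInv_ne ha i h0, pderiv_sphereQuad_ne ha i h0]
  push_cast
  ring

/-- The part of the right-hand side that is cubic in $u_1$, the only part that enters the condition
on $A$ alone. -/
lemma pderiv_jetF_one_one_one (ha : a ∈ jetDomain 𝕜 m) (i j k l : Fin m) :
    MvPowerSeries.pderiv 𝕜 (k, 1) (MvPowerSeries.pderiv 𝕜 (j, 1)
      (MvPowerSeries.pderiv 𝕜 (i, 1) (jetF r a l))) =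
      48 * jetInv a ^ 2 * (jetU a 0 i * jetU a 0 j * kron k l + jetU a 0 i * jetU a 0 k * kron j l
        + jetU a 0 j * jetU a 0 k * kron i l)
      - 12 * (jetU a 0 ⬝ᵥ jetU a 0) * jetInv a ^ 2 *
        (kron i j * kron k l + kron i k * kron j l + kron j k * kron i l)
      - 24 * jetInv a ^ 2 * (jetU a 0 i * kron j k + jetU a 0 j * kron i k + jetU a 0 k * kron i j)
        * jetU a 0 l := by
  have h0 : (1 : Fin 4) ≠ 0 := by decide
  have h2 : (1 : Fin 4) ≠ 2 := by decide
  rw [pderiv_jetF_one r ha]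
  simp only [map_add, map_sub, map_neg, Derivation.leibniz, Derivation.leibniz_pow,
    smul_eq_mul, nsmul_eq_mul, derivation_C, derivation_six, derivation_twentyFour, derivation_two,
    derivation_twelve, derivation_fortyEight, derivation_kron, pderiv_jetU',
    pderiv_jetU_ne a _ h0, pderiv_jetU_ne a _ h2, pderiv_dot_ne a _ h0 h0, pderiv_dot_right a _ h0,
    pderiv_dot_ne a _ h0 h2, pderiv_dot_self, Nat.cast_ofNat, Nat.add_one_sub_one, pow_one,
    pderiv_jetInv_ne ha _ h0, pderiv_sphereQuad_ne ha _ h0, mul_zero, add_zero, zero_add, sub_zero,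
    zero_sub, kron_comm k i, kron_comm k j, kron_comm j i, neg_zero]
  ring

end JetFDerivatives

/-! ### Elimination of $B$: comparison of the derivatives by $u_3$, $u_2$, $u_1$. -/

namespace IsZCR

open Finset MvPowerSeries LieSeries

variable {𝕜 : Type*} [RCLike 𝕜] {m : ℕ} {L : Type*} [LieRing L] [LieAlgebra 𝕜 L]
  {r : Fin (m + 1) → 𝕜} {a : Fin m × ℕ → 𝕜} {A B : LieSeries (JetIdx m 4) L}

lemma pd_pd_A (h : IsZCR r a A B) {k : Fin 4} (hk : k ≠ 0) (i j : Fin m) :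
    pd L (i, k) (pd L (j, 0) A) = 0 := by
  rw [pd_comm, h.pd_A k hk, map_zero]

lemma pd_pd_pd_A (h : IsZCR r a A B) {k : Fin 4} (hk : k ≠ 0) (i j l : Fin m) :
    pd L (i, k) (pd L (j, 0) (pd L (l, 0) A)) = 0 := by
  rw [pd_comm, h.pd_pd_A hk, map_zero]

lemma Dt_A (A : LieSeries (JetIdx m 4) L) :
    Dt L r a A = ∑ l, jetF r a l • pd L (l, 0) A := rfl

lemma pd_sum_smul (h : IsZCR r a A B) {k : Fin 4} (hk : k ≠ 0) (i : Fin m)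
    (f : Fin m → MvPowerSeries (JetIdx m 4) 𝕜) :
    pd L (i, k) (∑ l, f l • pd L (l, 0) A) =
      ∑ l, MvPowerSeries.pderiv 𝕜 (i, k) (f l) • pd L (l, 0) A := by
  simp only [map_sum, pd_smul, h.pd_pd_A hk, smul_zero, add_zero]

/-- This is the derivative of the zero-curvature equation by $u^i_3$: only the leading term of $F$
contributes. -/
lemma pd_B_two (h : IsZCR r a A B) (ha : a ∈ jetDomain 𝕜 m) (i : Fin m) :
    pd L (i, 2) B = pd L (i, 0) A := by
  have hk : (3 : Fin 4) ≠ 0 := by decide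
  have h1 := congrArg (pd L (i, 3)) h.eq
  rw [map_add, map_sub, pd_Dx_three, h.pd_B, Dt_A, h.pd_sum_smul hk, pd_lie, h.pd_A 3 hk, h.pd_B]
    at h1
  simp only [pderiv_jetF_three r ha, sum_kron_smul, map_zero, zero_lie, lie_zero, add_zero] at h1
  exact sub_eq_zero.1 h1

/-- This is the derivative of the zero-curvature equation by $u^i_2$, with `pd_B_two` inserted. -/
lemma pd_B_one (h : IsZCR r a A B) (ha : a ∈ jetDomain 𝕜 m) (i : Fin m) :
    pd L (i, 1) B = ∑ l, MvPowerSeries.pderiv 𝕜 (i, 2) (jetF r a l) • pd L (l, 0) A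
      - Dx L a (pd L (i, 0) A) - ⁅A, pd L (i, 0) A⁆ := by
  have hk : (2 : Fin 4) ≠ 0 := by decide
  have h1 := congrArg (pd L (i, 2)) h.eq
  rw [map_add, map_sub, pd_Dx_two, h.pd_B_two ha, Dt_A, h.pd_sum_smul hk, pd_lie, h.pd_A 2 hk,
    h.pd_B_two ha, zero_lie, zero_add, map_zero] at h1
  rw [← sub_eq_zero, ← h1]
  abel

lemma pd_one_pd_B_one (h : IsZCR r a A B) (ha : a ∈ jetDomain 𝕜 m) (i j : Fin m) :
    pd L (j, 1) (pd L (i, 1) B) =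
      (kron i j * (6 * jetInv a)) • (∑ l, jetU a 0 l • pd L (l, 0) A)
      - (6 * jetU a 0 j * jetInv a) • pd L (i, 0) A - (6 * jetU a 0 i * jetInv a) • pd L (j, 0) A
      - pd L (j, 0) (pd L (i, 0) A) := by
  have hk : (1 : Fin 4) ≠ 0 := by decide
  rw [h.pd_B_one ha, map_sub, map_sub, h.pd_sum_smul hk, pd_Dx_one, h.pd_pd_A hk, map_zero, add_zero,
    pd_lie, h.pd_A 1 hk, h.pd_pd_A hk, zero_lie, lie_zero, add_zero, sub_zero]
  congr 1
  have h1 (l : Fin m) : MvPowerSeries.pderiv 𝕜 (j, 1) (MvPowerSeries.pderiv 𝕜 (i, 2) (jetF r a l)) =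
      (kron i j * (6 * jetInv a)) * jetU a 0 l - (6 * jetU a 0 j * jetInv a) * kron i l
        - (6 * jetU a 0 i * jetInv a) * kron j l := by
    rw [pderiv_jetF_two_one r ha]
    ring
  simp only [h1, sub_smul, sum_sub_distrib, mul_smul _ (kron _ _), ← smul_sum, sum_kron_smul]
  simp only [mul_smul _ (jetU a 0 _), ← smul_sum]

/-- By `pd_one_pd_B_one` the second derivatives of $B$ by $u_1$ depend on $u_0$ only. Hence the
third ones vanish, and in the third $u_1$-derivative of the equation the bracket $[A,B]$ and the
term with $D_x$ disappear; what is left concerns $A$ alone. -/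
lemma cubic (h : IsZCR r a A B) (ha : a ∈ jetDomain 𝕜 m) (i j k : Fin m) :
    pd L (i, 0) (pd L (k, 1) (pd L (j, 1) B)) + pd L (j, 0) (pd L (k, 1) (pd L (i, 1) B))
      + pd L (k, 0) (pd L (j, 1) (pd L (i, 1) B)) =
    ∑ l, MvPowerSeries.pderiv 𝕜 (k, 1) (MvPowerSeries.pderiv 𝕜 (j, 1)
      (MvPowerSeries.pderiv 𝕜 (i, 1) (jetF r a l))) • pd L (l, 0) A := by
  have hk : (1 : Fin 4) ≠ 0 := by decide
  have h0 : pd L (k, 1) (pd L (j, 1) (pd L (i, 1) B)) = 0 := by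
    rw [h.pd_one_pd_B_one ha]
    simp only [map_sub, pd_smul, h.pd_pd_A hk, h.pd_pd_pd_A hk, map_sum, smul_zero, add_zero,
      Derivation.leibniz, derivation_kron, derivation_six, pderiv_jetInv_ne ha _ hk,
      pderiv_jetU_ne a _ hk, zero_smul, sum_const_zero, sub_zero]
  have h1 := congrArg (fun z => pd L (k, 1) (pd L (j, 1) (pd L (i, 1) z))) h.eq
  simp only [map_add, map_sub, pd_Dx_one, pd_lie, Dt_A, h.pd_sum_smul hk, h.pd_A 1 hk, zero_lie,
    zero_add, h0, lie_zero, map_zero, add_zero] at h1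
  rw [← sub_eq_zero, ← h1, pd_comm (j, 1) (i, 0), pd_comm (k, 1) (i, 0), pd_comm (k, 1) (j, 0)]
  abel

end IsZCR

/-! ### The form of `A` -/

section Algebraic

variable {R M : Type*} [CommRing R] [AddCommGroup M] [Module R M]

/-- The condition `cubic`, multiplied by $\Delta^2$ and rewritten for $G=\Delta A$. In terms of $G$
all derivatives of order less than two disappear, and the equation involves only the Hessian, its
gradient and its contraction $W$ with $u$. -/
lemma hessian_identity {s δ ui uj uk dij dik djk : R} (hδ : (1 + s) * δ = 1)
    {A Au Ai Aj Ak Aij Aik Ajk Aijk Vi Vj Vk Wi Wj Wk Gij Gik Gjk Gijk : M}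
    (hWi : Wi = (2 * ui) • A + (2 * s) • Ai + (2 * ui) • Au + (1 + s) • Vi)
    (hWj : Wj = (2 * uj) • A + (2 * s) • Aj + (2 * uj) • Au + (1 + s) • Vj)
    (hWk : Wk = (2 * uk) • A + (2 * s) • Ak + (2 * uk) • Au + (1 + s) • Vk)
    (hGij : Gij = (2 * dij) • A + (2 * ui) • Aj + (2 * uj) • Ai + (1 + s) • Aij)
    (hGik : Gik = (2 * dik) • A + (2 * ui) • Ak + (2 * uk) • Ai + (1 + s) • Aik)
    (hGjk : Gjk = (2 * djk) • A + (2 * uj) • Ak + (2 * uk) • Aj + (1 + s) • Ajk)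
    (hGijk : Gijk = (2 * dij) • Ak + (2 * dik) • Aj + (2 * djk) • Ai + (2 * ui) • Ajk
      + (2 * uj) • Aik + (2 * uk) • Aij + (1 + s) • Aijk)
    (hc : ((djk * 6 * (-2 * ui * δ ^ 2)) • Au + (djk * (6 * δ)) • (Ai + Vi)
        - (6 * (dik * δ + uk * (-2 * ui * δ ^ 2))) • Aj - (6 * uk * δ) • Aij
        - (6 * (dij * δ + uj * (-2 * ui * δ ^ 2))) • Ak - (6 * uj * δ) • Aik - Aijk)
      + ((dik * 6 * (-2 * uj * δ ^ 2)) • Au + (dik * (6 * δ)) • (Aj + Vj)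
        - (6 * (djk * δ + uk * (-2 * uj * δ ^ 2))) • Ai - (6 * uk * δ) • Aij
        - (6 * (dij * δ + ui * (-2 * uj * δ ^ 2))) • Ak - (6 * ui * δ) • Ajk - Aijk)
      + ((dij * 6 * (-2 * uk * δ ^ 2)) • Au + (dij * (6 * δ)) • (Ak + Vk)
        - (6 * (djk * δ + uj * (-2 * uk * δ ^ 2))) • Ai - (6 * uj * δ) • Aik
        - (6 * (dik * δ + ui * (-2 * uk * δ ^ 2))) • Aj - (6 * ui * δ) • Ajk - Aijk) =
      (48 * δ ^ 2 * (ui * uj)) • Ak + (48 * δ ^ 2 * (ui * uk)) • Aj + (48 * δ ^ 2 * (uj * uk)) • Ai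
      - (12 * s * δ ^ 2 * dij) • Ak - (12 * s * δ ^ 2 * dik) • Aj - (12 * s * δ ^ 2 * djk) • Ai
      - (24 * δ ^ 2 * (ui * djk + uj * dik + uk * dij)) • Au) :
    (3 : R) • ((1 + s) • Gijk + (2 * ui) • Gjk + (2 * uj) • Gik + (2 * uk) • Gij
      - (2 * djk) • Wi - (2 * dik) • Wj - (2 * dij) • Wk) = 0 := by
  have hc' := congrArg ((1 + s) ^ 2 • ·) hc
  rw [← sub_eq_zero] at hc'
  rw [← neg_eq_zero, ← hc']
  subst hWi hWj hWk hGij hGik hGjk hGijk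
  clear hc hc'
  match_scalars <;> grind

/-- The two hypotheses are the $u^l$-derivative of the Hessian equation for $(i,j,k)$ and the one
with $k,l$ exchanged. In their difference the derivatives of $H$ cancel. After multiplication by
$1+s$, the gradient of $W$ is replaced by means of the last six hypotheses; the terms with $Q$
cancel, and $2(1+s)+2(1-s)=4$ leaves an algebraic condition. -/
lemma hessian_integrability {s ui uj uk ul dij dik djk dil djl dkl : R}
    {Hij Hik Hjk Hil Hjl Hijk Hijl Hjkl Hikl Hijkl Wil Wik Wjl Wjk Wkl Wlk Hkl Q : M}
    (h₁ : (2 * ul) • Hijk + (1 + s) • Hijkl + (2 * dil) • Hjk + (2 * ui) • Hjkl + (2 * djl) • Hik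
      + (2 * uj) • Hikl + (2 * dkl) • Hij + (2 * uk) • Hijl
      - (2 * djk) • Wil - (2 * dik) • Wjl - (2 * dij) • Wkl = 0)
    (h₂ : (2 * uk) • Hijl + (1 + s) • Hijkl + (2 * dik) • Hjl + (2 * ui) • Hjkl + (2 * djk) • Hil
      + (2 * uj) • Hikl + (2 * dkl) • Hij + (2 * ul) • Hijk
      - (2 * djl) • Wik - (2 * dil) • Wjk - (2 * dij) • Wlk = 0)
    (hil : (1 + s) • Wil = (1 - s) • Hil + (2 * dil) • Q)
    (hik : (1 + s) • Wik = (1 - s) • Hik + (2 * dik) • Q)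
    (hjl : (1 + s) • Wjl = (1 - s) • Hjl + (2 * djl) • Q)
    (hjk : (1 + s) • Wjk = (1 - s) • Hjk + (2 * djk) • Q)
    (hkl : (1 + s) • Wkl = (1 - s) • Hkl + (2 * dkl) • Q)
    (hlk : (1 + s) • Wlk = (1 - s) • Hkl + (2 * dkl) • Q) :
    (4 : R) • (dil • Hjk + djl • Hik - dik • Hjl - djk • Hil) = 0 := by
  linear_combination (norm := module) (1 + s) • h₁ - (1 + s) • h₂ + (2 * djk) • hil
    + (2 * dik) • hjl + (2 * dij) • hkl - (2 * djl) • hik - (2 * dil) • hjk - (2 * dij) • hlk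

lemma hessian_W_identity {s ui uj dij : R} {V Hij Wi Wj Q W' : M}
    (h₁ : W' = Hij + V)
    (h₂ : (1 + s) • V = (2 * ui) • Wj + (2 * dij) • Q - (2 * ui) • Wj - (2 * s) • Hij
      + (2 * uj) • Wi - (2 * uj) • Wi) :
    (1 + s) • W' = (1 - s) • Hij + (2 * dij) • Q := by
  subst h₁
  linear_combination (norm := module) h₂

end Algebraic

namespace LieSeries

open Finset MvPowerSeries

variable {𝕜 : Type*} [RCLike 𝕜] {m : ℕ} {L : Type*} [LieRing L] [LieAlgebra 𝕜 L]

/-- The matrix of second derivatives of `Δ A` with respect to the `u^i_0`. -/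
def hess (a : Fin m × ℕ → 𝕜) (A : LieSeries (JetIdx m 4) L) (i j : Fin m) :
    LieSeries (JetIdx m 4) L :=
  pd L (j, 0) (pd L (i, 0) (jetDen a • A))

/-- The contraction of the matrix of second derivatives of `Δ A` with the vector `u`. -/
def hessContr (a : Fin m × ℕ → 𝕜) (A : LieSeries (JetIdx m 4) L) (i : Fin m) :
    LieSeries (JetIdx m 4) L :=
  ∑ l, jetU a 0 l • hess a A i l

lemma hess_comm (a : Fin m × ℕ → 𝕜) (A : LieSeries (JetIdx m 4) L) (i j : Fin m) :
    hess a A i j = hess a A j i := pd_comm _ _ _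

lemma pd_hess_comm (a : Fin m × ℕ → 𝕜) (A : LieSeries (JetIdx m 4) L) (i j k : Fin m) :
    pd L (k, 0) (hess a A i j) = pd L (j, 0) (hess a A i k) := pd_comm _ _ _

lemma pd_smul_jetDen (a : Fin m × ℕ → 𝕜) (A : LieSeries (JetIdx m 4) L) (i : Fin m) :
    pd L (i, 0) (jetDen a • A) = (2 * jetU a 0 i) • A + jetDen a • pd L (i, 0) A := by
  rw [pd_smul, pderiv_jetDen]

lemma hess_eq (a : Fin m × ℕ → 𝕜) (A : LieSeries (JetIdx m 4) L) (i j : Fin m) :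
    hess a A i j = (2 * kron i j : MvPowerSeries (JetIdx m 4) 𝕜) • A + (2 * jetU a 0 i) • pd L (j, 0) A
      + (2 * jetU a 0 j) • pd L (i, 0) A + jetDen a • pd L (j, 0) (pd L (i, 0) A) := by
  rw [hess, pd_smul_jetDen, map_add, pd_smul, pd_smul_jetDen, Derivation.leibniz, pderiv_jetU',
    derivation_two, kron_comm j i]
  simp only [smul_eq_mul, mul_zero, add_zero]
  abel

lemma pd_hess (a : Fin m × ℕ → 𝕜) (A : LieSeries (JetIdx m 4) L) (i j k : Fin m) :
    pd L (k, 0) (hess a A i j) = (2 * kron i j : MvPowerSeries (JetIdx m 4) 𝕜) • pd L (k, 0) A + (2 * kron i k : MvPowerSeries (JetIdx m 4) 𝕜) • pd L (j, 0) A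
      + (2 * kron j k : MvPowerSeries (JetIdx m 4) 𝕜) • pd L (i, 0) A
      + (2 * jetU a 0 i) • pd L (k, 0) (pd L (j, 0) A)
      + (2 * jetU a 0 j) • pd L (k, 0) (pd L (i, 0) A)
      + (2 * jetU a 0 k) • pd L (j, 0) (pd L (i, 0) A)
      + jetDen a • pd L (k, 0) (pd L (j, 0) (pd L (i, 0) A)) := by
  rw [hess_eq]
  simp only [map_add, pd_smul, pderiv_jetDen, Derivation.leibniz, pderiv_jetU', derivation_two,
    derivation_kron, smul_eq_mul, mul_zero, add_zero, zero_smul, zero_add, kron_comm k]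
  abel

lemma hessContr_eq (a : Fin m × ℕ → 𝕜) (A : LieSeries (JetIdx m 4) L) (i : Fin m) :
    hessContr a A i = (2 * jetU a 0 i) • A + (2 * (jetU a 0 ⬝ᵥ jetU a 0)) • pd L (i, 0) A
      + (2 * jetU a 0 i) • (∑ l, jetU a 0 l • pd L (l, 0) A)
      + jetDen a • ∑ l, jetU a 0 l • pd L (i, 0) (pd L (l, 0) A) := by
  simp only [hessContr, hess_eq, smul_add, sum_add_distrib]
  have h1 : ∑ l, jetU a 0 l • (2 * kron i l : MvPowerSeries (JetIdx m 4) 𝕜) • A =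
      (2 * jetU a 0 i) • A := by
    have (l : Fin m) : jetU a 0 l • (2 * kron i l : MvPowerSeries (JetIdx m 4) 𝕜) • A =
        (kron i l : MvPowerSeries (JetIdx m 4) 𝕜) • (2 * jetU a 0 l) • A := by
      rw [smul_smul, smul_smul]
      exact congrArg (· • A) (by ring)
    simp only [this, sum_kron_smul]
  have h2 : ∑ l, jetU a 0 l • (2 * jetU a 0 l) • pd L (i, 0) A =
      (2 * (jetU a 0 ⬝ᵥ jetU a 0)) • pd L (i, 0) A := by
    rw [dotProduct, mul_sum, sum_smul]
    refine sum_congr rfl fun l _ => ?_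
    rw [smul_smul]
    exact congrArg (· • _) (by ring)
  have h3 : ∑ l, jetU a 0 l • (2 * jetU a 0 i) • pd L (l, 0) A =
      (2 * jetU a 0 i) • ∑ l, jetU a 0 l • pd L (l, 0) A := by
    rw [smul_sum]
    exact sum_congr rfl fun l _ => smul_comm _ _ _
  have h4 : ∑ l, jetU a 0 l • jetDen a • pd L (l, 0) (pd L (i, 0) A) =
      jetDen a • ∑ l, jetU a 0 l • pd L (i, 0) (pd L (l, 0) A) := by
    rw [smul_sum]
    refine sum_congr rfl fun l _ => ?_
    rw [smul_comm, pd_comm]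
  rw [h1, h2, h3, h4]
  abel

end LieSeries

namespace IsZCR

open Finset MvPowerSeries LieSeries

variable {𝕜 : Type*} [RCLike 𝕜] {m : ℕ} {L : Type*} [LieRing L] [LieAlgebra 𝕜 L]
  {r : Fin (m + 1) → 𝕜} {a : Fin m × ℕ → 𝕜} {A B : LieSeries (JetIdx m 4) L}

lemma pd_zero_pd_one_pd_B_one (h : IsZCR r a A B) (ha : a ∈ jetDomain 𝕜 m) (i j k : Fin m) :
    pd L (i, 0) (pd L (k, 1) (pd L (j, 1) B)) =
      (kron j k * 6 * (-2 * jetU a 0 i * jetInv a ^ 2)) • (∑ l, jetU a 0 l • pd L (l, 0) A)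
      + (kron j k * (6 * jetInv a)) •
        (pd L (i, 0) A + ∑ l, jetU a 0 l • pd L (i, 0) (pd L (l, 0) A))
      - (6 * (kron i k * jetInv a + jetU a 0 k * (-2 * jetU a 0 i * jetInv a ^ 2))) • pd L (j, 0) A
      - (6 * jetU a 0 k * jetInv a) • pd L (i, 0) (pd L (j, 0) A)
      - (6 * (kron i j * jetInv a + jetU a 0 j * (-2 * jetU a 0 i * jetInv a ^ 2))) • pd L (k, 0) A
      - (6 * jetU a 0 j * jetInv a) • pd L (i, 0) (pd L (k, 0) A)
      - pd L (i, 0) (pd L (k, 0) (pd L (j, 0) A)) := by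
  have e1 : pd L (i, 0) (∑ l, jetU a 0 l • pd L (l, 0) A) =
      pd L (i, 0) A + ∑ l, jetU a 0 l • pd L (i, 0) (pd L (l, 0) A) := by
    simp only [map_sum, pd_smul, pderiv_jetU', sum_add_distrib, sum_kron_smul]
  have e2 : MvPowerSeries.pderiv 𝕜 (i, 0) (kron j k * (6 * jetInv a)) =
      kron j k * 6 * (-2 * jetU a 0 i * jetInv a ^ 2) := by
    simp only [Derivation.leibniz, derivation_kron, derivation_six, pderiv_jetInv ha, smul_eq_mul]
    ring
  have e3 (k : Fin m) : MvPowerSeries.pderiv 𝕜 (i, 0) (6 * jetU a 0 k * jetInv a) =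
      6 * (kron i k * jetInv a + jetU a 0 k * (-2 * jetU a 0 i * jetInv a ^ 2)) := by
    simp only [Derivation.leibniz, pderiv_jetU', derivation_six, pderiv_jetInv ha, smul_eq_mul]
    ring
  rw [h.pd_one_pd_B_one ha]
  simp only [map_sub, pd_smul, e1, e2, e3]
  abel

lemma sum_pderiv_jetF_smul (ha : a ∈ jetDomain 𝕜 m) (i j k : Fin m) :
    ∑ l, MvPowerSeries.pderiv 𝕜 (k, 1) (MvPowerSeries.pderiv 𝕜 (j, 1)
      (MvPowerSeries.pderiv 𝕜 (i, 1) (jetF r a l))) • pd L (l, 0) A =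
      (48 * jetInv a ^ 2 * (jetU a 0 i * jetU a 0 j)) • pd L (k, 0) A
      + (48 * jetInv a ^ 2 * (jetU a 0 i * jetU a 0 k)) • pd L (j, 0) A
      + (48 * jetInv a ^ 2 * (jetU a 0 j * jetU a 0 k)) • pd L (i, 0) A
      - (12 * (jetU a 0 ⬝ᵥ jetU a 0) * jetInv a ^ 2 * kron i j) • pd L (k, 0) A
      - (12 * (jetU a 0 ⬝ᵥ jetU a 0) * jetInv a ^ 2 * kron i k) • pd L (j, 0) A
      - (12 * (jetU a 0 ⬝ᵥ jetU a 0) * jetInv a ^ 2 * kron j k) • pd L (i, 0) A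
      - (24 * jetInv a ^ 2 * (jetU a 0 i * kron j k + jetU a 0 j * kron i k
        + jetU a 0 k * kron i j)) • (∑ l, jetU a 0 l • pd L (l, 0) A) := by
  have e (l : Fin m) : MvPowerSeries.pderiv 𝕜 (k, 1) (MvPowerSeries.pderiv 𝕜 (j, 1)
      (MvPowerSeries.pderiv 𝕜 (i, 1) (jetF r a l))) =
      (48 * jetInv a ^ 2 * (jetU a 0 i * jetU a 0 j)) * kron k l
      + (48 * jetInv a ^ 2 * (jetU a 0 i * jetU a 0 k)) * kron j l
      + (48 * jetInv a ^ 2 * (jetU a 0 j * jetU a 0 k)) * kron i l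
      - (12 * (jetU a 0 ⬝ᵥ jetU a 0) * jetInv a ^ 2 * kron i j) * kron k l
      - (12 * (jetU a 0 ⬝ᵥ jetU a 0) * jetInv a ^ 2 * kron i k) * kron j l
      - (12 * (jetU a 0 ⬝ᵥ jetU a 0) * jetInv a ^ 2 * kron j k) * kron i l
      - (24 * jetInv a ^ 2 * (jetU a 0 i * kron j k + jetU a 0 j * kron i k
        + jetU a 0 k * kron i j)) * jetU a 0 l := by
    rw [pderiv_jetF_one_one_one r ha]
    ring
  simp only [e, add_smul, sub_smul, sum_add_distrib, sum_sub_distrib, mul_smul _ (kron _ _) (pd _ _ _),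
    mul_smul _ (jetU a 0 _) (pd _ _ _), ← smul_sum, sum_kron_smul]

/-- It expresses the gradient of the Hessian of $\Delta A$ through the Hessian itself, so the system
is closed and can be tested for integrability. -/
lemma hess_equation (h : IsZCR r a A B) (ha : a ∈ jetDomain 𝕜 m) (i j k : Fin m) :
    jetDen a • pd L (k, 0) (hess a A i j) + (2 * jetU a 0 i) • hess a A j k
      + (2 * jetU a 0 j) • hess a A i k + (2 * jetU a 0 k) • hess a A i j
      - (2 * kron j k : MvPowerSeries (JetIdx m 4) 𝕜) • hessContr a A i - (2 * kron i k : MvPowerSeries (JetIdx m 4) 𝕜) • hessContr a A j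
      - (2 * kron i j : MvPowerSeries (JetIdx m 4) 𝕜) • hessContr a A k = 0 := by
  have hc := h.cubic ha i j k
  rw [sum_pderiv_jetF_smul ha, h.pd_zero_pd_one_pd_B_one ha, h.pd_zero_pd_one_pd_B_one ha,
    h.pd_zero_pd_one_pd_B_one ha, kron_comm k i, kron_comm k j, kron_comm j i,
    pd_comm (i, 0) (j, 0) A, pd_comm (i, 0) (k, 0) A, pd_comm (j, 0) (k, 0) A,
    pd_comm (j, 0) (k, 0) (pd L (i, 0) A), pd_comm (i, 0) (k, 0) (pd L (j, 0) A),
    pd_comm (i, 0) (j, 0) A] at hc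
  refine (isUnit_ofNat_series (𝕜 := 𝕜) (σ := JetIdx m 4) 3).smul_eq_zero.1 ?_
  exact hessian_identity (jetDen_mul_jetInv ha) (hessContr_eq a A i) (hessContr_eq a A j)
    (hessContr_eq a A k) (hess_eq a A i j) (hess_eq a A i k) (hess_eq a A j k) (pd_hess a A i j k) hc

/-- Differentiate $W_i=\sum_lu^lH_{il}$ and contract `hess_equation` with $u$; the terms $u^iW_j$
and $u^jW_i$ cancel. -/
lemma pd_hessContr (h : IsZCR r a A B) (ha : a ∈ jetDomain 𝕜 m) (i j : Fin m) :
    jetDen a • pd L (j, 0) (hessContr a A i) = (1 - jetU a 0 ⬝ᵥ jetU a 0) • hess a A i j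
      + (2 * kron i j : MvPowerSeries (JetIdx m 4) 𝕜) • ∑ l, jetU a 0 l • hessContr a A l := by
  have e1 : pd L (j, 0) (hessContr a A i) =
      hess a A i j + ∑ l, jetU a 0 l • pd L (j, 0) (hess a A i l) := by
    simp only [hessContr, map_sum, pd_smul, pderiv_jetU', sum_add_distrib, sum_kron_smul]
  refine hessian_W_identity (ui := jetU a 0 i) (uj := jetU a 0 j) (Wi := hessContr a A i)
    (Wj := hessContr a A j) e1 ?_
  have e2 (l : Fin m) : jetDen a • pd L (j, 0) (hess a A i l) =
      (kron l j : MvPowerSeries (JetIdx m 4) 𝕜) • (2 : MvPowerSeries (JetIdx m 4) 𝕜) • hessContr a A i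
      + (2 * kron i j : MvPowerSeries (JetIdx m 4) 𝕜) • hessContr a A l
      + (kron i l : MvPowerSeries (JetIdx m 4) 𝕜) • (2 : MvPowerSeries (JetIdx m 4) 𝕜) • hessContr a A j
      - (2 * jetU a 0 i) • hess a A j l - (2 : MvPowerSeries (JetIdx m 4) 𝕜) • jetU a 0 l • hess a A i j
      - (2 * jetU a 0 j) • hess a A i l := by
    have h1 := h.hess_equation ha i l j
    rw [hess_comm a A l j] at h1
    rw [← sub_eq_zero, ← h1]
    simp only [smul_smul]
    rw [mul_comm (kron l j) 2, mul_comm (kron i l) 2]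
    abel
  have e3 (l : Fin m) : (1 + jetU a 0 ⬝ᵥ jetU a 0) • jetU a 0 l • pd L (j, 0) (hess a A i l) =
      (kron j l : MvPowerSeries (JetIdx m 4) 𝕜) • (2 * jetU a 0 l) • hessContr a A i
      + (2 * kron i j : MvPowerSeries (JetIdx m 4) 𝕜) • jetU a 0 l • hessContr a A l
      + (kron i l : MvPowerSeries (JetIdx m 4) 𝕜) • (2 * jetU a 0 l) • hessContr a A j
      - (2 * jetU a 0 i) • jetU a 0 l • hess a A j l
      - (jetU a 0 l * jetU a 0 l) • (2 : MvPowerSeries (JetIdx m 4) 𝕜) • hess a A i j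
      - (2 * jetU a 0 j) • jetU a 0 l • hess a A i l := by
    rw [smul_comm]
    change jetU a 0 l • jetDen a • pd L (j, 0) (hess a A i l) = _
    rw [e2, kron_comm l j]
    generalize pd L (j, 0) (hess a A i l) = z₀
    generalize hess a A i j = z₁
    generalize hess a A i l = z₂
    generalize hess a A j l = z₃
    generalize hessContr a A i = z₄
    generalize hessContr a A j = z₅
    generalize hessContr a A l = z₆
    simp only [smul_sub, smul_add, smul_smul]
    refine congrArg₂ (· - ·) (congrArg₂ (· - ·) (congrArg₂ (· - ·) (congrArg₂ (· + ·)
      (congrArg₂ (· + ·) ?_ ?_) ?_) ?_) ?_) ?_ <;> exact congrArg (· • _) (by ring)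
  rw [smul_sum]
  simp only [e3, sum_add_distrib, sum_sub_distrib, sum_kron_smul, ← smul_sum, ← sum_smul]
  change _ - (2 * jetU a 0 i) • hessContr a A j - (jetU a 0 ⬝ᵥ jetU a 0) • _
    - (2 * jetU a 0 j) • hessContr a A i = _
  rw [smul_smul, mul_comm _ (2 : MvPowerSeries (JetIdx m 4) 𝕜)]
  abel

/-- Equality of the mixed derivatives $\partial_k\partial_l$ of the Hessian entry $H_{ij}$. -/
lemma hess_compat (h : IsZCR r a A B) (ha : a ∈ jetDomain 𝕜 m) (i j k l : Fin m) :
    (kron i l : MvPowerSeries (JetIdx m 4) 𝕜) • hess a A j k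
      + (kron j l : MvPowerSeries (JetIdx m 4) 𝕜) • hess a A i k
      - (kron i k : MvPowerSeries (JetIdx m 4) 𝕜) • hess a A j l
      - (kron j k : MvPowerSeries (JetIdx m 4) 𝕜) • hess a A i l = 0 := by
  have key (k l : Fin m) := congrArg (pd L (l, 0)) (h.hess_equation ha i j k)
  simp only [map_add, map_sub, map_zero, pd_smul, pderiv_jetDen, Derivation.leibniz, pderiv_jetU',
    derivation_kron, derivation_two, smul_eq_mul, mul_zero, add_zero, zero_smul, zero_add] at key
  have h₁ := key k l
  have h₂ := key l k
  rw [pd_comm (k, 0) (l, 0), pd_hess_comm a A j l k, pd_hess_comm a A i l k] at h₂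
  rw [kron_comm l i, kron_comm l j, kron_comm l k] at h₁
  rw [kron_comm k i, kron_comm k j] at h₂
  refine (isUnit_ofNat_series (𝕜 := 𝕜) (σ := JetIdx m 4) 4).smul_eq_zero.1 ?_
  have hlk := h.pd_hessContr ha l k
  rw [kron_comm l k, hess_comm a A l k] at hlk
  have e {x₁ x₂ x₃ x₄ x₅ x₆ x₇ x₈ y₁ y₂ y₃ : LieSeries (JetIdx m 4) L}
      (h : x₁ + x₂ + (x₃ + x₄) + (x₅ + x₆) + (x₇ + x₈) - y₁ - y₂ - y₃ = 0) :
      x₁ + x₂ + x₃ + x₄ + x₅ + x₆ + x₇ + x₈ - y₁ - y₂ - y₃ = 0 := by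
    rw [← h]
    abel
  refine hessian_integrability (s := jetU a 0 ⬝ᵥ jetU a 0) (e h₁) (e h₂)
    (h.pd_hessContr ha i l) (h.pd_hessContr ha i k) (h.pd_hessContr ha j l)
    (h.pd_hessContr ha j k) (h.pd_hessContr ha k l) hlk

end IsZCR

/-! ### Integration of the Hessian equation. -/

namespace IsZCR

open Finset MvPowerSeries LieSeries

variable {𝕜 : Type*} [RCLike 𝕜] {m : ℕ} {L : Type*} [LieRing L] [LieAlgebra 𝕜 L]
  {r : Fin (m + 1) → 𝕜} {a : Fin m × ℕ → 𝕜} {A B : LieSeries (JetIdx m 4) L}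

lemma hess_of_ne (h : IsZCR r a A B) (ha : a ∈ jetDomain 𝕜 m) {i j : Fin m} (hij : i ≠ j) :
    hess a A i j = 0 := by
  have h1 := h.hess_compat ha i i j i
  rw [kron_self, kron_ne hij, one_smul, zero_smul, sub_zero, sub_zero] at h1
  rw [← two_smul (MvPowerSeries (JetIdx m 4) 𝕜)] at h1
  exact (isUnit_ofNat_series (𝕜 := 𝕜) (σ := JetIdx m 4) 2).smul_eq_zero.1 h1

lemma hess_self (h : IsZCR r a A B) (ha : a ∈ jetDomain 𝕜 m) (i j : Fin m) :
    hess a A i i = hess a A j j := by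
  by_cases hij : i = j
  · rw [hij]
  have h1 := h.hess_compat ha i j j i
  rw [kron_self, kron_self, kron_ne hij, kron_ne (Ne.symm hij), one_smul, zero_smul, zero_smul,
    one_smul, add_zero, sub_zero] at h1
  exact (sub_eq_zero.1 h1).symm

lemma pd_smul_jetDen_ne (h : IsZCR r a A B) {k : Fin 4} (hk : k ≠ 0) (i : Fin m) :
    pd L (i, k) (jetDen a • A) = 0 := by
  rw [pd_smul, pderiv_jetDen_ne i hk, h.pd_A k hk, zero_smul, smul_zero, add_zero]

lemma exists_hess_eq_const (h : IsZCR r a A B) (ha : a ∈ jetDomain 𝕜 m) (hm : 2 ≤ m) :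
    ∃ t : L, ∀ i j, hess a A i j =
      (kron i j : MvPowerSeries (JetIdx m 4) 𝕜) • const (JetIdx m 4) L t := by
  let i₀ : Fin m := ⟨0, by omega⟩
  -- To differentiate the common diagonal entry by $u^k$, use the entry with index $i\ne k$:
  -- $\partial_kH_{ii}=\partial_iH_{ik}=0$. This needs two different indices.
  obtain ⟨t, ht⟩ := LieSeries.exists_eq_const 𝕜 (c := hess a A i₀ i₀) (fun k => by
    have : Nontrivial (Fin m) := Fin.nontrivial_iff_two_le.2 hm
    obtain ⟨i, hik⟩ := exists_ne k
    rw [h.hess_self ha i₀ i, pd_hess_comm, h.hess_of_ne ha hik, map_zero]) (fun k hk i => by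
      rw [hess, pd_comm, pd_comm (i, k), h.pd_smul_jetDen_ne hk, map_zero, map_zero])
  refine ⟨t, fun i j => ?_⟩
  by_cases hij : i = j
  · rw [hij, kron_self, one_smul, h.hess_self ha j i₀, ht]
  · rw [kron_ne hij, zero_smul, h.hess_of_ne ha hij]

/-- Two integrations: the first derivatives of $\Delta A$ are $u^it$ plus constants $g_i$, and then
$\Delta A$ itself is known up to a constant. -/
lemma exists_smul_jetDen_eq (h : IsZCR r a A B) (ha : a ∈ jetDomain 𝕜 m) (hm : 2 ≤ m) :
    ∃ (t g₀ : L) (g : Fin m → L), jetDen a • A = (C (1 / 2) * (jetU a 0 ⬝ᵥ jetU a 0)) •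
      const (JetIdx m 4) L t + comb (jetU a 0) g + const _ L g₀ := by
  obtain ⟨t, ht⟩ := h.exists_hess_eq_const ha hm
  have h1 (i : Fin m) : ∃ x, pd L (i, 0) (jetDen a • A) - jetU a 0 i • const _ L t = const _ L x := by
    refine LieSeries.exists_eq_const 𝕜 (fun j => ?_) (fun k hk j => ?_)
    · rw [map_sub, pd_smul _ (jetU a 0 i), pd_const, smul_zero, add_zero, pderiv_jetU', kron_comm, ← ht i j, hess,
        sub_self]
    · rw [map_sub, pd_smul _ (jetU a 0 i), pd_const, smul_zero, add_zero, pderiv_jetU_ne a j hk, zero_smul, pd_comm (j, k),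
        h.pd_smul_jetDen_ne hk, map_zero, sub_zero]
  choose g hg using h1
  obtain ⟨g₀, hg₀⟩ := LieSeries.exists_eq_const 𝕜 (c := jetDen a • A -
      ((C (1 / 2) * (jetU a 0 ⬝ᵥ jetU a 0)) • const (JetIdx m 4) L t + comb (jetU a 0) g))
    (fun i => by
      have e : comb (fun b => MvPowerSeries.pderiv 𝕜 (i, 0) (jetU a 0 b)) g = const _ L (g i) := by
        simp only [comb, pderiv_jetU', sum_kron_smul]
      rw [map_sub, map_add, pd_smul _ (C (1 / 2) * (jetU a 0 ⬝ᵥ jetU a 0)), pd_comb, pd_const, e,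
        ← hg i, smul_zero, add_zero, Derivation.leibniz, derivation_C, pderiv_dot_self,
        smul_zero, add_zero, smul_eq_mul, ← mul_assoc, C_half_mul_two, one_mul]
      abel)
    (fun k hk i => by
      rw [map_sub, map_add, pd_smul _ (C (1 / 2) * (jetU a 0 ⬝ᵥ jetU a 0)), pd_comb, pd_const,
        h.pd_smul_jetDen_ne hk, Derivation.leibniz, derivation_C, pderiv_dot_ne a i hk hk]
      simp only [pderiv_jetU_ne a i hk, comb_zero, smul_zero, zero_smul, add_zero, sub_zero])
  exact ⟨t, g₀, g, by rw [← hg₀]; abel⟩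

/-- The form of `A` in a solution of the zero-curvature equation. -/
theorem exists_eq_zcrA (h : IsZCR r a A B) (ha : a ∈ jetDomain 𝕜 m) (hm : 2 ≤ m) :
    ∃ (q₀ : L) (p : Fin (m + 1) → L), A = zcrA a q₀ p := by
  obtain ⟨t, g₀, g, hg⟩ := h.exists_smul_jetDen_eq ha hm
  -- The constants come from $\Delta^{-1}=\tfrac12(1+S^n)$, $u^i\Delta^{-1}=\tfrac12S^i$ and
  -- $\langle u,u\rangle\Delta^{-1}=\tfrac12(1-S^n)$.
  refine ⟨(1 / 2 : 𝕜) • g₀ + (1 / 4 : 𝕜) • t, Fin.snoc (α := fun _ => L)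
    (fun i => (1 / 2 : 𝕜) • g i) ((1 / 2 : 𝕜) • g₀ - (1 / 4 : 𝕜) • t), ?_⟩
  have hA : A = jetInv a • jetDen a • A := by
    rw [smul_smul, mul_comm, jetDen_mul_jetInv ha, one_smul]
  have hδ := jetDen_mul_jetInv ha
  rw [jetDen] at hδ
  have h2 : (C (1 / 2) : MvPowerSeries (JetIdx m 4) 𝕜) * 2 = 1 := C_half_mul_two
  have h4 : (C (1 / 4) : MvPowerSeries (JetIdx m 4) 𝕜) * 2 = C (1 / 2) := by
    rw [← map_ofNat (C (σ := JetIdx m 4) (R := 𝕜)) 2, ← map_mul]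
    congr 1
    norm_num
  rw [hA, hg, zcrA, comb_def (sphere a), Fin.sum_univ_castSucc, sphere_last]
  simp only [sphere_castSucc, Fin.snoc_castSucc, Fin.snoc_last, map_add, map_sub, const_smul]
  have e : ∑ i, (2 * jetU a 0 i * jetInv a) • (C (1 / 2) : MvPowerSeries (JetIdx m 4) 𝕜) •
      const (JetIdx m 4) L (g i) = jetInv a • comb (jetU a 0) g := by
    rw [comb, smul_sum]
    refine sum_congr rfl fun i _ => ?_
    rw [smul_smul, smul_smul]
    exact congrArg (· • _) (by linear_combination jetU a 0 i * jetInv a * h2)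
  rw [e]
  generalize comb (jetU a 0) g = z
  generalize const (JetIdx m 4) L t = x
  generalize const (JetIdx m 4) L g₀ = y
  generalize jetU a 0 ⬝ᵥ jetU a 0 = σ at *
  generalize jetInv a = δ at *
  generalize (C (1 / 2) : MvPowerSeries (JetIdx m 4) 𝕜) = c₂ at *
  generalize (C (1 / 4) : MvPowerSeries (JetIdx m 4) 𝕜) = c₄ at *
  have f1 : δ * (c₂ * σ) = c₄ - (2 * δ - 1) * c₄ := by
    linear_combination c₂ * hδ + (δ - 1) * h4
  have f2 : δ = c₂ + (2 * δ - 1) * c₂ := by linear_combination -δ * h2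
  have f3 : δ • y = c₂ • y + ((2 * δ - 1) * c₂) • y := by
    conv_lhs => rw [f2]
    rw [add_smul]
  simp only [smul_add, smul_sub, smul_smul, f1, f3, sub_smul]
  abel

end IsZCR

/-! ### The form of `B` -/

section SphereDerivatives

open Finset MvPowerSeries LieSeries

variable {𝕜 : Type*} [RCLike 𝕜] {m : ℕ} {a : Fin m × ℕ → 𝕜}

/-- The derivative of `sphere` with respect to `u^i`. -/
def sphereD (a : Fin m × ℕ → 𝕜) (i : Fin m) (b : Fin (m + 1)) : MvPowerSeries (JetIdx m 4) 𝕜 :=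
  MvPowerSeries.pderiv 𝕜 (i, 0) (sphere a b)

lemma sphereD_castSucc (ha : a ∈ jetDomain 𝕜 m) (i j : Fin m) : sphereD a i j.castSucc =
    2 * jetInv a * kron i j - 4 * jetU a 0 i * jetInv a ^ 2 * jetU a 0 j := by
  rw [sphereD, sphere_castSucc]
  simp only [Derivation.leibniz, smul_eq_mul, pderiv_jetU', pderiv_jetInv ha, derivation_two]
  ring

lemma sphereD_last (ha : a ∈ jetDomain 𝕜 m) (i : Fin m) : sphereD a i (Fin.last m) =
    -4 * jetU a 0 i * jetInv a ^ 2 := by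
  rw [sphereD, sphere_last]
  simp only [map_sub, Derivation.leibniz, smul_eq_mul, pderiv_jetInv ha, derivation_two,
    Derivation.map_one_eq_zero]
  ring

lemma sum_mul_sphereD_castSucc (ha : a ∈ jetDomain 𝕜 m) (f : Fin m → MvPowerSeries (JetIdx m 4) 𝕜)
    (j : Fin m) : ∑ l, f l * sphereD a l j.castSucc =
      2 * jetInv a * f j - 4 * (f ⬝ᵥ jetU a 0) * jetInv a ^ 2 * jetU a 0 j := by
  have h (l : Fin m) : f l * sphereD a l j.castSucc = kron j l * (2 * jetInv a * f l) -
      4 * jetInv a ^ 2 * jetU a 0 j * (f l * jetU a 0 l) := by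
    rw [sphereD_castSucc ha, kron_comm l j]
    ring
  simp only [h, sum_sub_distrib, sum_kron_mul, ← mul_sum]
  rw [dotProduct]
  ring

lemma sum_mul_sphereD_last (ha : a ∈ jetDomain 𝕜 m) (f : Fin m → MvPowerSeries (JetIdx m 4) 𝕜) :
    ∑ l, f l * sphereD a l (Fin.last m) = -4 * (f ⬝ᵥ jetU a 0) * jetInv a ^ 2 := by
  have h (l : Fin m) : f l * sphereD a l (Fin.last m) =
      -4 * jetInv a ^ 2 * (f l * jetU a 0 l) := by
    rw [sphereD_last ha]
    ring
  simp only [h, ← mul_sum]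
  rw [dotProduct]
  ring

/-- The chain rule for $D_xS$, as $S$ depends on $u_0$ only. -/
lemma sum_jetU_mul_sphereD (ha : a ∈ jetDomain 𝕜 m) (b : Fin (m + 1)) :
    ∑ l, jetU a 1 l * sphereD a l b = sphere₁ a b := by
  induction b using Fin.lastCases with
  | last =>
    rw [sum_mul_sphereD_last ha, sphere₁_last ha, dotProduct_comm]
  | cast j =>
    rw [sum_mul_sphereD_castSucc ha, sphere₁_castSucc ha, dotProduct_comm]

lemma pderiv_sphere₁_dot_one (ha : a ∈ jetDomain 𝕜 m) (i : Fin m) :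
    MvPowerSeries.pderiv 𝕜 (i, 1) (sphere₁ a ⬝ᵥ sphere₁ a) =
      8 * jetInv a ^ 2 * jetU a 1 i := by
  rw [sphere₁_dot_sphere₁ ha]
  simp only [Derivation.leibniz, Derivation.leibniz_pow, derivation_four, pderiv_dot_self,
    pderiv_jetInv_ne ha i (show (1 : Fin 4) ≠ 0 by decide), smul_eq_mul]
  ring

lemma pderiv_sphereFlux_one (ha : a ∈ jetDomain 𝕜 m) (i : Fin m) (b : Fin (m + 1)) :
    MvPowerSeries.pderiv 𝕜 (i, 1) (sphereFlux a b) =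
      2 * scalarDx a (sphereD a i b) + 12 * jetInv a ^ 2 * jetU a 1 i * sphere a b := by
  rw [sphereFlux, map_add, pderiv_sphere₂_one ha, Derivation.leibniz, Derivation.leibniz,
    derivation_C, pderiv_sphere₁_dot_one ha, pderiv_sphere (i, 1) (by simp) ha]
  simp only [smul_eq_mul, mul_zero, add_zero, zero_add]
  rw [sphereD]
  linear_combination 4 * jetInv a ^ 2 * jetU a 1 i * sphere a b * two_mul_C (𝕜 := 𝕜) (m := m)

lemma pderiv_sphereFlux_two (ha : a ∈ jetDomain 𝕜 m) (i : Fin m) (b : Fin (m + 1)) :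
    MvPowerSeries.pderiv 𝕜 (i, 2) (sphereFlux a b) = sphereD a i b := by
  rw [sphereFlux, map_add, pderiv_sphere₂_two ha, Derivation.leibniz, Derivation.leibniz,
    derivation_C, pderiv_sphere₁_dot_ne ha i (by decide) (by decide),
    pderiv_sphere (i, 2) (by simp) ha, sphereD]
  simp

lemma pderiv_sphereFlux_three (ha : a ∈ jetDomain 𝕜 m) (i : Fin m) (b : Fin (m + 1)) :
    MvPowerSeries.pderiv 𝕜 (i, 3) (sphereFlux a b) = 0 := by
  rw [sphereFlux, map_add, pderiv_sphere₂_three ha, Derivation.leibniz, Derivation.leibniz,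
    derivation_C, pderiv_sphere₁_dot_ne ha i (by decide) (by decide),
    pderiv_sphere (i, 3) (by simp) ha]
  simp

/-- Conceptually this is the derivative by $u^i_2$ of the evolution equation for $S$, with
$[\partial/\partial u^i_2,D_x]=\partial/\partial u^i_1$; it is verified here by direct computation.
-/
lemma sum_pderiv_jetF_mul_sphereD (r : Fin (m + 1) → 𝕜) (ha : a ∈ jetDomain 𝕜 m) (i : Fin m)
    (b : Fin (m + 1)) :
    ∑ l, MvPowerSeries.pderiv 𝕜 (i, 2) (jetF r a l) * sphereD a l b =
      scalarDx a (sphereD a i b) + MvPowerSeries.pderiv 𝕜 (i, 1) (sphereFlux a b) := by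
  have h := jetDen_mul_jetInv ha
  rw [jetDen] at h
  have e : (fun l => MvPowerSeries.pderiv 𝕜 (i, 2) (jetF r a l)) ⬝ᵥ jetU a 0 =
      -12 * (jetU a 0 ⬝ᵥ jetU a 1) * jetInv a * jetU a 0 i
        + 6 * jetU a 1 i * jetInv a * (jetU a 0 ⬝ᵥ jetU a 0) := by
    have e1 (l : Fin m) : MvPowerSeries.pderiv 𝕜 (i, 2) (jetF r a l) * jetU a 0 l =
        kron i l * (-6 * (jetU a 0 ⬝ᵥ jetU a 1) * jetInv a * jetU a 0 l)
        - 6 * jetU a 0 i * jetInv a * (jetU a 0 l * jetU a 1 l)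
        + 6 * jetU a 1 i * jetInv a * (jetU a 0 l * jetU a 0 l) := by
      rw [pderiv_jetF_two r ha]
      ring
    rw [dotProduct]
    simp only [e1, sum_add_distrib, sum_sub_distrib, sum_kron_mul, ← mul_sum]
    simp only [dotProduct]
    ring
  rw [pderiv_sphereFlux_one ha]
  induction b using Fin.lastCases with
  | last =>
    rw [sum_mul_sphereD_last ha, e, sphereD_last ha, sphere_last]
    simp only [map_neg, Derivation.leibniz, Derivation.leibniz_pow, smul_eq_mul, nsmul_eq_mul,
      scalarDx_jetU₀, scalarDx_jetInv ha, derivation_four]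
    generalize jetU a 0 ⬝ᵥ jetU a 0 = σ at *
    clear e
    push_cast
    grind
  | cast j =>
    rw [sum_mul_sphereD_castSucc ha, e, sphereD_castSucc ha, sphere_castSucc, pderiv_jetF_two r ha]
    simp only [map_sub, Derivation.leibniz, Derivation.leibniz_pow, smul_eq_mul, nsmul_eq_mul,
      scalarDx_jetU₀, scalarDx_jetInv ha, derivation_four, derivation_two, derivation_kron]
    generalize jetU a 0 ⬝ᵥ jetU a 0 = σ at *
    clear e
    push_cast
    grind

end SphereDerivatives

namespace LieSeries

open Finset MvPowerSeries

variable {𝕜 : Type*} [RCLike 𝕜] {m : ℕ} {L : Type*} [LieRing L] [LieAlgebra 𝕜 L]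

lemma sum_smul_comb {σ ι κ : Type*} [DecidableEq σ] [Fintype ι] [Fintype κ]
    (f : κ → MvPowerSeries σ 𝕜) (g : κ → ι → MvPowerSeries σ 𝕜) (p : ι → L) :
    ∑ l, f l • comb (g l) p = comb (fun b => ∑ l, f l * g l b) p := by
  simp only [comb, smul_sum, smul_smul, sum_smul]
  exact sum_comm

lemma pd_comb_sphere (a : Fin m × ℕ → 𝕜) (i : Fin m) (p : Fin (m + 1) → L) :
    pd L (i, 0) (comb (sphere a) p) = comb (sphereD a i) p := pd_comb _ _ _

lemma pd_comb_sphere_ne {a : Fin m × ℕ → 𝕜} (ha : a ∈ jetDomain 𝕜 m) (i : Fin m) {k : Fin 4}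
    (hk : k ≠ 0) (p : Fin (m + 1) → L) : pd L (i, k) (comb (sphere a) p) = 0 := by
  simp only [pd_comb, pderiv_sphere (i, k) hk ha, comb_zero]

lemma pd_comb_sphereD_ne {a : Fin m × ℕ → 𝕜} (ha : a ∈ jetDomain 𝕜 m) (i j : Fin m) {k : Fin 4}
    (hk : k ≠ 0) (p : Fin (m + 1) → L) : pd L (i, k) (comb (sphereD a j) p) = 0 := by
  rw [← pd_comb_sphere, pd_comm, pd_comb_sphere_ne ha i hk, map_zero]

lemma pd_comb_sphere₁_one {a : Fin m × ℕ → 𝕜} (ha : a ∈ jetDomain 𝕜 m) (i : Fin m)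
    (p : Fin (m + 1) → L) : pd L (i, 1) (comb (sphere₁ a) p) = comb (sphereD a i) p := by
  simp only [pd_comb, pderiv_sphere₁_one ha]
  rfl

lemma Dx_comb_sphere (a : Fin m × ℕ → 𝕜) (p : Fin (m + 1) → L) :
    Dx L a (comb (sphere a) p) = comb (sphere₁ a) p := Dx_comb _ _ _

lemma Dx_comb_sphere₁ (a : Fin m × ℕ → 𝕜) (p : Fin (m + 1) → L) :
    Dx L a (comb (sphere₁ a) p) = comb (sphere₂ a) p := Dx_comb _ _ _

lemma Dx_eq_sum (a : Fin m × ℕ → 𝕜) {c : LieSeries (JetIdx m 4) L}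
    (h1 : ∀ i, pd L (i, 1) c = 0) (h2 : ∀ i, pd L (i, 2) c = 0) :
    Dx L a c = ∑ i, jetU a 1 i • pd L (i, 0) c := by
  rw [Dx, field_apply, Fintype.sum_prod_type]
  refine sum_congr rfl fun i _ => ?_
  rw [Fin.sum_univ_three]
  change jetU a 1 i • pd L (i, 0) c + jetU a 2 i • pd L (i, 1) c + jetU a 3 i • pd L (i, 2) c = _
  rw [h1, h2, smul_zero, smul_zero, add_zero, add_zero]

end LieSeries

/-! ### The remainder of $B$ as a function of $u_0$, and its integrability. -/

namespace IsZCR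

open Finset MvPowerSeries LieSeries

variable {𝕜 : Type*} [RCLike 𝕜] {m : ℕ} {L : Type*} [LieRing L] [LieAlgebra 𝕜 L]
  {r : Fin (m + 1) → 𝕜} {a : Fin m × ℕ → 𝕜} {q₀ : L} {p : Fin (m + 1) → L}
  {B : LieSeries (JetIdx m 4) L}

lemma pd_zcrA (a : Fin m × ℕ → 𝕜) (q₀ : L) (p : Fin (m + 1) → L) (i : Fin m) :
    pd L (i, 0) (zcrA a q₀ p) = comb (sphereD a i) p := by
  rw [zcrA, map_add, pd_const, zero_add, pd_comb_sphere]

/-- The part of `B` that is not determined by the highest derivatives. -/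
def remainder (a : Fin m × ℕ → 𝕜) (q₀ : L) (p : Fin (m + 1) → L) (B : LieSeries (JetIdx m 4) L) :
    LieSeries (JetIdx m 4) L :=
  B - comb (sphereFlux a) p + ⁅zcrA a q₀ p, comb (sphere₁ a) p⁆

lemma pd_remainder_three (h : IsZCR r a (zcrA a q₀ p) B) (ha : a ∈ jetDomain 𝕜 m) (i : Fin m) :
    pd L (i, 3) (remainder a q₀ p B) = 0 := by
  rw [remainder, map_add, map_sub, h.pd_B, pd_lie, h.pd_A 3 (by decide), pd_comb, pd_comb]
  simp only [pderiv_sphereFlux_three ha, pderiv_sphere₁_three ha, comb_zero, lie_zero, zero_lie,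
    sub_zero, add_zero]

lemma pd_remainder_two (h : IsZCR r a (zcrA a q₀ p) B) (ha : a ∈ jetDomain 𝕜 m) (i : Fin m) :
    pd L (i, 2) (remainder a q₀ p B) = 0 := by
  rw [remainder, map_add, map_sub, h.pd_B_two ha, pd_zcrA, pd_lie, h.pd_A 2 (by decide), pd_comb,
    pd_comb]
  simp only [pderiv_sphereFlux_two ha, pderiv_sphere₁_two ha, comb_zero, lie_zero, zero_lie,
    add_zero]
  exact sub_self _

lemma pd_remainder_one (h : IsZCR r a (zcrA a q₀ p) B) (ha : a ∈ jetDomain 𝕜 m) (i : Fin m) :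
    pd L (i, 1) (remainder a q₀ p B) = 0 := by
  rw [remainder, map_add, map_sub, h.pd_B_one ha, pd_lie, h.pd_A 1 (by decide), zero_lie, zero_add,
    pd_comb_sphere₁_one ha, pd_comb]
  simp only [pd_zcrA, sum_smul_comb, sum_pderiv_jetF_mul_sphereD r ha, Dx_comb, comb_add]
  abel

lemma eq_remainder (B : LieSeries (JetIdx m 4) L) : B =
    comb (sphereFlux a) p - ⁅zcrA a q₀ p, comb (sphere₁ a) p⁆ + remainder a q₀ p B := by
  rw [remainder]
  abel

/-- The zero-curvature equation after the flux and the bracket with $S_x$ have been split off from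
$B$: the terms containing $S_{xx}$ have cancelled. -/
lemma remainder_equation (h : IsZCR r a (zcrA a q₀ p) B) (ha : a ∈ jetDomain 𝕜 m) :
    Dx L a (remainder a q₀ p B) - (C (3 / 2) * sphereQuad r a) • comb (sphere₁ a) p
      + (C (3 / 2) * (sphere₁ a ⬝ᵥ sphere₁ a)) • ⁅const (JetIdx m 4) L q₀, comb (sphere a) p⁆
      - ⁅zcrA a q₀ p, ⁅zcrA a q₀ p, comb (sphere₁ a) p⁆⁆
      + ⁅zcrA a q₀ p, remainder a q₀ p B⁆ = 0 := by
  have h1 := h.eq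
  have hDtA : Dt L r a (zcrA a q₀ p) = comb (fun b => scalarDx a (sphereFlux a b)) p +
      (C (3 / 2) * sphereQuad r a) • comb (sphere₁ a) p := by
    simp only [zcrA, map_add, Dt_const, Dt_comb, scalarDt_sphere r ha, comb_add, comb_mul, zero_add]
  have hflux : comb (sphereFlux a) p = comb (sphere₂ a) p +
      (C (3 / 2) * (sphere₁ a ⬝ᵥ sphere₁ a)) • comb (sphere a) p := by
    rw [← comb_mul, ← comb_add]
    rfl
  have hDxA : Dx L a (zcrA a q₀ p) = comb (sphere₁ a) p := by
    rw [zcrA, map_add, Dx_const, zero_add, Dx_comb_sphere]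
  have hDxB : Dx L a B = comb (fun b => scalarDx a (sphereFlux a b)) p
      - ⁅zcrA a q₀ p, comb (sphere₂ a) p⁆ + Dx L a (remainder a q₀ p B) := by
    conv_lhs => rw [eq_remainder (a := a) (q₀ := q₀) (p := p) B]
    rw [map_add, map_sub, Dx_lie, hDxA, Dx_comb_sphere₁, lie_self, zero_add, Dx_comb]
  have hAB : ⁅zcrA a q₀ p, B⁆ = ⁅zcrA a q₀ p, comb (sphere₂ a) p⁆
      + (C (3 / 2) * (sphere₁ a ⬝ᵥ sphere₁ a)) • ⁅const (JetIdx m 4) L q₀, comb (sphere a) p⁆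
      - ⁅zcrA a q₀ p, ⁅zcrA a q₀ p, comb (sphere₁ a) p⁆⁆
      + ⁅zcrA a q₀ p, remainder a q₀ p B⁆ := by
    have e : ⁅zcrA a q₀ p, comb (sphere a) p⁆ = ⁅const (JetIdx m 4) L q₀, comb (sphere a) p⁆ := by
      rw [zcrA, add_lie, lie_self, add_zero]
    conv_lhs => rw [eq_remainder (a := a) (q₀ := q₀) (p := p) B]
    rw [lie_add, lie_sub, hflux, lie_add, lie_smul, e]
  rw [hDxB, hDtA, hAB] at h1
  rw [← h1]
  abel

/-- This is the derivative of `remainder_equation` by $u^i_1$; the remainder depends on $u_0$ only,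
and $D_x$ of it is linear in $u_1$. -/
lemma remainder_linear (h : IsZCR r a (zcrA a q₀ p) B) (ha : a ∈ jetDomain 𝕜 m) (i : Fin m) :
    pd L (i, 0) (remainder a q₀ p B) - (C (3 / 2) * sphereQuad r a) • comb (sphereD a i) p
      + (12 * jetInv a ^ 2 * jetU a 1 i) • ⁅const (JetIdx m 4) L q₀, comb (sphere a) p⁆
      - ⁅zcrA a q₀ p, ⁅zcrA a q₀ p, comb (sphereD a i) p⁆⁆ = 0 := by
  have h1 := congrArg (pd L (i, 1)) (h.remainder_equation ha)
  have hk : (1 : Fin 4) ≠ 0 := by decide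
  have e1 : MvPowerSeries.pderiv 𝕜 (i, 1) (C (3 / 2) * (sphere₁ a ⬝ᵥ sphere₁ a)) =
      12 * jetInv a ^ 2 * jetU a 1 i := by
    rw [Derivation.leibniz, derivation_C, pderiv_sphere₁_dot_one ha, smul_zero, add_zero,
      smul_eq_mul]
    linear_combination 4 * jetInv a ^ 2 * jetU a 1 i * two_mul_C (𝕜 := 𝕜) (m := m)
  have e2 : MvPowerSeries.pderiv 𝕜 (i, 1) (C (3 / 2) * sphereQuad r a) = 0 := by
    rw [Derivation.leibniz, derivation_C, pderiv_sphereQuad_ne ha i hk, smul_zero, smul_zero,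
      add_zero]
  simp only [map_add, map_sub, map_zero, pd_Dx_one, pd_lie, pd_smul, e1, e2, pd_const,
    pd_comb_sphere₁_one ha, pd_comb_sphere_ne ha i hk, h.pd_A 1 hk, h.pd_remainder_one ha,
    zero_smul, zero_lie, lie_zero, smul_zero, add_zero, zero_add] at h1
  exact h1

/-- A second derivative by $u^i_1$ singles out the only term quadratic in $u_1$, which comes from
$\langle S_x,S_x\rangle$. Its coefficient $12\Delta^{-2}$ is invertible. -/
lemma const_lie_comb_sphere (h : IsZCR r a (zcrA a q₀ p) B) (ha : a ∈ jetDomain 𝕜 m)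
    (hm : 1 ≤ m) : ⁅const (JetIdx m 4) L q₀, comb (sphere a) p⁆ = 0 := by
  let i : Fin m := ⟨0, hm⟩
  have hk : (1 : Fin 4) ≠ 0 := by decide
  have h1 := congrArg (pd L (i, 1)) (h.remainder_linear ha i)
  have e1 : MvPowerSeries.pderiv 𝕜 (i, 1) (12 * jetInv a ^ 2 * jetU a 1 i) = 12 * jetInv a ^ 2 := by
    simp only [Derivation.leibniz, Derivation.leibniz_pow, pderiv_jetInv_ne ha i hk, pderiv_jetU',
      kron_self, derivation_twelve, smul_eq_mul, mul_one]
    simp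
  have e2 : MvPowerSeries.pderiv 𝕜 (i, 1) (C (3 / 2) * sphereQuad r a) = 0 := by
    rw [Derivation.leibniz, derivation_C, pderiv_sphereQuad_ne ha i hk, smul_zero, smul_zero,
      add_zero]
  have e3 : pd L (i, 1) (pd L (i, 0) (remainder a q₀ p B)) = 0 := by
    rw [pd_comm, h.pd_remainder_one ha, map_zero]
  simp only [map_add, map_sub, map_zero, pd_lie, pd_smul, e1, e2, pd_const,
    pd_comb_sphereD_ne ha i i hk, pd_comb_sphere_ne ha i hk, h.pd_A 1 hk,
    e3,
    zero_smul, zero_lie, lie_zero, smul_zero, add_zero, zero_add, sub_zero] at h1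
  refine (IsUnit.smul_eq_zero ?_).1 h1
  exact (isUnit_ofNat_series 12).mul ((isUnit_jetInv ha).pow 2)

lemma lie_q₀ (h : IsZCR r a (zcrA a q₀ p) B) (ha : a ∈ jetDomain 𝕜 m) (hm : 1 ≤ m)
    (b : Fin (m + 1)) : ⁅q₀, p b⁆ = 0 := by
  have h1 := h.const_lie_comb_sphere ha hm
  rw [const_lie_comb] at h1
  refine (const_add_comb_sphere_eq_zero hm ha (x₀ := (0 : L))
    (x := fun b => ⁅q₀, p b⁆) ?_).2 b
  rw [map_zero, zero_add, h1]

lemma zcrA_lie_comb (hq : ∀ b, ⁅q₀, p b⁆ = 0) (f : Fin (m + 1) → MvPowerSeries (JetIdx m 4) 𝕜) :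
    ⁅zcrA a q₀ p, comb f p⁆ = ⁅comb (sphere a) p, comb f p⁆ := by
  rw [zcrA, add_lie, const_lie_comb_eq_zero hq, zero_add]

lemma zcrA_lie_lie_comb (hq : ∀ b, ⁅q₀, p b⁆ = 0)
    (f : Fin (m + 1) → MvPowerSeries (JetIdx m 4) 𝕜) :
    ⁅zcrA a q₀ p, ⁅zcrA a q₀ p, comb f p⁆⁆ =
      ⁅comb (sphere a) p, ⁅comb (sphere a) p, comb f p⁆⁆ := by
  rw [zcrA_lie_comb hq, zcrA, add_lie, leibniz_lie (const (JetIdx m 4) L q₀), const_lie_comb_eq_zero hq,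
    const_lie_comb_eq_zero hq, zero_lie, lie_zero, zero_add, zero_add]

lemma pd_remainder_zero (h : IsZCR r a (zcrA a q₀ p) B) (ha : a ∈ jetDomain 𝕜 m) (hm : 1 ≤ m)
    (i : Fin m) : pd L (i, 0) (remainder a q₀ p B) =
      (C (3 / 2) * sphereQuad r a) • comb (sphereD a i) p
      + ⁅comb (sphere a) p, ⁅comb (sphere a) p, comb (sphereD a i) p⁆⁆ := by
  have h1 := h.remainder_linear ha i
  rw [h.const_lie_comb_sphere ha hm, smul_zero, add_zero, zcrA_lie_lie_comb (h.lie_q₀ ha hm)] at h1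
  rw [← sub_eq_zero, ← h1]
  abel

/-- The part of `remainder_equation` that is free of $u_1$: the linear part cancels once the
gradient of the remainder is inserted. -/
lemma zcrA_lie_remainder (h : IsZCR r a (zcrA a q₀ p) B) (ha : a ∈ jetDomain 𝕜 m) (hm : 1 ≤ m) :
    ⁅zcrA a q₀ p, remainder a q₀ p B⁆ = 0 := by
  have h1 := h.remainder_equation ha
  have e : comb (sphere₁ a) p = ∑ i, jetU a 1 i • comb (sphereD a i) p := by
    rw [sum_smul_comb]
    simp only [sum_jetU_mul_sphereD ha]
  rw [Dx_eq_sum a (h.pd_remainder_one ha) (h.pd_remainder_two ha), h.const_lie_comb_sphere ha hm,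
    zcrA_lie_lie_comb (h.lie_q₀ ha hm), e] at h1
  simp only [h.pd_remainder_zero ha hm, smul_add, sum_add_distrib, lie_sum, lie_smul, smul_sum,
    smul_comm (jetU a 1 _), smul_zero, add_zero] at h1
  rw [← h1]
  abel

/-- Symmetry of the second derivatives of the remainder. The derivative of $\tfrac32\langle
S,RS\rangle$ gives a factor 3, and the Jacobi identity collects the double brackets into three equal
ones, so 3 can be cancelled. -/
lemma sphere_integrability (h : IsZCR r a (zcrA a q₀ p) B) (ha : a ∈ jetDomain 𝕜 m) (hm : 1 ≤ m)
    (i j : Fin m) :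
    ⁅comb (sphere a) p, ⁅comb (sphereD a j) p, comb (sphereD a i) p⁆⁆
      + (∑ b, C (r b) * sphere a b * sphereD a j b) • comb (sphereD a i) p
      - (∑ b, C (r b) * sphere a b * sphereD a i b) • comb (sphereD a j) p = 0 := by
  have h1 := pd_comm (j, 0) (i, 0) (remainder a q₀ p B)
  have hq (i : Fin m) : MvPowerSeries.pderiv 𝕜 (i, 0) (C (3 / 2) * sphereQuad r a) =
      3 * ∑ b, C (r b) * sphere a b * sphereD a i b := by
    rw [Derivation.leibniz, derivation_C, derivation_sphereQuad r ha, smul_zero, add_zero,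
      smul_eq_mul, ← mul_assoc, mul_comm _ (2 : MvPowerSeries (JetIdx m 4) 𝕜), two_mul_C]
    rfl
  have hD : pd L (j, 0) (comb (sphereD a i) p) = pd L (i, 0) (comb (sphereD a j) p) := by
    rw [← pd_comb_sphere, ← pd_comb_sphere, pd_comm]
  simp only [h.pd_remainder_zero ha hm, map_add, pd_smul, pd_lie, pd_comb_sphere, hq, hD,
    lie_add] at h1
  have hJ := leibniz_lie (comb (sphere a) p) (comb (sphereD a j) p) (comb (sphereD a i) p)
  have hJ2 : ⁅⁅comb (sphere a) p, comb (sphereD a j) p⁆, comb (sphereD a i) p⁆ =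
    -⁅comb (sphereD a i) p, ⁅comb (sphere a) p, comb (sphereD a j) p⁆⁆ := (lie_skew _ _).symm
  have hJ3 : ⁅comb (sphere a) p, ⁅comb (sphereD a i) p, comb (sphereD a j) p⁆⁆ =
      -⁅comb (sphere a) p, ⁅comb (sphereD a j) p, comb (sphereD a i) p⁆⁆ := by
    rw [← lie_neg, lie_skew]
  rw [hJ2] at hJ
  rw [hJ3] at h1
  refine (isUnit_ofNat_series (𝕜 := 𝕜) (σ := JetIdx m 4) 3).smul_eq_zero.1 ?_
  generalize pd L (i, 0) (comb (sphereD a j) p) = z₀ at *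
  generalize ⁅comb (sphere a) p, ⁅comb (sphereD a j) p, comb (sphereD a i) p⁆⁆ = z₁ at *
  generalize ⁅comb (sphereD a i) p, ⁅comb (sphere a) p, comb (sphereD a j) p⁆⁆ = z₂ at *
  generalize ⁅comb (sphereD a j) p, ⁅comb (sphere a) p, comb (sphereD a i) p⁆⁆ = z₃ at *
  have h3 : (3 : MvPowerSeries (JetIdx m 4) 𝕜) • z₁ = z₁ + z₁ + z₁ := by
    rw [show (3 : MvPowerSeries (JetIdx m 4) 𝕜) = 1 + 1 + 1 by norm_num, add_smul, add_smul,
      one_smul]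
  rw [smul_sub, smul_add, smul_smul, smul_smul, h3]
  rw [← sub_eq_zero] at h1 hJ
  have h4 := congrArg₂ (· + ·) h1 hJ
  rw [add_zero] at h4
  rw [← h4]
  abel

end IsZCR

/-! ### The relations of `𝔤(n)` from the integrability condition -/

section Relations

open Finset MvPowerSeries LieSeries

variable {𝕜 : Type*} [RCLike 𝕜] {L : Type*} [LieRing L] [LieAlgebra 𝕜 L]

/-- The values on the basis of the trilinear map `[X, [Y, Z]] + ⟨RX, Y⟩ Z - ⟨RX, Z⟩ Y`. -/
def gTensor {n : ℕ} (r : Fin n → 𝕜) (p : Fin n → L) (b c d : Fin n) : L :=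
  ⁅p b, ⁅p c, p d⁆⁆ + (if b = c then r b • p d else 0) - (if b = d then r b • p c else 0)

lemma gTensor_skew {n : ℕ} (r : Fin n → 𝕜) (p : Fin n → L) (b c d : Fin n) :
    gTensor r p b c d = -gTensor r p b d c := by
  rw [gTensor, gTensor, ← lie_skew (p d) (p c), lie_neg]
  abel

/-- The Kronecker terms of `gTensor` vanish for distinct indices, and for two equal leading indices
they reproduce the summand $r_ip_k$. -/
lemma gRel_of_gTensor {n : ℕ} {r : Fin n → 𝕜} {p : Fin n → L}
    (h₁ : ∀ i j k, i ≠ j → j ≠ k → k ≠ i → gTensor r p i j k = 0)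
    (h₂ : ∀ i j k, i ≠ k → j ≠ k → gTensor r p i i k = gTensor r p j j k) : GRel r p := by
  constructor
  · intro i j k hij hjk hki
    simpa [gTensor, hij, hki.symm] using h₁ i j k hij hjk hki
  · intro i j k hik hjk
    simpa [gTensor, hik, hjk] using h₂ i j k hik hjk

lemma LieSeries.comb_gTensor {σ : Type*} [DecidableEq σ] {n : ℕ} (r : Fin n → 𝕜) (p : Fin n → L)
    (f g k : Fin n → MvPowerSeries σ 𝕜) :
    comb (fun t : Fin n × Fin n × Fin n => f t.1 * g t.2.1 * k t.2.2)
      (fun t => gTensor r p t.1 t.2.1 t.2.2) =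
    ⁅comb f p, ⁅comb g p, comb k p⁆⁆ + (∑ b, C (r b) * f b * g b) • comb k p
      - (∑ b, C (r b) * f b * k b) • comb g p := by
  have h1 : ⁅comb f p, ⁅comb g p, comb k p⁆⁆ =
      ∑ b, ∑ c, ∑ d, (f b * g c * k d) • const σ L ⁅p b, ⁅p c, p d⁆⁆ := by
    rw [comb_def f, sum_lie]
    refine sum_congr rfl fun b _ => ?_
    rw [comb_def g, sum_lie, lie_sum]
    refine sum_congr rfl fun c _ => ?_
    rw [comb_def k, lie_sum, lie_sum]
    refine sum_congr rfl fun d _ => ?_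
    simp only [smul_lie, lie_smul, const_lie, smul_smul]
    exact congrArg (· • _) (by ring)
  have h2 (b c : Fin n) : ∑ d, (f b * g c * k d) • const σ L (if b = c then r b • p d else 0) =
      if b = c then (C (r b) * f b * g c) • comb k p else 0 := by
    split_ifs
    · rw [comb, smul_sum]
      refine sum_congr rfl fun d _ => ?_
      rw [const_smul, smul_smul, smul_smul]
      exact congrArg (· • _) (by ring)
    · simp
  have h3 (b c : Fin n) : ∑ d, (f b * g c * k d) • const σ L (if b = d then r b • p c else 0) =
      (C (r b) * f b * k b * g c) • const σ L (p c) := by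
    rw [sum_eq_single b]
    · rw [if_pos rfl, const_smul, smul_smul]
      exact congrArg (· • _) (by ring)
    · intro d _ hd
      rw [if_neg (Ne.symm hd), map_zero, smul_zero]
    · simp
  rw [comb, Fintype.sum_prod_type]
  simp only [Fintype.sum_prod_type, gTensor, map_add, map_sub, smul_add, smul_sub, sum_add_distrib,
    sum_sub_distrib, h2, h3, sum_ite_eq, mem_univ, if_true]
  rw [h1, sum_smul, sum_smul]
  refine congrArg _ (sum_congr rfl fun b _ => ?_)
  rw [comb, smul_sum]
  exact sum_congr rfl fun c _ => mul_smul _ _ _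

/-- The trilinear map with given values on the basis. -/
def trilinear {n : ℕ} (τ : Fin n → Fin n → Fin n → L) :
    (Fin n → 𝕜) →ₗ[𝕜] (Fin n → 𝕜) →ₗ[𝕜] (Fin n → 𝕜) →ₗ[𝕜] L :=
  Fintype.linearCombination 𝕜 fun b => Fintype.linearCombination 𝕜 fun c =>
    Fintype.linearCombination 𝕜 (τ b c)

lemma trilinear_apply {n : ℕ} (τ : Fin n → Fin n → Fin n → L) (X Y Z : Fin n → 𝕜) :
    trilinear τ X Y Z = ∑ b, ∑ c, ∑ d, (X b * Y c * Z d) • τ b c d := by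
  simp only [trilinear, Fintype.linearCombination_apply, LinearMap.sum_apply, LinearMap.smul_apply,
    smul_sum, smul_smul, mul_assoc]

lemma trilinear_single {n : ℕ} (τ : Fin n → Fin n → Fin n → L) (b c d : Fin n) :
    trilinear τ (Pi.single b (1 : 𝕜)) (Pi.single c 1) (Pi.single d 1) = τ b c d := by
  simp only [trilinear, Fintype.linearCombination_apply_single, one_smul]

variable {m : ℕ} {a : Fin m × ℕ → 𝕜}

/-- The polynomials `Δ² ∂S/∂u^i`. -/
def sphereDPoly (i : Fin m) : Fin (m + 1) → MvPolynomial (Fin m) 𝕜 :=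
  Fin.snoc (α := fun _ => MvPolynomial (Fin m) 𝕜)
    (fun j => 2 * (1 + MvPolynomial.X ⬝ᵥ MvPolynomial.X) * (if i = j then 1 else 0)
      - 4 * MvPolynomial.X i * MvPolynomial.X j)
    (-4 * MvPolynomial.X i)

lemma polyJet_sphereDPoly (ha : a ∈ jetDomain 𝕜 m) (i : Fin m) (b : Fin (m + 1)) :
    polyJet a (sphereDPoly i b) = jetDen a ^ 2 * sphereD a i b := by
  have h := jetDen_mul_jetInv ha
  have h2 : jetDen a ^ 2 * jetInv a ^ 2 = 1 := by rw [← mul_pow, h, one_pow]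
  induction b using Fin.lastCases with
  | last =>
    rw [sphereDPoly, Fin.snoc_last, sphereD_last ha]
    simp only [map_mul, map_neg, map_ofNat, polyJet_X]
    linear_combination 4 * jetU a 0 i * h2
  | cast j =>
    rw [sphereDPoly, Fin.snoc_castSucc, sphereD_castSucc ha]
    have e : polyJet a (if i = j then 1 else 0) = kron i j := by
      rw [kron]
      split_ifs <;> simp
    simp only [map_sub, map_mul, map_add, map_ofNat, map_one, polyJet_X, polyJet_dot, e]
    change 2 * jetDen a * kron i j - _ = _
    linear_combination 4 * jetU a 0 i * jetU a 0 j * h2 - 2 * jetDen a * kron i j * h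

variable (𝕜) in
/-- The basis vectors of `𝕜ⁿ`. -/
abbrev stdVec {n : ℕ} (b : Fin n) : Fin n → 𝕜 := Pi.single b 1

/-- The inclusion of `𝕜^m` into `𝕜^{m+1}` as the first `m` coordinates. -/
def inclVec : (Fin m → 𝕜) →ₗ[𝕜] Fin (m + 1) → 𝕜 :=
  Fintype.linearCombination 𝕜 fun i => stdVec 𝕜 i.castSucc

lemma inclVec_single (i : Fin m) (t : 𝕜) :
    inclVec (Pi.single i t) = t • stdVec 𝕜 i.castSucc := by
  rw [inclVec, Fintype.linearCombination_apply_single]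

lemma inclVec_castSucc (y : Fin m → 𝕜) (i : Fin m) : inclVec y i.castSucc = y i := by
  simp [inclVec, Fintype.linearCombination_apply, Pi.single_apply, Fin.castSucc_inj]

lemma inclVec_last (y : Fin m → 𝕜) : inclVec y (Fin.last m) = 0 := by
  simp [inclVec, Fintype.linearCombination_apply, (Fin.castSucc_lt_last _).ne']

/-- The values of the polynomials `Δ S`. -/
def sphereVec (y : Fin m → 𝕜) : Fin (m + 1) → 𝕜 :=
  (2 : 𝕜) • inclVec y + (1 - y ⬝ᵥ y) • stdVec 𝕜 (Fin.last m)

/-- The values of the polynomials `Δ² ∂S/∂c`, where `∂/∂c` is the derivative along `c`. -/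
def tangentVec (y c : Fin m → 𝕜) : Fin (m + 1) → 𝕜 :=
  (2 * (1 + y ⬝ᵥ y)) • inclVec c - (4 * (c ⬝ᵥ y)) • (inclVec y + stdVec 𝕜 (Fin.last m))

lemma eval_spherePoly (y : Fin m → 𝕜) (b : Fin (m + 1)) :
    MvPolynomial.eval y (spherePoly b) = sphereVec y b := by
  induction b using Fin.lastCases with
  | last => simp [spherePoly, sphereVec, inclVec_last, dotProduct]
  | cast i => simp [spherePoly, sphereVec, inclVec_castSucc, (Fin.castSucc_lt_last _).ne]

lemma sum_eval_sphereDPoly (y c : Fin m → 𝕜) (b : Fin (m + 1)) :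
    ∑ i, c i * MvPolynomial.eval y (sphereDPoly i b) = tangentVec y c b := by
  induction b using Fin.lastCases with
  | last =>
    simp only [sphereDPoly, Fin.snoc_last, tangentVec, Pi.sub_apply, Pi.smul_apply, Pi.add_apply,
      inclVec_last, Pi.single_eq_same, dotProduct, map_mul, map_neg, map_ofNat, MvPolynomial.eval_X,
      smul_eq_mul, mul_zero, zero_sub, zero_add, mul_one, mul_sum, ← sum_neg_distrib]
    exact sum_congr rfl fun i _ => by ring
  | cast j =>
    have e (i : Fin m) : c i * MvPolynomial.eval y (sphereDPoly i j.castSucc) =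
        (if j = i then 2 * (1 + y ⬝ᵥ y) * c i else 0) - 4 * (c i * y i) * y j := by
      simp only [sphereDPoly, Fin.snoc_castSucc, dotProduct, eq_comm (a := j)]
      split_ifs <;> simp <;> ring
    simp only [e, sum_sub_distrib, sum_ite_eq, mem_univ, if_true, ← sum_mul, ← mul_sum]
    simp [tangentVec, inclVec_castSucc, (Fin.castSucc_lt_last _).ne, dotProduct]

variable {r : Fin (m + 1) → 𝕜} {p : Fin (m + 1) → L}

/-- The integrability condition, known as an identity of power series at `a`, is transferred to
every `y`; by linearity it holds for arbitrary tangent directions. -/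
lemma trilinear_tangentVec_eq_zero (ha : a ∈ jetDomain 𝕜 m)
    (h : ∀ i j, ⁅comb (sphere a) p, ⁅comb (sphereD a j) p, comb (sphereD a i) p⁆⁆
      + (∑ b, C (r b) * sphere a b * sphereD a j b) • comb (sphereD a i) p
      - (∑ b, C (r b) * sphere a b * sphereD a i b) • comb (sphereD a j) p = 0)
    (y c d : Fin m → 𝕜) :
    trilinear (gTensor r p) (sphereVec y) (tangentVec y c) (tangentVec y d) = 0 := by
  have h1 (j i : Fin m) : trilinear (gTensor r p) (sphereVec y)
      (fun b => MvPolynomial.eval y (sphereDPoly j b))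
      (fun b => MvPolynomial.eval y (sphereDPoly i b)) = 0 := by
    have h2 := h i j
    rw [← comb_gTensor] at h2
    -- The exponent 5 is 1 for $S$ and 2 for each of the two derivatives of $S$; it clears all
    -- denominators.
    have h3 := congrArg (jetDen a ^ 5 • ·) h2
    simp only [smul_zero, ← comb_mul] at h3
    have h4 (t : Fin (m + 1) × Fin (m + 1) × Fin (m + 1)) :
        jetDen a ^ 5 * (sphere a t.1 * sphereD a j t.2.1 * sphereD a i t.2.2) =
        polyJet a (spherePoly t.1 * sphereDPoly j t.2.1 * sphereDPoly i t.2.2) := by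
      rw [map_mul, map_mul, polyJet_spherePoly ha, polyJet_sphereDPoly ha, polyJet_sphereDPoly ha]
      ring
    simp only [h4] at h3
    have h5 := sum_eval_smul_eq_zero h3 y
    simp only [Fintype.sum_prod_type, map_mul, eval_spherePoly] at h5
    rw [trilinear_apply]
    exact h5
  have h2 (c : Fin m → 𝕜) : tangentVec y c =
      ∑ i, c i • fun b => MvPolynomial.eval y (sphereDPoly i b) := by
    funext b
    rw [← sum_eval_sphereDPoly, Finset.sum_apply]
    rfl
  rw [h2 c, h2 d]
  simp only [map_sum, LinearMap.sum_apply, map_smul, LinearMap.smul_apply, h1, smul_zero,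
    sum_const_zero]

theorem gRel_of_trilinear
    (h : ∀ y c d : Fin m → 𝕜,
      trilinear (gTensor r p) (sphereVec y) (tangentVec y c) (tangentVec y d) = 0) : GRel r p := by
  have two : (2 : 𝕜) ≠ 0 := two_ne_zero
  have four : (4 : 𝕜) ≠ 0 := by norm_num
  -- The point $y=0$ is the pole $e_n$, with tangent directions $e_i$; in `t1` and `t1'` the point
  -- $y=e_k$ gives $2e_k$, with tangent directions $e_i$, $i\ne k$, and $e_n$.
  have t0 (i j : Fin m) : gTensor r p (Fin.last m) i.castSucc j.castSucc = 0 := by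
    have h1 := h 0 (Pi.single i 1) (Pi.single j 1)
    simpa [sphereVec, tangentVec, inclVec_single, trilinear_single, two] using h1
  have t1 (k i j : Fin m) (hi : i ≠ k) (hj : j ≠ k) :
      gTensor r p k.castSucc i.castSucc j.castSucc = 0 := by
    have h1 := h (Pi.single k 1) (Pi.single i 1) (Pi.single j 1)
    have e : (2 : 𝕜) * (1 + 1) ≠ 0 := by norm_num
    simpa [sphereVec, tangentVec, inclVec_single, trilinear_single, two, hi, hj, e] using h1
  have t1' (k i : Fin m) (hi : i ≠ k) :
      gTensor r p k.castSucc i.castSucc (Fin.last m) = 0 := by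
    have h1 := h (Pi.single k 1) (Pi.single i 1) (Pi.single k 1)
    have e : (2 : 𝕜) * (1 + 1) ≠ 0 := by norm_num
    have e2 : tangentVec (Pi.single k (1 : 𝕜)) (Pi.single k 1) =
        (-4 : 𝕜) • stdVec 𝕜 (Fin.last m) := by
      simp only [tangentVec, inclVec_single, dotProduct_single, Pi.single_eq_same]
      module
    rw [e2] at h1
    simpa [sphereVec, tangentVec, inclVec_single, trilinear_single, two, hi, e, four] using h1
  have t2 (k i : Fin m) (hi : i ≠ k) : gTensor r p k.castSucc k.castSucc i.castSucc =
      gTensor r p (Fin.last m) (Fin.last m) i.castSucc := by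
    -- A rational point on the circle through $e_k$ and $e_n$: up to scale it is $(4/5,3/5)$. The
    -- tangent vector in the same plane mixes the components $kk$ and $nn$.
    have h1 := h (Pi.single k (1 / 2)) (Pi.single k 1) (Pi.single i 1)
    have e1 : sphereVec (Pi.single k (1 / 2 : 𝕜)) =
        stdVec 𝕜 k.castSucc + (3 / 4 : 𝕜) • stdVec 𝕜 (Fin.last m) := by
      simp only [sphereVec, inclVec_single, dotProduct_single, Pi.single_eq_same]
      module
    have e2 : tangentVec (Pi.single k (1 / 2 : 𝕜)) (Pi.single k 1) =
        (3 / 2 : 𝕜) • stdVec 𝕜 k.castSucc - (2 : 𝕜) • stdVec 𝕜 (Fin.last m) := by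
      simp only [tangentVec, inclVec_single, dotProduct_single, Pi.single_eq_same]
      module
    have e3 : tangentVec (Pi.single k (1 / 2 : 𝕜)) (Pi.single i 1) =
        (5 / 2 : 𝕜) • stdVec 𝕜 i.castSucc := by
      simp only [tangentVec, inclVec_single, dotProduct_single, Pi.single_eq_same,
        Pi.single_eq_of_ne (Ne.symm hi)]
      module
    rw [e1, e2, e3] at h1
    simp only [map_add, map_sub, map_smul, LinearMap.add_apply, LinearMap.sub_apply,
      LinearMap.smul_apply, trilinear_single, t0, gTensor_skew r p k.castSucc (Fin.last m),
      t1' k i hi] at h1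
    have h2 : (15 / 4 : 𝕜) • (gTensor r p k.castSucc k.castSucc i.castSucc -
      gTensor r p (Fin.last m) (Fin.last m) i.castSucc) = 0 := by
      rw [← h1]
      module
    exact sub_eq_zero.1 ((smul_eq_zero.1 h2).resolve_left (by norm_num))
  have t3 (k l : Fin m) (hkl : k ≠ l) : gTensor r p k.castSucc k.castSucc (Fin.last m) =
      gTensor r p l.castSucc l.castSucc (Fin.last m) := by
    -- The point must satisfy $\langle y,y\rangle=1$, so that it lies on the equator and the radial
    -- direction becomes tangent along $e_n$; the triple 3, 4, 5 keeps it rational. The other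
    -- direction is the rotation in the plane of $e_k$ and $e_l$.
    have h1 := h (Pi.single k (3 / 5) + Pi.single l (4 / 5))
      (Pi.single k (4 / 5) - Pi.single l (3 / 5)) (Pi.single k (3 / 5) + Pi.single l (4 / 5))
    have hy : (Pi.single k (3 / 5) + Pi.single l (4 / 5) : Fin m → 𝕜) ⬝ᵥ
        (Pi.single k (3 / 5) + Pi.single l (4 / 5)) = 1 := by
      simp [dotProduct_add, hkl, hkl.symm]
      norm_num
    have hd : (Pi.single k (4 / 5) - Pi.single l (3 / 5) : Fin m → 𝕜) ⬝ᵥ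
        (Pi.single k (3 / 5) + Pi.single l (4 / 5)) = 0 := by
      simp [dotProduct_add, hkl, hkl.symm]
      norm_num
    have e1 : sphereVec (Pi.single k (3 / 5) + Pi.single l (4 / 5) : Fin m → 𝕜) =
        (6 / 5 : 𝕜) • stdVec 𝕜 k.castSucc + (8 / 5 : 𝕜) • stdVec 𝕜 l.castSucc := by
      rw [sphereVec, hy, map_add, inclVec_single, inclVec_single]
      module
    have e2 : tangentVec (Pi.single k (3 / 5) + Pi.single l (4 / 5) : Fin m → 𝕜)
        (Pi.single k (3 / 5) + Pi.single l (4 / 5)) = (-4 : 𝕜) • stdVec 𝕜 (Fin.last m) := by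
      rw [tangentVec, hy]
      module
    have e3 : tangentVec (Pi.single k (3 / 5) + Pi.single l (4 / 5) : Fin m → 𝕜)
        (Pi.single k (4 / 5) - Pi.single l (3 / 5)) =
        (16 / 5 : 𝕜) • stdVec 𝕜 k.castSucc - (12 / 5 : 𝕜) • stdVec 𝕜 l.castSucc := by
      rw [tangentVec, hy, hd, map_sub, inclVec_single, inclVec_single]
      module
    rw [e1, e2, e3] at h1
    simp only [map_add, map_sub, map_smul,
      LinearMap.add_apply, LinearMap.sub_apply, smul_add, smul_sub,
      LinearMap.smul_apply, trilinear_single, t1' k l hkl.symm, t1' l k hkl] at h1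
    have h2 : (-384 / 25 : 𝕜) • (gTensor r p k.castSucc k.castSucc (Fin.last m) -
      gTensor r p l.castSucc l.castSucc (Fin.last m)) = 0 := by
      rw [← h1]
      module
    exact sub_eq_zero.1 ((smul_eq_zero.1 h2).resolve_left (by norm_num))
  refine gRel_of_gTensor (fun i j k hij hjk hki => ?_) (fun i j k hik hjk => ?_)
  · induction i using Fin.lastCases with
    | last =>
      induction j using Fin.lastCases with
      | last => exact absurd rfl hij
      | cast j =>
        induction k using Fin.lastCases with
        | last => exact absurd rfl hki
        | cast k => exact t0 j k
    | cast i =>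
      induction j using Fin.lastCases with
      | last =>
        induction k using Fin.lastCases with
        | last => exact absurd rfl hjk
        | cast k => rw [gTensor_skew, t1' i k fun h => hki (by rw [h]), neg_zero]
      | cast j =>
        induction k using Fin.lastCases with
        | last => exact t1' i j fun h => hij (by rw [h])
        | cast k => exact t1 i j k (fun h => hij (by rw [h])) (fun h => hki (by rw [h]))
  · induction k using Fin.lastCases with
    | last =>
      induction i using Fin.lastCases with
      | last => exact absurd rfl hik
      | cast i =>
        induction j using Fin.lastCases with
        | last => exact absurd rfl hjk
        | cast j =>
          by_cases hij : i = j
          · rw [hij]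
          · exact t3 i j hij
    | cast k =>
      have key (i : Fin (m + 1)) (hik : i ≠ k.castSucc) : gTensor r p i i k.castSucc =
          gTensor r p (Fin.last m) (Fin.last m) k.castSucc := by
        induction i using Fin.lastCases with
        | last => rfl
        | cast i => exact t2 i k fun h => hik (by rw [h])
      rw [key i hik, key j hjk]

end Relations

/-! ### The form of the solutions of the zero-curvature equation -/

namespace IsZCR

open Finset MvPowerSeries LieSeries

variable {𝕜 : Type*} [RCLike 𝕜] {m : ℕ} {L : Type*} [LieRing L] [LieAlgebra 𝕜 L]
  {r : Fin (m + 1) → 𝕜} {a : Fin m × ℕ → 𝕜}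

/-- Every solution of the zero-curvature equation comes from elements with the relations of
`hAlgebra r`. -/
theorem exists_hRel {A B : LieSeries (JetIdx m 4) L} (h : IsZCR r a A B) (hm : 2 ≤ m)
    {o : Fin (m + 1) → Fin (m + 1)} (ho : ∀ k, o k ≠ k) (ha : a ∈ jetDomain 𝕜 m) :
    ∃ (q₀ q₁ : L) (p : Fin (m + 1) → L), HRel r q₀ q₁ p ∧ A = zcrA a q₀ p ∧
      B = zcrB r a q₁ p (gTower o r p 1) := by
  obtain ⟨q₀, p, rfl⟩ := h.exists_eq_zcrA ha hm
  have hm1 : 1 ≤ m := by omega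
  have hm3 : 3 ≤ m + 1 := by omega
  have hg : GRel r p := gRel_of_trilinear
    (trilinear_tangentVec_eq_zero ha (h.sphere_integrability ha hm1))
  have hq₀ := h.lie_q₀ ha hm1
  have hn' := fun i j => Fin.exists_ne_and_ne hm3 i j
  have H := hg.towerRel ho hn' 1
  set p' := gTower o r p 1 with hp'
  have hs : ⁅comb (sphere a) p, comb (sphere a) p'⁆ = 0 := by
    refine comb_lie_comb_eq_zero (fun b c hbc => ?_) (fun b => ?_) _
    · have h1 := H.skew' (s := 1) le_rfl hbc
      change ⁅p c, _⁆ = -⁅p b, _⁆ at h1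
      rw [h1, add_neg_cancel]
    · exact H.lie_same 0 1 le_rfl b
  have hq₀' : ∀ b, ⁅q₀, p' b⁆ = 0 := by
    intro b
    change ⁅q₀, ⁅p (o b), ⁅p (o b), p b⁆⁆ + r (o b) • p b⁆ = 0
    simp only [lie_add, lie_smul, leibniz_lie q₀, hq₀, zero_lie, lie_zero, smul_zero, add_zero]
  -- The gradient of the remainder is now computed from the relations of $\mathfrak g(n)$, with
  -- $\langle S,S\rangle=1$ and $\langle S,\partial_iS\rangle=0$. It agrees with that of the
  -- explicit expression from `zcrB`, so the difference is a constant.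
  obtain ⟨q₁, hq₁⟩ := LieSeries.exists_eq_const 𝕜 (c := remainder a q₀ p B -
      (comb (sphere a) p' + (C (1 / 2) * sphereQuad r a) • comb (sphere a) p)) (fun i => by
    have hT := comb_lie_comb_lie_comb (hg.lie_lie_eq hm3 ho) (sphere a) (sphere a) (sphereD a i)
    have e1 : ∑ b, sphere a b * sphere a b = 1 := sphere_dot_sphere ha
    have e2 : ∑ b, C (r b) * sphere a b * sphere a b = sphereQuad r a := by
      rw [← sum_sphere_sq r ha]
      exact sum_congr rfl fun b _ => by ring
    have e3 : ∑ b, sphere a b * sphereD a i b = 0 := sphere_dot_derivation ha _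
    have e4 : MvPowerSeries.pderiv 𝕜 (i, 0) (C (1 / 2) * sphereQuad r a) =
        ∑ b, C (r b) * sphere a b * sphereD a i b := by
      rw [Derivation.leibniz, derivation_C, derivation_sphereQuad r ha, smul_zero, add_zero,
        smul_eq_mul, ← mul_assoc, C_half_mul_two, one_mul]
      rfl
    have e5 : (C (3 / 2) : MvPowerSeries (JetIdx m 4) 𝕜) = C (1 / 2) + 1 := by
      rw [← map_one (C (σ := JetIdx m 4) (R := 𝕜)), ← map_add]
      congr 1
      norm_num
    rw [map_sub, map_add, pd_smul, h.pd_remainder_zero ha hm1, hT, e1, e2, e3, e4, pd_comb_sphere,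
      pd_comb_sphere, e5]
    simp only [add_mul, add_smul, one_mul, one_smul, zero_smul]
    abel) (fun k hk i => by
    have h1 : pd L (i, k) (remainder a q₀ p B) = 0 := by
      fin_cases k
      · exact absurd rfl hk
      · exact h.pd_remainder_one ha i
      · exact h.pd_remainder_two ha i
      · exact h.pd_remainder_three ha i
    rw [map_sub, map_add, pd_smul, h1, pd_comb_sphere_ne ha i hk, pd_comb_sphere_ne ha i hk,
      Derivation.leibniz, derivation_C, pderiv_sphereQuad_ne ha i hk]
    simp)
  have hD : remainder a q₀ p B =
      comb (sphere a) p' + (C (1 / 2) * sphereQuad r a) • comb (sphere a) p + const _ L q₁ := by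
    rw [← hq₁]
    abel
  have hAD := h.zcrA_lie_remainder ha hm1
  -- In the bracket of $A$ with the remainder only the contributions of `q₁` survive; independence
  -- of $1,S^1,\dots,S^n$ separates them.
  have hAD' : const (JetIdx m 4) L ⁅q₀, q₁⁆ + comb (sphere a) (fun b => -⁅q₁, p b⁆) = 0 := by
    have e1 : ⁅comb (sphere a) p, const (JetIdx m 4) L q₁⁆ = comb (sphere a) fun b => -⁅q₁, p b⁆ := by
      rw [← lie_skew, const_lie_comb]
      simp only [comb, map_neg, smul_neg, sum_neg_distrib]
    rw [← hAD, hD, zcrA, add_lie, lie_add, lie_add, lie_add, lie_add, lie_smul, lie_smul, hs,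
      lie_self, const_lie_comb_eq_zero hq₀, const_lie_comb_eq_zero hq₀', const_lie, e1]
    simp
  obtain ⟨h1, h2⟩ := const_add_comb_sphere_eq_zero hm1 ha hAD'
  refine ⟨q₀, q₁, p, ⟨hg, hq₀, fun b => neg_eq_zero.1 (h2 b), h1⟩, rfl, ?_⟩
  rw [eq_remainder (a := a) (q₀ := q₀) (p := p) B, hD, zcrA_lie_comb hq₀, zcrB]
  abel

end IsZCR

/-! ### The structure of the Wahlquist–Estabrook algebra -/

section WEStructure

open LieSeries

variable {𝕜 : Type*} [RCLike 𝕜] {m : ℕ} {L : Type*} [LieRing L] [LieAlgebra 𝕜 L]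
  {L' : Type*} [LieRing L'] [LieAlgebra 𝕜 L'] {r : Fin (m + 1) → 𝕜} {a : Fin m × ℕ → 𝕜}

lemma map_gTower {n : ℕ} (f : L →ₗ⁅𝕜⁆ L') (o : Fin n → Fin n) (r : Fin n → 𝕜) (p : Fin n → L)
    (s : ℕ) (k : Fin n) : f (gTower o r p s k) = gTower o r (fun l => f (p l)) s k := by
  induction s with
  | zero => rfl
  | succ s ih =>
    change f (⁅p (o k), ⁅p (o k), gTower o r p s k⁆⁆ + r (o k) • gTower o r p s k) = _
    rw [map_add, LieHom.map_lie, LieHom.map_lie, map_smul, ih]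
    rfl

lemma map_zcrA (f : L →ₗ⁅𝕜⁆ L') (q₀ : L) (p : Fin (m + 1) → L) :
    map f (zcrA a q₀ p) = zcrA a (f q₀) fun l => f (p l) := by
  rw [zcrA, map_add, LieSeries.map_const, map_comb, zcrA]

lemma map_zcrB (f : L →ₗ⁅𝕜⁆ L') (q₁ : L) (p p' : Fin (m + 1) → L) :
    map f (zcrB r a q₁ p p') = zcrB r a (f q₁) (fun l => f (p l)) fun l => f (p' l) := by
  rw [zcrB, map_add, map_add, map_add, map_sub, map_smul, LieHom.map_lie, LieSeries.map_const, map_comb,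
    map_comb, map_comb, map_comb, zcrB]

/-- The parameters of a solution can be recovered from it; this identifies the images of the
generators under a homomorphism that is known only through its action on the series. -/
lemma zcrA_injective (hm : 1 ≤ m) (ha : a ∈ jetDomain 𝕜 m) {q₀ q₀' : L} {p p' : Fin (m + 1) → L}
    (h : zcrA a q₀ p = zcrA a q₀' p') : q₀ = q₀' ∧ p = p' := by
  have h1 : const _ L (q₀ - q₀') + comb (sphere a) (fun b => p b - p' b) = 0 := by
    have h2 : comb (sphere a) (fun b => p b - p' b) = comb (sphere a) p - comb (sphere a) p' := by
      simp only [comb, map_sub, smul_sub, Finset.sum_sub_distrib]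
    rw [map_sub, h2, sub_add_sub_comm]
    exact sub_eq_zero.2 h
  obtain ⟨h2, h3⟩ := const_add_comb_sphere_eq_zero hm ha h1
  exact ⟨sub_eq_zero.1 h2, funext fun b => sub_eq_zero.1 (h3 b)⟩

lemma zcrB_injective {q₁ q₁' : L} {p p' : Fin (m + 1) → L}
    (h : zcrB r a q₁ p p' = zcrB r a q₁' p p') : q₁ = q₁' :=
  const_injective (add_left_cancel h)

/-- The Wahlquist–Estabrook algebra of the Landau–Lifshitz system has the presentation
`hAlgebra`. -/
theorem exists_hAlgebra_equiv_weAlgebra (hm : 3 ≤ m + 1) (r : Fin (m + 1) → 𝕜)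
    (ha : a ∈ jetDomain 𝕜 m) : Nonempty (hAlgebra r ≃ₗ⁅𝕜⁆ WEAlgebra (landauLifshitz r) a) := by
  have : Nontrivial (Fin (m + 1)) := Fin.nontrivial_iff_two_le.2 (by omega)
  choose o ho using fun k : Fin (m + 1) => exists_ne k
  -- The classification applied to the universal solution gives `f` out of `hAlgebra r`; the
  -- explicit solution over `hAlgebra r` gives `g` in the opposite direction. Uniqueness on both
  -- sides makes them inverse.
  obtain ⟨q₀, q₁, p, h, hA, hB⟩ := (isZCR_we (r := r) ha).exists_hRel (by omega) ho ha
  obtain ⟨f, hf₀, hf₁, hf⟩ := hAlgebra.exists_lift h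
  obtain ⟨g, hgA, hgB⟩ := exists_weHom ha ((hAlgebra.hRel r).isZCR hm ho ha)
  have hA' := hgA
  rw [hA, map_zcrA] at hA'
  obtain ⟨hg₀, hg⟩ := zcrA_injective (by omega) ha hA'
  have hB' := hgB
  rw [hB, map_zcrB] at hB'
  simp only [map_gTower] at hB'
  rw [hg] at hB'
  have hg₁ := zcrB_injective hB'
  have hgf : g.comp f = LieHom.id := by
    refine hAlgebra.hom_ext ?_ ?_ fun l => ?_
    · rw [LieHom.comp_apply, hf₀, hg₀]; rfl
    · rw [LieHom.comp_apply, hf₁, hg₁]; rfl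
    · rw [LieHom.comp_apply, hf]
      exact congrFun hg l
  have hfg : f.comp g = LieHom.id := by
    refine weHom_ext (r := r) (a := a) ?_ ?_
    · change map f (map g (weA r a)) = weA r a
      rw [hgA, map_zcrA, hf₀, hA]
      simp only [hf]
    · change map f (map g (weB r a)) = weB r a
      rw [hgB, map_zcrB, hf₁, hB]
      simp only [map_gTower, hf]
  exact ⟨LieEquiv.ofBijective f ⟨Function.LeftInverse.injective (g := g)
    (DFunLike.congr_fun hgf), fun y => ⟨g y, DFunLike.congr_fun hfg y⟩⟩⟩

lemma AbelianPlane.range_eq_span {f : AbelianPlane 𝕜 → L} {x y : L}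
    (h : ∀ s t : 𝕜, f (AbelianPlane.mk s t) = s • x + t • y) :
    Set.range f = (Submodule.span 𝕜 {x, y} : Set L) := by
  ext z
  rw [SetLike.mem_coe, Submodule.mem_span_pair]
  constructor
  · rintro ⟨⟨s, t⟩, rfl⟩
    exact ⟨s, t, (h s t).symm⟩
  · rintro ⟨s, t, rfl⟩
    exact ⟨_, h s t⟩

lemma gAlgebra.range_eq_lieSpan {n : ℕ} {r : Fin n → 𝕜} (f : gAlgebra r →ₗ⁅𝕜⁆ L) :
    Set.range f = (LieSubalgebra.lieSpan 𝕜 L (Set.range fun l => f (gAlgebra.p r l)) : Set L) := by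
  refine Set.Subset.antisymm ?_ ?_
  · rintro _ ⟨y, rfl⟩
    refine PresentedLieAlgebra.eq_top_of_gen_mem ((LieSubalgebra.lieSpan 𝕜 L
      (Set.range fun l => f (gAlgebra.p r l))).comap f) (fun l => ?_) y
    exact LieSubalgebra.subset_lieSpan ⟨l, rfl⟩
  · have : LieSubalgebra.lieSpan 𝕜 L (Set.range fun l => f (gAlgebra.p r l)) ≤ f.range := by
      refine LieSubalgebra.lieSpan_le.2 ?_
      rintro _ ⟨l, rfl⟩
      exact ⟨_, rfl⟩
    exact this

/-- The inclusion of the second factor of a product of Lie algebras. -/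
def LieHom.inrProd (L L' : Type*) [LieRing L] [LieAlgebra 𝕜 L] [LieRing L'] [LieAlgebra 𝕜 L'] :
    L' →ₗ⁅𝕜⁆ L × L' where
  toFun y := (0, y)
  map_add' _ _ := Prod.ext (add_zero _).symm rfl
  map_smul' _ _ := Prod.ext (smul_zero _).symm rfl
  map_lie' := Prod.ext (lie_self _).symm rfl

/-- An isomorphism of Lie algebras acts on the second factor of a product. -/
def LieEquiv.prodRight (M : Type*) [LieRing M] [LieAlgebra 𝕜 M] (e : L ≃ₗ⁅𝕜⁆ L') :
    (M × L) ≃ₗ⁅𝕜⁆ M × L' where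
  toFun z := (z.1, e z.2)
  invFun z := (z.1, e.symm z.2)
  map_add' _ _ := Prod.ext rfl (map_add e _ _)
  map_smul' _ _ := Prod.ext rfl (map_smul e _ _)
  map_lie' := Prod.ext rfl (LieEquiv.map_lie e _ _)
  left_inv _ := Prod.ext rfl (e.symm_apply_apply _)
  right_inv _ := Prod.ext rfl (e.apply_symm_apply _)

end WEStructure

theorem theorem3p7 {𝕜 : Type*} [RCLike 𝕜] (m : ℕ) (hm : 3 ≤ m + 1)
    (r : Fin (m + 1) → 𝕜) (hr : Function.Injective r)
    (a : Fin m × ℕ → 𝕜) (ha : a ∈ jetDomain 𝕜 m) :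
    ∃ e : hAlgebra r ≃ₗ⁅𝕜⁆ WEAlgebra (landauLifshitz r) a,
      (∃ φ : (AbelianPlane 𝕜 × gAlgebra r) ≃ₗ⁅𝕜⁆ WEAlgebra (landauLifshitz r) a,
        (∀ s t : 𝕜, φ (AbelianPlane.mk s t, 0) =
          s • e (hAlgebra.p r 0) + t • e (hAlgebra.p r (Fin.last (m + 2)))) ∧
        (∀ l : Fin (m + 1), φ (0, gAlgebra.p r l) = e (hAlgebra.p r l.succ.castSucc)) ∧
        Set.range (fun z : AbelianPlane 𝕜 => φ (z, 0)) =
          (Submodule.span 𝕜 {e (hAlgebra.p r 0), e (hAlgebra.p r (Fin.last (m + 2)))} :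
            Set (WEAlgebra (landauLifshitz r) a)) ∧
        Set.range (fun y : gAlgebra r => φ (0, y)) =
          (LieSubalgebra.lieSpan 𝕜 (WEAlgebra (landauLifshitz r) a)
            (Set.range fun l : Fin (m + 1) => e (hAlgebra.p r l.succ.castSucc)) :
            Set (WEAlgebra (landauLifshitz r) a))) ∧
      (∃ ψ : (AbelianPlane 𝕜 × curveAlgebra r) ≃ₗ⁅𝕜⁆ WEAlgebra (landauLifshitz r) a,
        (∀ s t : 𝕜, ψ (AbelianPlane.mk s t, 0) =
          s • e (hAlgebra.p r 0) + t • e (hAlgebra.p r (Fin.last (m + 2)))) ∧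
        (∀ l : Fin (m + 1),
          ψ (0, curveAlgebra.Q r l) = e (hAlgebra.p r l.succ.castSucc))) := by
  obtain ⟨e⟩ := exists_hAlgebra_equiv_weAlgebra hm r ha
  obtain ⟨d, hd₀, hd⟩ := exists_hAlgebra_equiv r
  obtain ⟨c, hc⟩ := exists_gAlgebra_equiv hm r
  obtain ⟨φ, hφ'⟩ : ∃ φ : (AbelianPlane 𝕜 × gAlgebra r) ≃ₗ⁅𝕜⁆ WEAlgebra (landauLifshitz r) a,
      ∀ z, φ z = e (d z) := ⟨d.trans e, fun _ => rfl⟩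
  have hφ₀ (s t : 𝕜) : φ (AbelianPlane.mk s t, 0) =
      s • e (hAlgebra.p r 0) + t • e (hAlgebra.p r (Fin.last (m + 2))) := by
    rw [hφ', hd₀, map_add, map_smul, map_smul]
  have hφ (l : Fin (m + 1)) : φ (0, gAlgebra.p r l) = e (hAlgebra.p r l.succ.castSucc) := by
    rw [hφ', hd]
  refine ⟨e, ⟨φ, hφ₀, hφ, AbelianPlane.range_eq_span hφ₀, ?_⟩,
    (LieEquiv.prodRight (AbelianPlane 𝕜) c.symm).trans φ, fun s t => ?_, fun l => ?_⟩
  · have h := gAlgebra.range_eq_lieSpan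
      (φ.toLieHom.comp (LieHom.inrProd (AbelianPlane 𝕜) (gAlgebra r)))
    simp only [← hφ]
    exact h
  · refine Eq.trans (congrArg φ ?_) (hφ₀ s t)
    exact Prod.ext rfl (map_zero c.symm)
  · refine Eq.trans (congrArg φ ?_) (hφ l)
    exact Prod.ext rfl ((congrArg c.symm (hc l)).symm.trans (c.symm_apply_apply _))

end
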